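/- **Setting.** Identify $T^*\mathbb R^d$ with $\mathbb R^d\times\mathbb R^d$, with Euclidean norms. For a locally Lipschitz $f:\mathbb R^k\to\mathbb R$, the Clarke generalized derivative $\partial f(a)$ is the convex hull of all limits of sequences $df(x_n)$ with $x_n\to a$ and $f$ differentiable at $x_n$. Let $T\ge 0$, let $H:[0,T]\times T^*\mathbb R^d\to\mathbb R$ be $C^2$ with compact support, let $X_{H_t}=(\partial_yH_t,-\partial_xH_t)$, let $\varphi_H^{s,t}=(X_s^t,Y_s^t)$ be the flow of $X_{H_t}$ from time $s$ to time $t$, and let $c_H=\sup|D^2H_t(x,y)|$, the supremum being over $t\in[0,T]$ and $(x,y)\in T^*\mathbb R^d$. If $c_H|t-s|<\ln 2$, the map $\alpha_s^t:(x,y)\mapsto(X_s^t(x,y),y)$ is a diffeomorphism of $T^*\mathbb R^d$, and one sets $$\phi_H^{s,t}(X,y)=\int_s^t\Big(\big(Y_s^\tau-y\big)\cdot\tfrac{d}{d\tau}X_s^\tau-H(\tau,X_s^\tau,Y_s^\tau)\Big)\,d\tau ,$$ where $(X_s^\tau,Y_s^\tau)=\varphi_H^{s,\tau}\big((\alpha_s^t)^{-1}(X,y)\big)$.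 Let $v:\mathbb R^d\to\mathbb R$ be globally Lipschitz, let $N\ge 1$ and $0\le t_0\le t_1\le\dots\le t_N\le T$ with $c_H(t_{i+1}-t_i)<\ln 2$ for all $i$. For $x\in\mathbb R^d$ and $\eta=((x_i,y_i))_{0\le i<N}\in(T^*\mathbb R^d)^N$ put, with $x_N:=x$, $$S(x,\eta)=v(x_0)+\sum_{0\le i<N}\phi_H^{t_i,t_{i+1}}(x_{i+1},y_i)+\sum_{0\le i<N}(x_{i+1}-x_i)\cdot y_i ,$$ $$Q(\eta)=-x_{N-1}\cdot y_{N-1}+\sum_{0\le i<N-1}(x_{i+1}-x_i)\cdot y_i .$$ Consider also the truncations $\theta(\eta/a)\big(S(x,\eta)-Q(\eta)\big)+Q(\eta)$, where $a>0$ and $\theta$ is a $C^\infty$ compactly supported function on $(T^*\mathbb R^d)^N$ with values in $[0,1]$, equal to $1$ near $0$. From now on let $S$ denote either the above family or any of these truncations. Let $k_\infty$ be the Morse index of $Q$, and for $b\in\mathbb R$ let $S_x^b=\{\eta: S(x,\eta)\le b\}$. A descending cycle at level $b$ is a relative singular cycle $\sigma$ of $(S_x^b,S_x^{-b})$ of dimension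 $k_\infty$, with coefficients in $\mathbb Z_2$, whose class in $H_{k_\infty}(S_x^b,S_x^{-b};\mathbb Z_2)$ is nonzero (for $b$ large this group is $\mathbb Z_2$, so $[\sigma]$ is its generator). Let $|\sigma|$ be the union of the images of the simplices of $\sigma$. The minmax function is $$R_S(x)=\inf_{\sigma}\max_{\eta\in|\sigma|}S(x,\eta),$$ the infimum being over the descending cycles at level $b$, for $b$ large. **Proposition.** The minmax function is well defined (for every $x$, for all sufficiently large $b$, descending cycles at level $b$ exist, and the above infimum is finite and does not depend on $b$) and locally Lipschitz on $\mathbb R^d$, and for every $x\in\mathbb R^d$ its Clarke generalized derivative satisfies $$\partial R_S(x)\subset\operatorname{co}\{\partial_xS(x,\eta)\mid\eta\in C(x)\},\qquad C(x)=\{\eta\mid 0\in\partial_\eta S(x,\eta),\ S(x,\eta)=R_S(x)\},$$ where $\operatorname{co}$ is the convex hull, $\partial_xS(x,\eta)$ is the differential at $x$ of the map $x'\mapsto S(x',\eta)$, and $\partial_\eta S(x,\eta)$ is the Clarke generalized derivative of $S(x,\cdot)$ at $\eta$. -/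

import Mathlib

open Set Filter Topology
open scoped ContDiff

noncomputable section

/-! ### Clarke's generalized derivative -/

/-- Clarke's generalized derivative of `f` at `a`: the convex hull of all `p` such that `(a, p)`
lies in the closure of the graph of the derivative `df` (over the differentiability points). -/
def clarkeDeriv {X : Type*} [NormedAddCommGroup X] [NormedSpace ℝ X] (f : X → ℝ) (a : X) :
    Set (X →L[ℝ] ℝ) :=
  convexHull ℝ {p | (a, p) ∈ closure
    {q : X × (X →L[ℝ] ℝ) | DifferentiableAt ℝ f q.1 ∧ q.2 = fderiv ℝ f q.1}}

/-! ### Singular chains with coefficients in `ℤ/2` and descending cycles -/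

/-- Singular `n`-chains of `X` with coefficients in `ℤ/2`. -/
abbrev SingChain (X : Type*) [TopologicalSpace X] (n : ℕ) : Type _ :=
  C(stdSimplex ℝ (Fin (n + 1)), X) →₀ ZMod 2

/-- The inclusion of the `i`-th face of the standard `(n+1)`-simplex. -/
def faceMap (n : ℕ) (i : Fin (n + 2)) :
    C(stdSimplex ℝ (Fin (n + 1)), stdSimplex ℝ (Fin (n + 2))) :=
  ⟨stdSimplex.map i.succAbove, stdSimplex.continuous_map _⟩

/-- The singular boundary operator modulo `2`. -/
def singBoundary (X : Type*) [TopologicalSpace X] (n : ℕ) :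
    SingChain X (n + 1) →ₗ[ZMod 2] SingChain X n :=
  ∑ i : Fin (n + 2), Finsupp.lmapDomain (ZMod 2) (ZMod 2) fun s => s.comp (faceMap n i)

/-- The image `|σ|` of a chain: the union of the images of its simplices. A chain of `X` is a chain
of the subspace `A` exactly when its image is contained in `A`. -/
def chainImage {X : Type*} [TopologicalSpace X] {n : ℕ} (σ : SingChain X n) : Set X :=
  ⋃ s ∈ σ.support, range s

/-- The sublevel set `f ^ a`. -/
def subLevel {X : Type*} (f : X → ℝ) (a : ℝ) : Set X := {η | f η ≤ a}

/-- `∂σ` is a chain of `A` (no condition in degree `0`). -/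
def BoundaryIn {X : Type*} [TopologicalSpace X] (A : Set X) : (n : ℕ) → SingChain X n → Prop
  | 0, _ => True
  | n + 1, σ => chainImage (singBoundary X n σ) ⊆ A

/-- `σ` is a descending cycle of `f` in degree `k` at the level `a`: a relative singular cycle of
`(f ^ a, f ^ (-a))` whose class in `H_k (f ^ a, f ^ (-a); ℤ/2)` is nonzero. (For `f` quadratic at
infinity with index `k` and `a` large, this group is `ℤ/2`: its generator is its only nonzero
element.) -/
def IsDescendingCycle {X : Type*} [TopologicalSpace X] (f : X → ℝ) (k : ℕ) (a : ℝ)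
    (σ : SingChain X k) : Prop :=
  chainImage σ ⊆ subLevel f a ∧
  BoundaryIn (subLevel f (-a)) k σ ∧
  ¬ ∃ (τ : SingChain X (k + 1)) (ρ : SingChain X k),
      chainImage τ ⊆ subLevel f a ∧ chainImage ρ ⊆ subLevel f (-a) ∧
        σ = singBoundary X k τ + ρ

/-- The set of the numbers `max_{|σ|} f`, for the descending cycles `σ` at the level `a`. -/
def cycleMaxima {X : Type*} [TopologicalSpace X] (f : X → ℝ) (k : ℕ) (a : ℝ) : Set ℝ :=
  {m | ∃ σ : SingChain X k, IsDescendingCycle f k a σ ∧ IsGreatest (f '' chainImage σ) m}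

/-- `inf max f` over the descending cycles of `(f ^ ∞, f ^ (-∞))`, that is, the value for all large
`a` of the infimum over the descending cycles at the level `a`. -/
def minmaxValue {X : Type*} [TopologicalSpace X] (f : X → ℝ) (k : ℕ) : ℝ :=
  limUnder atTop fun a : ℝ => sInf (cycleMaxima f k a)

/-- The minmax function `R_S` of a family `S` (of index `k` at infinity). -/
def minmaxFun {E X : Type*} [TopologicalSpace X] (S : E → X → ℝ) (k : ℕ) (x : E) : ℝ :=
  minmaxValue (S x) k

/-- `C(x)`: the critical points of `S (x, ·)`, in Clarke's sense, at the level `R_S (x)`. -/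
def critSet {E X : Type*} [NormedAddCommGroup X] [NormedSpace ℝ X] (S : E → X → ℝ) (k : ℕ)
    (x : E) : Set X :=
  {η | 0 ∈ clarkeDeriv (S x) η ∧ S x η = minmaxFun S k x}

/-! ### Hamiltonian flows and their generating functions -/

/-- The base `ℝ ^ d`, with the Euclidean norm. -/
abbrev Base (d : ℕ) : Type := EuclideanSpace ℝ (Fin d)

/-- `T* ℝ ^ d = ℝ ^ d × ℝ ^ d`, with the Euclidean norm. -/
abbrev Cot (d : ℕ) : Type := EuclideanSpace ℝ (Fin d ⊕ Fin d)

/-- The point `(x, y)` of `T* ℝ ^ d`. -/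
def cotMk {d : ℕ} (x y : Base d) : Cot d := WithLp.toLp 2 (Sum.elim x y)

/-- The component `x` of `(x, y)`. -/
def Cot.pos {d : ℕ} (z : Cot d) : Base d := WithLp.toLp 2 fun i => z (Sum.inl i)

/-- The component `y` of `(x, y)`. -/
def Cot.mom {d : ℕ} (z : Cot d) : Base d := WithLp.toLp 2 fun i => z (Sum.inr i)

/-- The Hamiltonian vector field `X_H = (∂_y H, -∂_x H)` at the time `t`. -/
def hamField {d : ℕ} (H : ℝ → Cot d → ℝ) (t : ℝ) (z : Cot d) : Cot d :=
  cotMk (gradient (fun y => H t (cotMk (Cot.pos z) y)) (Cot.mom z))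
    (-gradient (fun x => H t (cotMk x (Cot.mom z))) (Cot.pos z))

/-- The Hamiltonian transformation `φ_H^{s,t}`: the value at the time `t` of the solution on
`[0, T]` of Hamilton's equations which takes the value `z` at the time `s`. -/
def hamFlow {d : ℕ} (H : ℝ → Cot d → ℝ) (T s t : ℝ) (z : Cot d) : Cot d :=
  Classical.epsilon fun w => ∃ γ : ℝ → Cot d, γ s = z ∧ γ t = w ∧
    ∀ τ ∈ Icc (0 : ℝ) T, HasDerivWithinAt γ (hamField H τ (γ τ)) (Icc (0 : ℝ) T) τ

/-- `c_H = sup |D² H_t (x, y)|` over `[0, T] × T* ℝ ^ d`. -/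
def hessSup {d : ℕ} (H : ℝ → Cot d → ℝ) (T : ℝ) : ℝ :=
  ⨆ q : Icc (0 : ℝ) T × Cot d, ‖fderiv ℝ (fderiv ℝ (H q.1)) q.2‖

/-- The map `α_s^t : (x, y) ↦ (X_s^t (x, y), y)`, where `φ_H^{s,t} = (X_s^t, Y_s^t)`. -/
def alphaMap {d : ℕ} (H : ℝ → Cot d → ℝ) (T s t : ℝ) (z : Cot d) : Cot d :=
  cotMk (Cot.pos (hamFlow H T s t z)) (Cot.mom z)

/-- The generating function
`φ_s^t (X, y) = ∫_s^t ((Y_s^τ - y) · dX_s^τ/dτ - H (τ, X_s^τ, Y_s^τ)) dτ` of `φ_H^{s,t}`, along the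
trajectory `(X_s^τ, Y_s^τ) = φ_H^{s,τ} ((α_s^t)⁻¹ (X, y))`; the velocity `dX_s^τ/dτ` is the first
component of the Hamiltonian vector field. -/
def genFun {d : ℕ} (H : ℝ → Cot d → ℝ) (T s t : ℝ) (X y : Base d) : ℝ :=
  let z : Cot d := Function.invFun (alphaMap H T s t) (cotMk X y)
  ∫ τ in s..t,
    (inner ℝ (Cot.mom (hamFlow H T s τ z) - y) (Cot.pos (hamField H τ (hamFlow H T s τ z)))
      - H τ (hamFlow H T s τ z))

/-! ### The generating families -/

/-- The space of the fibre variable `η = ((x_i, y_i))_{0 ≤ i < N}`. -/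
abbrev Fibre (d N : ℕ) : Type := Fin N → Cot d

/-- The points `x_0, …, x_{N-1}` given by `η`, followed by `x_N = x`. -/
def nodes {d N : ℕ} (x : Base d) (η : Fibre d N) : Fin (N + 1) → Base d :=
  Fin.snoc (α := fun _ => Base d) (fun j => Cot.pos (η j)) x

/-- `S (x, η) = v (x_0) + ∑ φ_H^{t_i, t_{i+1}} (x_{i+1}, y_i) + ∑ (x_{i+1} - x_i) y_i`, where
`x_N = x`. -/
def genFamily {d N : ℕ} (H : ℝ → Cot d → ℝ) (T : ℝ) (v : Base d → ℝ) (t : Fin (N + 1) → ℝ)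
    (x : Base d) (η : Fibre d N) : ℝ :=
  v (nodes x η 0)
    + ∑ i : Fin N, genFun H T (t i.castSucc) (t i.succ) (nodes x η i.succ) (Cot.mom (η i))
    + ∑ i : Fin N, inner ℝ (nodes x η i.succ - nodes x η i.castSucc) (Cot.mom (η i))

/-- The linear map `η ↦ x_j`, where `x_N = 0`. -/
def nodeLin (d N : ℕ) (j : Fin (N + 1)) : Fibre d N →ₗ[ℝ] Base d where
  toFun η := nodes 0 η j
  map_add' η ζ := by
    refine Fin.lastCases ?_ (fun i => ?_) j <;> simp [nodes] <;> rfl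
  map_smul' c η := by
    refine Fin.lastCases ?_ (fun i => ?_) j <;> simp [nodes] <;> rfl

/-- The linear map `η ↦ y_i`. -/
def momLin (d N : ℕ) (i : Fin N) : Fibre d N →ₗ[ℝ] Base d where
  toFun η := Cot.mom (η i)
  map_add' _ _ := rfl
  map_smul' _ _ := rfl

/-- The quadratic form `Q (η) = - x_{N-1} y_{N-1} + ∑_{i < N-1} (x_{i+1} - x_i) y_i`. -/
def quadInfty (d N : ℕ) : QuadraticForm ℝ (Fibre d N) :=
  LinearMap.BilinMap.toQuadraticMap
    (∑ i : Fin N, (innerₗ (Base d)).compl₁₂ (nodeLin d N i.succ - nodeLin d N i.castSucc)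
      (momLin d N i))

theorem quadInfty_apply (d N : ℕ) (η : Fibre d N) :
    quadInfty d N η
      = ∑ i : Fin N, inner ℝ (nodes 0 η i.succ - nodes 0 η i.castSucc) (Cot.mom (η i)) := by
  simp only [quadInfty, LinearMap.BilinMap.toQuadraticMap_apply, LinearMap.sum_apply]
  rfl

/-- The Morse index of `Q`. -/
def indexInfty (d N : ℕ) : ℕ := sigNeg (quadInfty d N)

/-- The truncated family `θ (η / a) (S (x, η) - Q (η)) + Q (η)`. -/
def truncFamily {d N : ℕ} (θ : Fibre d N → ℝ) (a : ℝ) (S : Base d → Fibre d N → ℝ)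
    (x : Base d) (η : Fibre d N) : ℝ :=
  θ (a⁻¹ • η) * (S x η - quadInfty d N η) + quadInfty d N η

/-- The families under consideration: `S` itself and its truncations `S_K`. -/
def IsFamily {d N : ℕ} (H : ℝ → Cot d → ℝ) (T : ℝ) (v : Base d → ℝ) (t : Fin (N + 1) → ℝ)
    (F : Base d → Fibre d N → ℝ) : Prop :=
  F = genFamily H T v t ∨
  ∃ (θ : Fibre d N → ℝ) (a : ℝ), ContDiff ℝ ∞ θ ∧ HasCompactSupport θ ∧
    (∀ η, θ η ∈ Icc (0 : ℝ) 1) ∧ (∀ᶠ η in 𝓝 0, θ η = 1) ∧ 0 < a ∧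
    F = truncFamily θ a (genFamily H T v t)

end

/-! In suitable linear coordinates (p, q) the form Q is |p|² − |q|². The difference S − Q is
Lipschitz in η, locally uniformly in x, because each generating function has bounded Lipschitz
partial gradients: by the first variation of the action these are Y − y and x − X, and the condition
c_H |t − s| < ln 2 makes α_s^t the identity plus a contraction. Hence every S(x, ·) is tame
(`IsTame`): shrinking p outside a ball of radius L, or dilating q outside such a ball, decreases it.
Truncation preserves this, the cutoff being supported in a ball.

For a tame function, the descending cycles at a large level a are the chains in the sublevel a, with
boundary in the sublevel −a, that are not relative boundaries modulo the complement of {q = 0}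
(`Linked`; see `IsTame.linked` and `IsTame.isDescendingCycle`). Linking mentions neither the
function nor the level, so a cycle found for one x can serve for its neighbours. Linked cycles exist
by a mod 2 Sperner lemma (`stdSimplex.sperner`, `SingChain.not_isRelBoundary_single`). They meet {q
= 0}, where the function is bounded below, so the minmax is finite; dilating q shows that it does
not depend on the level. Squeezing cycles into the tube |p| ≤ L reduces the comparison of S(x, ·)
with S(x', ·) to a compact box, whence the local Lipschitz property.

For the inclusion, separation by hyperplanes reduces the matter to a one-sided estimate
(`IsTameFamily.eventually_minmaxFun_le`): if ∂_xS · e < u < u' on C(x₀), then R(x + se) ≤ R(x) + su'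
for x near x₀ and small s > 0. Take an almost optimal cycle for x. The points at level R(x₀) where
∂_xS · e ≥ u are not Clarke critical, so finitely many small pushes in descent directions move them
down (`exists_isDescent`). Since S(x, ·) − S(x₀, ·) has a small Lipschitz constant in η, the same
deformation does not increase S(x, ·). On the deformed cycle a point is then either well below the
minmax level, or satisfies ∂_xS · e < u, and moving from x to x + se costs at most su'. The descent
directions come from Rademacher's theorem and Fubini (`apply_add_smul_le`). -/

noncomputable section

/-! ### Chains of tuples modulo `2` -/

/-- Formal sums modulo `2` of `n`-tuples of points of `V`. -/
abbrev TupleChain (V : Type*) (n : ℕ) : Type _ := (Fin n → V) →₀ ZMod 2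

namespace TupleChain

variable {V V' V'' : Type*} {n : ℕ}

theorem add_self_mod_two {M : Type*} [AddCommGroup M] [Module (ZMod 2) M] (c : M) : c + c = 0 := by
  rw [← two_smul (ZMod 2) c, show (2 : ZMod 2) = 0 from rfl, zero_smul]

/-- The boundary operator. -/
def bdry (V : Type*) (n : ℕ) : TupleChain V (n + 1) →ₗ[ZMod 2] TupleChain V n :=
  ∑ i : Fin (n + 1), Finsupp.lmapDomain (ZMod 2) (ZMod 2) fun w j => w (i.succAbove j)

/-- The cone with apex `b`. -/
def cone (b : V) (n : ℕ) : TupleChain V n →ₗ[ZMod 2] TupleChain V (n + 1) :=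
  Finsupp.lmapDomain (ZMod 2) (ZMod 2) fun w => Fin.cons b w

/-- The push-forward under a map. -/
def push (f : V → V') (n : ℕ) : TupleChain V n →ₗ[ZMod 2] TupleChain V' n :=
  Finsupp.lmapDomain (ZMod 2) (ZMod 2) fun w => f ∘ w

@[simp] theorem bdry_single (w : Fin (n + 1) → V) :
    bdry V n (Finsupp.single w 1) =
      ∑ i : Fin (n + 1), Finsupp.single (fun j => w (i.succAbove j)) 1 := by
  simp [bdry, LinearMap.sum_apply]

@[simp] theorem cone_single (b : V) (w : Fin n → V) :
    cone b n (Finsupp.single w 1) = Finsupp.single (Fin.cons b w : Fin (n + 1) → V) 1 := by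
  simp [cone]

@[simp] theorem push_single (f : V → V') (w : Fin n → V) :
    push f n (Finsupp.single w 1) = Finsupp.single (f ∘ w) 1 := by
  simp [push]

theorem push_comp (f : V → V') (g : V' → V'') :
    push g n ∘ₗ push f n = push (g ∘ f) n := by
  ext w : 2
  simp [Function.comp_assoc]

theorem push_push (f : V → V') (g : V' → V'') (c : TupleChain V n) :
    push g n (push f n c) = push (g ∘ f) n c :=
  LinearMap.congr_fun (push_comp f g) c

theorem bdry_push (f : V → V') (c : TupleChain V (n + 1)) :
    bdry V' n (push f (n + 1) c) = push f n (bdry V n c) := by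
  refine LinearMap.congr_fun (f := bdry V' n ∘ₗ push f (n + 1)) (g := push f n ∘ₗ bdry V n) ?_ c
  ext w : 2
  simp [Function.comp_def]

theorem push_cone (f : V → V') (b : V) (c : TupleChain V n) :
    push f (n + 1) (cone b n c) = cone (f b) n (push f n c) := by
  refine LinearMap.congr_fun (f := push f (n + 1) ∘ₗ cone b n) (g := cone (f b) n ∘ₗ push f n) ?_ c
  ext w : 2
  simp only [LinearMap.comp_apply, Finsupp.lsingle_apply, cone_single, push_single]
  rw [Fin.comp_cons]

/-- Deleting the apex gives back `c`; every other face of a cone is the cone over a face. -/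
theorem bdry_cone (b : V) (c : TupleChain V (n + 1)) :
    bdry V (n + 1) (cone b (n + 1) c) = c + cone b n (bdry V n c) := by
  refine LinearMap.congr_fun (f := bdry V (n + 1) ∘ₗ cone b (n + 1))
    (g := LinearMap.id + cone b n ∘ₗ bdry V n) ?_ c
  ext w : 2
  simp only [LinearMap.comp_apply, Finsupp.lsingle_apply, cone_single, bdry_single,
    LinearMap.add_apply, LinearMap.id_apply, map_sum]
  rw [Fin.sum_univ_succ]
  congr 1
  refine Finset.sum_congr rfl fun i _ => ?_
  congr 1
  ext j
  refine Fin.cases ?_ (fun j => ?_) j <;> simp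

/-- Tuples are counted by length, so length 0 is the augmentation (degree −1) and the cone formula
has no correction term there. -/
theorem bdry_cone_zero (b : V) (c : TupleChain V 0) : bdry V 0 (cone b 0 c) = c := by
  refine LinearMap.congr_fun (f := bdry V 0 ∘ₗ cone b 0) (g := LinearMap.id) ?_ c
  ext w : 2
  simp only [LinearMap.comp_apply, Finsupp.lsingle_apply, cone_single, bdry_single,
    LinearMap.id_apply]
  rw [Fintype.sum_subsingleton _ (0 : Fin 1)]
  congr 1

theorem single_eq_cone (w : Fin (n + 1) → V) :
    (Finsupp.single w 1 : TupleChain V (n + 1)) =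
      cone (w 0) n (Finsupp.single (Fin.tail w) 1) := by
  rw [cone_single, Fin.cons_self_tail]

/-- Every tuple is the cone over its tail with its first entry as apex, so the cone formula gives
the result by induction on the length. -/
theorem bdry_bdry (c : TupleChain V (n + 2)) : bdry V n (bdry V (n + 1) c) = 0 := by
  refine LinearMap.congr_fun (f := bdry V n ∘ₗ bdry V (n + 1)) (g := 0) ?_ c
  clear c
  ext w : 2
  simp only [LinearMap.comp_apply, Finsupp.lsingle_apply, LinearMap.zero_apply]
  induction n with
  | zero =>
    rw [single_eq_cone, bdry_cone, map_add, bdry_cone_zero, add_self_mod_two]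
  | succ n ih =>
    rw [single_eq_cone, bdry_cone, map_add, bdry_cone, ← add_assoc, add_self_mod_two, ih,
      map_zero, add_zero]

/-! ### Subdivision -/

/-- The subdivision operator with apices `b`. -/
def sd (b : ∀ n, (Fin (n + 1) → V) → V) : ∀ n, TupleChain V n →ₗ[ZMod 2] TupleChain V n
  | 0 => LinearMap.id
  | n + 1 => Finsupp.linearCombination (ZMod 2) fun w =>
      cone (b n w) n (sd b n (bdry V n (Finsupp.single w 1)))

theorem sd_succ_single (b : ∀ n, (Fin (n + 1) → V) → V) (w : Fin (n + 1) → V) :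
    sd b (n + 1) (Finsupp.single w 1) =
      cone (b n w) n (sd b n (bdry V n (Finsupp.single w 1))) := by
  simp [sd]

/-- In the cone formula the correction term is the boundary of a subdivided boundary, which vanishes
by the same identity one degree lower. -/
theorem bdry_sd (b : ∀ n, (Fin (n + 1) → V) → V) (c : TupleChain V (n + 1)) :
    bdry V n (sd b (n + 1) c) = sd b n (bdry V n c) := by
  refine LinearMap.congr_fun (f := bdry V n ∘ₗ sd b (n + 1)) (g := sd b n ∘ₗ bdry V n) ?_ c
  clear c
  ext w : 2
  simp only [LinearMap.comp_apply, Finsupp.lsingle_apply]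
  induction n with
  | zero => rw [sd_succ_single, bdry_cone_zero]
  | succ n ih =>
    have key : ∀ c, bdry V n (sd b (n + 1) c) = sd b n (bdry V n c) := fun c =>
      LinearMap.congr_fun (f := bdry V n ∘ₗ sd b (n + 1)) (g := sd b n ∘ₗ bdry V n)
        (by ext w : 2; simpa using ih w) c
    rw [sd_succ_single, bdry_cone, key, bdry_bdry, map_zero, map_zero, add_zero]

theorem push_sd {b : ∀ n, (Fin (n + 1) → V) → V} {b' : ∀ n, (Fin (n + 1) → V') → V'} {f : V → V'}
    (hf : ∀ n w, f (b n w) = b' n (f ∘ w)) (c : TupleChain V n) :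
    push f n (sd b n c) = sd b' n (push f n c) := by
  refine LinearMap.congr_fun (f := push f n ∘ₗ sd b n) (g := sd b' n ∘ₗ push f n) ?_ c
  induction n with
  | zero => rfl
  | succ n ih =>
    ext w : 2
    simp only [LinearMap.comp_apply, Finsupp.lsingle_apply, push_single]
    rw [sd_succ_single, sd_succ_single, push_cone, hf, ← push_single, bdry_push]
    congr 1
    exact LinearMap.congr_fun (ih 0) _

/-- The iterated subdivision operator. -/
def sdIter (b : ∀ n, (Fin (n + 1) → V) → V) (n m : ℕ) : TupleChain V n → TupleChain V n :=
  (sd b n)^[m]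

theorem bdry_sdIter (b : ∀ n, (Fin (n + 1) → V) → V) (m : ℕ) (c : TupleChain V (n + 1)) :
    bdry V n (sdIter b (n + 1) m c) = sdIter b n m (bdry V n c) := by
  induction m generalizing c with
  | zero => rfl
  | succ m ih => rw [sdIter, sdIter, Function.iterate_succ_apply, Function.iterate_succ_apply,
      ← bdry_sd]; exact ih _

theorem push_sdIter {b : ∀ n, (Fin (n + 1) → V) → V} {b' : ∀ n, (Fin (n + 1) → V') → V'}
    {f : V → V'} (hf : ∀ n w, f (b n w) = b' n (f ∘ w)) (m : ℕ) (c : TupleChain V n) :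
    push f n (sdIter b n m c) = sdIter b' n m (push f n c) := by
  induction m generalizing c with
  | zero => rfl
  | succ m ih => rw [sdIter, sdIter, Function.iterate_succ_apply, Function.iterate_succ_apply,
      ← push_sd hf]; exact ih _

theorem sdIter_sum (b : ∀ n, (Fin (n + 1) → V) → V) (m : ℕ) {ι : Type*} (s : Finset ι)
    (c : ι → TupleChain V n) : sdIter b n m (∑ i ∈ s, c i) = ∑ i ∈ s, sdIter b n m (c i) := by
  have : sdIter b n m = ⇑((sd b n) ^ m) := (Module.End.coe_pow _ _).symm
  rw [this, map_sum]

/-! ### Supports -/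

/-- All the tuples of `c` satisfy `p`. -/
def All (p : (Fin n → V) → Prop) (c : TupleChain V n) : Prop := ∀ w ∈ c.support, p w

theorem All.single {p : (Fin n → V) → Prop} {w : Fin n → V} (h : p w) :
    All p (Finsupp.single w 1) := by
  intro w' hw'
  rw [Finset.mem_singleton.1 (Finsupp.support_single_subset hw')]
  exact h

theorem All.sum {p : (Fin n → V) → Prop} {ι : Type*} {s : Finset ι} {c : ι → TupleChain V n}
    (h : ∀ i ∈ s, All p (c i)) : All p (∑ i ∈ s, c i) := by
  classical
  intro w hw
  obtain ⟨i, hi, hwi⟩ := Finset.mem_biUnion.1 (Finsupp.support_finsetSum hw)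
  exact h i hi w hwi

/-- A linear operator preserves a property of the tuples if it does so on single tuples. -/
theorem All.map {n' : ℕ} {p : (Fin n → V) → Prop} {p' : (Fin n' → V') → Prop}
    {f : TupleChain V n →ₗ[ZMod 2] TupleChain V' n'} {c : TupleChain V n} (hc : All p c)
    (h : ∀ w, p w → All p' (f (Finsupp.single w 1))) : All p' (f c) := by
  rw [← c.sum_single, Finsupp.sum, map_sum]
  refine All.sum fun w hw => ?_
  have : Finsupp.single w (c w) = c w • (Finsupp.single w 1 : TupleChain V n) := by simp
  rw [this, map_smul]
  exact fun w' hw' => h w (hc w hw) w' (Finsupp.support_smul hw')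

/-! ### The mesh of subdivisions -/

section Mesh

variable {M : Type*} [PseudoMetricSpace M]

/-- Every ball which contains the points of `w` contains `v`. -/
def InHull (w : Fin n → M) (v : M) : Prop := ∀ y r, (∀ i, dist (w i) y ≤ r) → dist v y ≤ r

/-- The points `b n w` are barycenters, as far as distances are concerned. -/
structure IsBary (b : ∀ n, (Fin (n + 1) → M) → M) : Prop where
  inHull : ∀ n w, InHull w (b n w)
  dist_le : ∀ n w D, (∀ i j, dist (w i) (w j) ≤ D) → ∀ i,
    dist (b n w) (w i) ≤ (n : ℝ) / (n + 1) * D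

/-- The new simplices join the barycenter to subdivided faces. The hull condition is carried through
the induction because it transfers the bound on the distance from the barycenter to the entries of
`w` to all vertices of those subdivided faces. -/
theorem IsBary.sd_single {b : ∀ n, (Fin (n + 1) → M) → M} (hb : IsBary b) {D : ℝ} (hD : 0 ≤ D)
    (w : Fin n → M) (hw : ∀ i j, dist (w i) (w j) ≤ D) :
    All (fun u : Fin n → M => (∀ i, InHull w (u i)) ∧
      ∀ i j, dist (u i) (u j) ≤ ((n - 1 : ℝ) / n) * D) (sd b n (Finsupp.single w 1)) := by
  induction n with
  | zero => exact fun u _ => ⟨fun i => i.elim0, fun i => i.elim0⟩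
  | succ n ih =>
    rw [sd_succ_single, bdry_single, map_sum, map_sum]
    refine All.sum fun k _ => ?_
    refine All.map (p := fun u : Fin n → M => (∀ i, InHull w (u i)) ∧
      (∀ i j, dist (u i) (u j) ≤ (n : ℝ) / (n + 1) * D) ∧
      ∀ i, dist (u i) (b n w) ≤ (n : ℝ) / (n + 1) * D) ?_ ?_
    · intro u hu
      obtain ⟨h1, h2⟩ := ih (fun j => w (k.succAbove j)) (fun i j => hw _ _) u hu
      refine ⟨fun i y r h => h1 i y r fun _ => h _, fun i j => (h2 i j).trans ?_, fun i =>
        h1 i _ _ fun j => by rw [dist_comm]; exact hb.dist_le n w D hw _⟩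
      refine mul_le_mul_of_nonneg_right ?_ hD
      have : 0 < n := i.pos
      have : (0 : ℝ) < n := by exact_mod_cast this
      rw [div_le_div_iff₀ this (by positivity)]
      nlinarith
    · rintro u ⟨h1, h2, h3⟩
      rw [cone_single]
      refine All.single ⟨fun i => ?_, fun i j => ?_⟩
      · refine Fin.cases ?_ (fun i => ?_) i
        · simpa using hb.inHull n w
        · simpa using h1 i
      · push_cast
        have hn : 0 ≤ (n : ℝ) / (n + 1) * D := by positivity
        refine Fin.cases ?_ (fun i => ?_) i <;> refine Fin.cases ?_ (fun j => ?_) j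
        · simpa using hn
        · simpa [dist_comm] using h3 j
        · simpa using h3 i
        · simpa using h2 i j

theorem IsBary.sdIter {b : ∀ n, (Fin (n + 1) → M) → M} (hb : IsBary b) {D : ℝ} (hD : 0 ≤ D)
    (w : Fin n → M) (hw : ∀ i j, dist (w i) (w j) ≤ D) (m : ℕ) :
    All (fun u : Fin n → M => ∀ i j, dist (u i) (u j) ≤ ((n - 1 : ℝ) / n) ^ m * D)
      (sdIter b n m (Finsupp.single w 1)) := by
  rcases Nat.eq_zero_or_pos n with rfl | hn
  · exact fun u _ i => i.elim0
  induction m with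
  | zero => exact All.single (by simpa using hw)
  | succ m ih =>
    rw [TupleChain.sdIter, Function.iterate_succ_apply']
    refine All.map ih fun u hu => ?_
    have h1 : (1 : ℝ) ≤ n := by exact_mod_cast hn
    have h2 : 0 ≤ ((n - 1 : ℝ) / n) := div_nonneg (by linarith) (by linarith)
    intro u' hu'
    have := (hb.sd_single (by positivity) u hu u' hu').2
    intro i j
    rw [pow_succ', mul_assoc]
    exact this i j

theorem IsBary.exists_small {b : ∀ n, (Fin (n + 1) → M) → M} (hb : IsBary b) {D : ℝ} (hD : 0 ≤ D)
    (w : Fin n → M) (hw : ∀ i j, dist (w i) (w j) ≤ D) {ε : ℝ} (hε : 0 < ε) :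
    ∀ᶠ m in atTop, All (fun u : Fin n → M => ∀ i j, dist (u i) (u j) < ε)
      (TupleChain.sdIter b n m (Finsupp.single w 1)) := by
  rcases Nat.eq_zero_or_pos n with rfl | hn
  · exact Eventually.of_forall fun m u _ i => i.elim0
  have h1 : (1 : ℝ) ≤ n := by exact_mod_cast hn
  have h2 : 0 ≤ ((n - 1 : ℝ) / n) := div_nonneg (by linarith) (by linarith)
  have h3 : ((n - 1 : ℝ) / n) < 1 := by rw [div_lt_one (by linarith)]; linarith
  have := (tendsto_pow_atTop_nhds_zero_of_lt_one h2 h3).mul_const D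
  rw [zero_mul] at this
  filter_upwards [this.eventually (gt_mem_nhds hε)] with m hm
  exact fun u hu i j => (hb.sdIter hD w hw m u hu i j).trans_lt hm

end Mesh

end TupleChain

end

noncomputable section

/-! ### The Sperner cochain -/

namespace TupleChain

/-- The functional on chains of tuples given by a function of tuples. -/
def functional {V : Type*} {n : ℕ} (φ : (Fin n → V) → ZMod 2) : TupleChain V n →ₗ[ZMod 2] ZMod 2 :=
  Finsupp.linearCombination (ZMod 2) φ

@[simp] theorem functional_single {V : Type*} {n : ℕ} (φ : (Fin n → V) → ZMod 2) (w : Fin n → V) :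
    functional φ (Finsupp.single w 1) = φ w := by simp [functional]

theorem functional_eq_zero {V : Type*} {n : ℕ} {φ : (Fin n → V) → ZMod 2} {c : TupleChain V n}
    (h : All (fun w => φ w = 0) c) : functional φ c = 0 := by
  rw [functional, Finsupp.linearCombination_apply, Finsupp.sum]
  exact Finset.sum_eq_zero fun w hw => by rw [h w hw, smul_zero]

/-- `1` for the tuples of labels which are permutations, and `0` for the others. -/
def labelDet {n : ℕ} (w : Fin n → Fin n) : ZMod 2 :=
  (Matrix.of fun i j => if w j = i then (1 : ZMod 2) else 0).det

/-- The same, for tuples of `n` labels among `n + 1`, when the label `0` is disregarded. -/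
def labelDetSucc {n : ℕ} (w : Fin n → Fin (n + 1)) : ZMod 2 :=
  (Matrix.of fun (i : Fin n) j => if w j = i.succ then (1 : ZMod 2) else 0).det

/-- The matrix `A` with a row of ones added on top. -/
def onesRow {n : ℕ} (A : Matrix (Fin n) (Fin (n + 1)) (ZMod 2)) :
    Matrix (Fin (n + 1)) (Fin (n + 1)) (ZMod 2) :=
  Matrix.of fun i j => Fin.cases 1 (fun i => A i j) i

/-- Laplace expansion along the row of ones; the signs disappear modulo 2. -/
theorem sum_det_submatrix_succAbove {n : ℕ} (A : Matrix (Fin n) (Fin (n + 1)) (ZMod 2)) :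
    ∑ j : Fin (n + 1), (A.submatrix id j.succAbove).det = (onesRow A).det := by
  rw [Matrix.det_succ_row_zero]
  refine Finset.sum_congr rfl fun j _ => ?_
  have h1 : (-1 : ZMod 2) = 1 := rfl
  have h2 : onesRow A 0 j = 1 := rfl
  rw [h1, h2, one_pow, one_mul, one_mul]
  rfl

theorem labelDet_eq_zero {n : ℕ} {w : Fin n → Fin n} (k : Fin n) (h : ∀ j, w j ≠ k) :
    labelDet w = 0 :=
  Matrix.det_eq_zero_of_row_eq_zero k fun j => by simp [h j]

theorem labelDetSucc_eq_zero {n : ℕ} {w : Fin n → Fin (n + 1)} (k : Fin n)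
    (h : ∀ j, w j ≠ k.succ) : labelDetSucc w = 0 :=
  Matrix.det_eq_zero_of_row_eq_zero k fun j => by simp [h j]

/-- Each column of the indicator matrix contains exactly one 1, so the sum of its rows equals the
added row of ones, and modulo 2 all rows together sum to zero. -/
theorem sum_labelDet_face {n : ℕ} (w : Fin (n + 1) → Fin n) :
    ∑ i : Fin (n + 1), labelDet (fun j => w (i.succAbove j)) = 0 := by
  refine (sum_det_submatrix_succAbove
    (Matrix.of fun (i : Fin n) (j : Fin (n + 1)) => if w j = i then (1 : ZMod 2) else 0)).trans ?_
  refine Matrix.exists_vecMul_eq_zero_iff.1 ⟨fun _ => 1, ?_, ?_⟩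
  · exact fun h => one_ne_zero (congrFun h 0)
  · ext j
    simp [Matrix.vecMul, dotProduct, Fin.sum_univ_succ, onesRow]
    rfl

/-- Replacing the row of label 0 by the sum of all rows, which is a row of ones, leaves the
determinant unchanged. This passage from a simplex to its faces drives the induction in Sperner's
lemma. -/
theorem sum_labelDetSucc_face {n : ℕ} (w : Fin (n + 1) → Fin (n + 1)) :
    ∑ i : Fin (n + 1), labelDetSucc (fun j => w (i.succAbove j)) = labelDet w := by
  refine (sum_det_submatrix_succAbove
    (Matrix.of fun (i : Fin n) (j : Fin (n + 1)) =>
      if w j = i.succ then (1 : ZMod 2) else 0)).trans ?_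
  have := Matrix.det_updateRow_sum
    (Matrix.of fun (i : Fin (n + 1)) j => if w j = i then (1 : ZMod 2) else 0) 0 fun _ => 1
  rw [one_smul] at this
  rw [labelDet, ← this]
  congr 1
  ext i j
  refine Fin.cases ?_ (fun i => ?_) i
  · rw [Matrix.updateRow_self]
    simp only [one_smul]
    change 1 = (∑ k : Fin (n + 1), fun j => if w j = k then (1 : ZMod 2) else 0) j
    simp [Finset.sum_apply]
  · rw [Matrix.updateRow_ne (Fin.succ_ne_zero i)]
    rfl

theorem functional_labelDet_bdry {n : ℕ} (c : TupleChain (Fin n) (n + 1)) :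
    functional labelDet (bdry _ n c) = 0 := by
  refine LinearMap.congr_fun (f := functional labelDet ∘ₗ bdry _ n) (g := 0) ?_ c
  ext w : 2
  simpa using sum_labelDet_face w

theorem functional_labelDetSucc_bdry {n : ℕ} (c : TupleChain (Fin (n + 1)) (n + 1)) :
    functional labelDetSucc (bdry _ n c) = functional labelDet c := by
  refine LinearMap.congr_fun (f := functional labelDetSucc ∘ₗ bdry _ n)
    (g := functional labelDet) ?_ c
  ext w : 2
  simpa using sum_labelDetSucc_face w

end TupleChain

/-! ### Affine simplices in the standard simplex -/

namespace stdSimplex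

open TupleChain

variable {m n : ℕ}

/-- The affine map from the standard simplex with prescribed vertices. -/
def combo (w : Fin n → stdSimplex ℝ (Fin m)) (t : stdSimplex ℝ (Fin n)) : stdSimplex ℝ (Fin m) :=
  ⟨fun x => ∑ i, t i * w i x, fun x => Finset.sum_nonneg fun i _ =>
      mul_nonneg (stdSimplex.zero_le t i) (stdSimplex.zero_le _ x), by
    rw [Finset.sum_comm]
    simp [← Finset.mul_sum]⟩

theorem combo_apply (w : Fin n → stdSimplex ℝ (Fin m)) (t : stdSimplex ℝ (Fin n)) (x : Fin m) :
    combo w t x = ∑ i, t i * w i x := rfl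

theorem map_apply {p q : ℕ} (f : Fin p → Fin q) (t : stdSimplex ℝ (Fin p)) (y : Fin q) :
    stdSimplex.map f t y = ∑ i, if f i = y then t i else 0 := by
  rw [stdSimplex.map_coe, FunOnFinite.linearMap_apply_apply, Finset.sum_filter]

theorem map_combo {p : ℕ} (f : Fin m → Fin p) (w : Fin n → stdSimplex ℝ (Fin m))
    (t : stdSimplex ℝ (Fin n)) :
    stdSimplex.map f (combo w t) = combo (stdSimplex.map f ∘ w) t := by
  refine stdSimplex.ext (funext fun y => ?_)
  simp only [map_apply, combo_apply, Function.comp_apply, Finset.mul_sum]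
  rw [Finset.sum_comm]
  refine Finset.sum_congr rfl fun i _ => ?_
  split_ifs with h <;> simp

theorem combo_map {p : ℕ} (f : Fin p → Fin n) (w : Fin n → stdSimplex ℝ (Fin m))
    (t : stdSimplex ℝ (Fin p)) : combo w (stdSimplex.map f t) = combo (w ∘ f) t := by
  refine stdSimplex.ext (funext fun y => ?_)
  simp only [map_apply, combo_apply, Function.comp_apply, Finset.sum_mul]
  rw [Finset.sum_comm]
  refine Finset.sum_congr rfl fun i _ => ?_
  simp [ite_mul]

/-- The vertices of the standard simplex. -/
def vert (n : ℕ) (i : Fin n) : stdSimplex ℝ (Fin n) := stdSimplex.vertex i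

theorem combo_vert (t : stdSimplex ℝ (Fin n)) : combo (vert n) t = t := by
  refine stdSimplex.ext (funext fun y => ?_)
  simp only [combo_apply, vert, stdSimplex.vertex_coe, Pi.single_apply]
  simp

theorem map_comp_vert {p : ℕ} (f : Fin m → Fin p) : stdSimplex.map f ∘ vert m = vert p ∘ f := by
  funext i
  exact stdSimplex.map_vertex f i

theorem continuous_combo : Continuous fun q : (Fin n → stdSimplex ℝ (Fin m)) × stdSimplex ℝ (Fin n) =>
    combo q.1 q.2 := by
  refine Continuous.subtype_mk (continuous_pi fun x => continuous_finsetSum _ fun i _ => ?_) _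
  refine Continuous.mul ?_ ?_
  · exact (continuous_apply i).comp (continuous_subtype_val.comp continuous_snd)
  · exact (continuous_apply x).comp (continuous_subtype_val.comp
      ((continuous_apply i).comp continuous_fst))

/-- The barycenter of the vertices of an affine simplex. -/
def bary (m : ℕ) (n : ℕ) (w : Fin (n + 1) → stdSimplex ℝ (Fin m)) : stdSimplex ℝ (Fin m) :=
  combo w stdSimplex.barycenter

theorem bary_apply (w : Fin (n + 1) → stdSimplex ℝ (Fin m)) (x : Fin m) :
    bary m n w x = ∑ i, ((n : ℝ) + 1)⁻¹ * w i x := by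
  rw [bary, combo_apply]
  refine Finset.sum_congr rfl fun i _ => ?_
  have : (stdSimplex.barycenter : stdSimplex ℝ (Fin (n + 1))) i = ((n : ℝ) + 1)⁻¹ := by
    refine (stdSimplex.barycenter_apply i).trans ?_
    simp
  rw [this]

theorem dist_le_iff {x y : stdSimplex ℝ (Fin m)} {r : ℝ} (hr : 0 ≤ r) :
    dist x y ≤ r ↔ ∀ i, |x i - y i| ≤ r := by
  rw [Subtype.dist_eq, dist_pi_le_iff hr]
  rfl

theorem isBary_bary (m : ℕ) : IsBary (bary m) where
  inHull n w y r h := by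
    have hr : 0 ≤ r := dist_nonneg.trans (h 0)
    have hn : (0 : ℝ) < n + 1 := by positivity
    rw [dist_le_iff hr]
    intro x
    have h1 : bary m n w x - y x = ∑ i : Fin (n + 1), ((n : ℝ) + 1)⁻¹ * (w i x - y x) := by
      rw [bary_apply, ← Finset.mul_sum, ← Finset.mul_sum, Finset.sum_sub_distrib]
      simp
      field_simp
    rw [h1]
    refine (Finset.abs_sum_le_sum_abs _ _).trans ?_
    have h2 : ∀ i ∈ Finset.univ, |((n : ℝ) + 1)⁻¹ * (w i x - y x)| ≤ ((n : ℝ) + 1)⁻¹ * r :=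
      fun i _ => by
        rw [abs_mul, abs_of_pos (inv_pos.2 hn)]
        exact mul_le_mul_of_nonneg_left ((dist_le_iff hr).1 (h i) x) (by positivity)
    refine (Finset.sum_le_sum h2).trans ?_
    simp
    field_simp
    exact le_rfl
  dist_le n w D h k := by
    have hD : 0 ≤ D := dist_nonneg.trans (h 0 0)
    have hn : (0 : ℝ) < n + 1 := by positivity
    rw [dist_le_iff (by positivity)]
    intro x
    have h1 : bary m n w x - w k x = ∑ i : Fin (n + 1), ((n : ℝ) + 1)⁻¹ * (w i x - w k x) := by
      rw [bary_apply, ← Finset.mul_sum, ← Finset.mul_sum, Finset.sum_sub_distrib]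
      simp
      field_simp
    -- The term of index `k` vanishes; `n` terms of weight 1/(n+1) remain, which gives the
    -- contraction factor.
    rw [h1, Fin.sum_univ_succAbove _ k, sub_self, mul_zero, zero_add]
    refine (Finset.abs_sum_le_sum_abs _ _).trans ?_
    have h2 : ∀ i ∈ Finset.univ,
        |((n : ℝ) + 1)⁻¹ * (w (k.succAbove i) x - w k x)| ≤ ((n : ℝ) + 1)⁻¹ * D :=
      fun i _ => by
        rw [abs_mul, abs_of_pos (inv_pos.2 hn)]
        exact mul_le_mul_of_nonneg_left ((dist_le_iff hD).1 (h _ _) x) (by positivity)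
    refine (Finset.sum_le_sum h2).trans ?_
    simp
    field_simp
    exact le_rfl

theorem map_bary {p : ℕ} (f : Fin m → Fin p) (n : ℕ) (w : Fin (n + 1) → stdSimplex ℝ (Fin m)) :
    stdSimplex.map f (bary m n w) = bary p n (stdSimplex.map f ∘ w) :=
  map_combo f w _

/-- The iterated barycentric subdivision of the standard simplex. -/
def sdSimplex (n m : ℕ) : TupleChain (stdSimplex ℝ (Fin n)) n :=
  sdIter (bary n) n m (Finsupp.single (vert n) 1)

theorem bdry_sdSimplex (n m : ℕ) :
    bdry _ n (sdSimplex (n + 1) m) =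
      ∑ i : Fin (n + 1), push (stdSimplex.map i.succAbove) n (sdSimplex n m) := by
  rw [sdSimplex, bdry_sdIter, bdry_single, sdIter_sum]
  refine Finset.sum_congr rfl fun i _ => ?_
  rw [sdSimplex, push_sdIter (map_bary _), push_single, map_comp_vert]
  rfl

theorem sdSimplex_small {X : Type*} [PseudoMetricSpace X] (n : ℕ) {ε : ℝ} (hε : 0 < ε) :
    ∀ᶠ m in atTop, All (fun u => ∀ i j, dist (u i) (u j) < ε) (sdSimplex n m) := by
  refine (isBary_bary n).exists_small zero_le_one _ (fun i j => ?_) hε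
  rw [dist_le_iff zero_le_one]
  intro k
  rw [abs_le]
  constructor <;> linarith [stdSimplex.zero_le (vert n i) k, stdSimplex.zero_le (vert n j) k,
    stdSimplex.le_one (vert n i) k, stdSimplex.le_one (vert n j) k]

theorem map_succAbove_self (i : Fin (n + 1)) (t : stdSimplex ℝ (Fin n)) :
    stdSimplex.map i.succAbove t i = 0 := by
  rw [map_apply]
  simp [Fin.succAbove_ne]

theorem map_succAbove_succAbove (i : Fin (n + 1)) (t : stdSimplex ℝ (Fin n)) (j : Fin n) :
    stdSimplex.map i.succAbove t (i.succAbove j) = t j := by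
  rw [map_apply]
  simp

/-- **Sperner's lemma** for iterated barycentric subdivisions. -/
theorem sperner (n m : ℕ) (L : stdSimplex ℝ (Fin n) → Fin n) (hL : ∀ t : stdSimplex ℝ (Fin n), t (L t) ≠ 0) :
    functional labelDet (push L n (sdSimplex n m)) = 1 := by
  induction n with
  | zero =>
    have : sdSimplex 0 m = Finsupp.single (vert 0) 1 := by
      rw [sdSimplex, sdIter]
      exact Function.iterate_fixed rfl m
    rw [this, push_single, functional_single, labelDet, Matrix.det_isEmpty]
  | succ n ih =>
    -- The count moves to the boundary. On the face opposite to vertex k+1 the label k+1 never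
    -- occurs, so the cochain vanishes; the face opposite to vertex 0 avoids label 0 and is the
    -- previous case.
    rw [← functional_labelDetSucc_bdry, bdry_push, bdry_sdSimplex, map_sum, map_sum,
      Fin.sum_univ_succ, Finset.sum_eq_zero, add_zero]
    · have h0 : ∀ t : stdSimplex ℝ (Fin n), ∃ j : Fin n,
          L (stdSimplex.map (Fin.succAbove 0) t) = j.succ := fun t => by
        refine ⟨(L (stdSimplex.map (Fin.succAbove 0) t)).pred fun h => ?_, by simp⟩
        have := hL (stdSimplex.map (Fin.succAbove 0) t)
        rw [h] at this
        exact this (map_succAbove_self 0 t)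
      choose L' hL' using h0
      rw [push_push, ← ih L' fun t => ?_]
      · refine LinearMap.congr_fun
          (f := functional labelDetSucc ∘ₗ push (L ∘ stdSimplex.map (Fin.succAbove 0)) n)
          (g := functional labelDet ∘ₗ push L' n) ?_ (sdSimplex n m)
        ext w : 2
        simp only [LinearMap.comp_apply, Finsupp.lsingle_apply, push_single, functional_single,
          labelDet, labelDetSucc, Function.comp_apply, hL', Fin.succ_inj]
      · have := hL (stdSimplex.map (Fin.succAbove 0) t)
        rwa [hL', ← Fin.succAbove_zero, map_succAbove_succAbove] at this
    · intro k _
      rw [push_push]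
      refine functional_eq_zero ?_
      refine All.map (p := fun _ => True) (fun _ _ => trivial) fun w _ => ?_
      rw [push_single]
      refine All.single (labelDetSucc_eq_zero k fun j h => ?_)
      have := hL (stdSimplex.map k.succ.succAbove (w j))
      rw [show L (stdSimplex.map k.succ.succAbove (w j)) = k.succ from h] at this
      exact this (map_succAbove_self _ _)

end stdSimplex

end

noncomputable section

/-! ### The prism operator on chains of tuples -/

namespace TupleChain

variable {V V' : Type*} {n : ℕ}

/-- The prism operator. -/
def prism (V : Type*) : ∀ n, TupleChain V n →ₗ[ZMod 2] TupleChain (V × unitInterval) (n + 1)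
  | 0 => 0
  | n + 1 => Finsupp.linearCombination (ZMod 2) fun w =>
      cone (w 0, 0) (n + 1) (push (fun x => (x, 1)) (n + 1) (Finsupp.single w 1)
        + push (fun x => (x, 0)) (n + 1) (Finsupp.single w 1)
        + prism V n (bdry V n (Finsupp.single w 1)))

theorem prism_succ_single (w : Fin (n + 1) → V) :
    prism V (n + 1) (Finsupp.single w 1) =
      cone (w 0, 0) (n + 1) (push (fun x => (x, 1)) (n + 1) (Finsupp.single w 1)
        + push (fun x => (x, 0)) (n + 1) (Finsupp.single w 1)
        + prism V n (bdry V n (Finsupp.single w 1))) := by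
  simp [prism]

/-- The prism over `w` is a cone from its first vertex at time 0. By induction the chain that is
coned off is a cycle, so the cone formula leaves no correction. -/
theorem bdry_prism (c : TupleChain V (n + 1)) :
    bdry _ (n + 1) (prism V (n + 1) c) = push (fun x => (x, 1)) (n + 1) c
      + push (fun x => (x, 0)) (n + 1) c + prism V n (bdry V n c) := by
  refine LinearMap.congr_fun (f := bdry _ (n + 1) ∘ₗ prism V (n + 1))
    (g := push (fun x => (x, 1)) (n + 1) + push (fun x => (x, 0)) (n + 1)
      + prism V n ∘ₗ bdry V n) ?_ c
  clear c
  induction n with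
  | zero =>
    ext w : 2
    simp only [LinearMap.comp_apply, Finsupp.lsingle_apply, LinearMap.add_apply]
    rw [prism_succ_single, bdry_cone, map_add, map_add, map_add, bdry_push, bdry_push]
    -- The empty tuple carries no time coordinate, so its top and bottom copies coincide and cancel.
    have h : (push (fun x : V => (x, (1 : unitInterval))) 0) = push (fun x => (x, 0)) 0 := by
      ext w : 2
      simp only [LinearMap.comp_apply, Finsupp.lsingle_apply, push_single]
      congr 1
      exact Subsingleton.elim _ _
    rw [h, add_self_mod_two]
    simp [prism]
  | succ n ih =>
    ext w : 2
    simp only [LinearMap.comp_apply, Finsupp.lsingle_apply, LinearMap.add_apply]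
    have key := LinearMap.congr_fun ih (bdry V (n + 1) (Finsupp.single w 1))
    simp only [LinearMap.comp_apply, LinearMap.add_apply, bdry_bdry, map_zero, add_zero] at key
    rw [prism_succ_single, bdry_cone, map_add (bdry _ (n + 1)), map_add (bdry _ (n + 1)), bdry_push,
      bdry_push, key, add_self_mod_two, map_zero, add_zero]

theorem push_prism (f : V → V') (c : TupleChain V n) :
    push (Prod.map f id) (n + 1) (prism V n c) = prism V' n (push f n c) := by
  refine LinearMap.congr_fun (f := push (Prod.map f id) (n + 1) ∘ₗ prism V n)
    (g := prism V' n ∘ₗ push f n) ?_ c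
  clear c
  induction n with
  | zero => simp [prism]
  | succ n ih =>
    ext w : 2
    have key := LinearMap.congr_fun ih (bdry V n (Finsupp.single w 1))
    simp only [LinearMap.comp_apply] at key
    simp only [LinearMap.comp_apply, Finsupp.lsingle_apply]
    rw [push_single, prism_succ_single, prism_succ_single, push_cone, map_add, map_add, map_add, map_add, key,
      push_push, push_push, ← push_single, bdry_push, push_push, push_push, map_add, map_add]
    rfl

end TupleChain

/-! ### Operations on singular chains -/

namespace SingChain

open TupleChain stdSimplex

variable {X Y Z : Type*} [TopologicalSpace X] [TopologicalSpace Y] [TopologicalSpace Z] {n k : ℕ}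

theorem mem_chainImage {σ : SingChain X n} {x : X} :
    x ∈ chainImage σ ↔ ∃ s ∈ σ.support, x ∈ range s := by
  simp only [chainImage, mem_iUnion, exists_prop]

theorem range_subset_chainImage {σ : SingChain X n}
    {s : C(stdSimplex ℝ (Fin (n + 1)), X)} (hs : s ∈ σ.support) : range s ⊆ chainImage σ :=
  fun _ hx => mem_chainImage.2 ⟨s, hs, hx⟩

theorem chainImage_single_subset (s : C(stdSimplex ℝ (Fin (n + 1)), X)) :
    chainImage (Finsupp.single s 1 : SingChain X n) ⊆ range s := by
  intro x hx
  obtain ⟨s', hs', hx⟩ := mem_chainImage.1 hx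
  rwa [Finset.mem_singleton.1 (Finsupp.support_single_subset hs')] at hx

theorem chainImage_zero : chainImage (0 : SingChain X n) = ∅ := by
  simp [chainImage]

theorem chainImage_add_subset (σ τ : SingChain X n) :
    chainImage (σ + τ) ⊆ chainImage σ ∪ chainImage τ := by
  classical
  intro x hx
  obtain ⟨s, hs, hx⟩ := mem_chainImage.1 hx
  rcases Finset.mem_union.1 (Finsupp.support_add hs) with h | h
  exacts [Or.inl (mem_chainImage.2 ⟨s, h, hx⟩), Or.inr (mem_chainImage.2 ⟨s, h, hx⟩)]

theorem chainImage_sum_subset {ι : Type*} (t : Finset ι) (σ : ι → SingChain X n) {A : Set X}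
    (h : ∀ i ∈ t, chainImage (σ i) ⊆ A) : chainImage (∑ i ∈ t, σ i) ⊆ A := by
  classical
  intro x hx
  obtain ⟨s, hs, hx⟩ := mem_chainImage.1 hx
  obtain ⟨i, hi, hsi⟩ := Finset.mem_biUnion.1 (Finsupp.support_finsetSum hs)
  exact h i hi (mem_chainImage.2 ⟨s, hsi, hx⟩)

theorem chainImage_map_subset {S : Type*} {f : (S →₀ ZMod 2) →ₗ[ZMod 2] SingChain X n}
    {c : S →₀ ZMod 2} {A : Set X} (h : ∀ s ∈ c.support, chainImage (f (Finsupp.single s 1)) ⊆ A) :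
    chainImage (f c) ⊆ A := by
  rw [← c.sum_single, Finsupp.sum, map_sum]
  refine chainImage_sum_subset _ _ fun s hs => ?_
  have : Finsupp.single s (c s) = c s • (Finsupp.single s 1 : S →₀ ZMod 2) := by simp
  rw [this, map_smul]
  intro x hx
  obtain ⟨s', hs', hx⟩ := mem_chainImage.1 hx
  exact h s hs (mem_chainImage.2 ⟨s', Finsupp.support_smul hs', hx⟩)

theorem isCompact_chainImage (σ : SingChain X n) : IsCompact (chainImage σ) :=
  σ.support.isCompact_biUnion fun s _ => isCompact_range s.continuous

/-- The push-forward of singular chains. -/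
def push (f : C(X, Y)) (n : ℕ) : SingChain X n →ₗ[ZMod 2] SingChain Y n :=
  Finsupp.lmapDomain (ZMod 2) (ZMod 2) fun s => f.comp s

@[simp] theorem push_single (f : C(X, Y)) (s : C(stdSimplex ℝ (Fin (n + 1)), X)) :
    push f n (Finsupp.single s 1) = Finsupp.single (f.comp s) 1 := by
  simp [push]

theorem push_id (σ : SingChain X n) : push (ContinuousMap.id X) n σ = σ := by
  have : push (ContinuousMap.id X) n = LinearMap.id := by
    ext s : 2
    simp
  rw [this, LinearMap.id_apply]

@[simp] theorem singBoundary_single (s : C(stdSimplex ℝ (Fin (n + 2)), X)) :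
    singBoundary X n (Finsupp.single s 1) =
      ∑ i : Fin (n + 2), Finsupp.single (s.comp (faceMap n i)) 1 := by
  simp [singBoundary, LinearMap.sum_apply]

theorem singBoundary_push (f : C(X, Y)) (σ : SingChain X (n + 1)) :
    singBoundary Y n (push f (n + 1) σ) = push f n (singBoundary X n σ) := by
  refine LinearMap.congr_fun (f := singBoundary Y n ∘ₗ push f (n + 1))
    (g := push f n ∘ₗ singBoundary X n) ?_ σ
  ext s : 2
  simp [ContinuousMap.comp_assoc]

theorem chainImage_push_subset (f : C(X, Y)) (σ : SingChain X n) :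
    chainImage (push f n σ) ⊆ f '' chainImage σ := by
  refine chainImage_map_subset fun s hs => ?_
  rw [push_single]
  refine (chainImage_single_subset _).trans ?_
  rintro _ ⟨t, rfl⟩
  exact ⟨s t, range_subset_chainImage hs ⟨t, rfl⟩, rfl⟩

theorem boundaryIn_push {A : Set X} {B : Set Y} (f : C(X, Y)) (hf : MapsTo f A B)
    {σ : SingChain X n} (hσ : BoundaryIn A n σ) : BoundaryIn B n (push f n σ) := by
  cases n with
  | zero => trivial
  | succ n =>
    refine Subset.trans ?_ (hf.image_subset)
    rw [singBoundary_push]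
    exact (chainImage_push_subset _ _).trans (image_mono hσ)

theorem boundaryIn_mono {A B : Set X} (h : A ⊆ B) {σ : SingChain X n} (hσ : BoundaryIn A n σ) :
    BoundaryIn B n σ := by
  cases n with
  | zero => trivial
  | succ n => exact Subset.trans (show chainImage (singBoundary X n σ) ⊆ A from hσ) h

/-! ### The prism operator on singular chains -/

/-- The affine simplex of `Δ × [0, 1]` with prescribed vertices. -/
def realize (w : Fin (k + 1) → stdSimplex ℝ (Fin (n + 1)) × unitInterval) :
    C(stdSimplex ℝ (Fin (k + 1)), stdSimplex ℝ (Fin (n + 1)) × unitInterval) where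
  toFun t := (combo (fun i => (w i).1) t, ⟨∑ i, t i * (w i).2, by
    refine ⟨Finset.sum_nonneg fun i _ => mul_nonneg (stdSimplex.zero_le t i) (w i).2.2.1, ?_⟩
    rw [← stdSimplex.sum_eq_one t]
    exact Finset.sum_le_sum fun i _ =>
      mul_le_of_le_one_right (stdSimplex.zero_le t i) (w i).2.2.2⟩)
  continuous_toFun := by
    refine Continuous.prodMk ?_ (Continuous.subtype_mk (continuous_finsetSum _ fun i _ => ?_) _)
    · exact continuous_combo.comp (Continuous.prodMk continuous_const continuous_id)
    · exact ((continuous_apply i).comp continuous_subtype_val).mul continuous_const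

theorem realize_comp_faceMap (w : Fin (k + 2) → stdSimplex ℝ (Fin (n + 1)) × unitInterval)
    (i : Fin (k + 2)) :
    (realize w).comp (faceMap k i) = realize fun j => w (i.succAbove j) := by
  ext1 t
  refine Prod.ext ?_ (Subtype.ext ?_)
  · exact combo_map _ _ _
  · change ∑ j, stdSimplex.map i.succAbove t j * ((w j).2 : ℝ)
      = ∑ j, t j * ((w (i.succAbove j)).2 : ℝ)
    rw [Fin.sum_univ_succAbove _ i, map_succAbove_self, zero_mul, zero_add]
    simp only [map_succAbove_succAbove]

/-- The chain of `Y` given by a chain of affine simplices of `Δ × [0, 1]`. -/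
def realizeChain (h : C(X × unitInterval, Y)) (s : C(stdSimplex ℝ (Fin (n + 1)), X)) (k : ℕ) :
    TupleChain (stdSimplex ℝ (Fin (n + 1)) × unitInterval) (k + 1) →ₗ[ZMod 2] SingChain Y k :=
  Finsupp.lmapDomain (ZMod 2) (ZMod 2) fun w =>
    (h.comp (s.prodMap (ContinuousMap.id _))).comp (realize w)

@[simp] theorem realizeChain_single (h : C(X × unitInterval, Y))
    (s : C(stdSimplex ℝ (Fin (n + 1)), X))
    (w : Fin (k + 1) → stdSimplex ℝ (Fin (n + 1)) × unitInterval) :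
    realizeChain h s k (Finsupp.single w 1) =
      Finsupp.single ((h.comp (s.prodMap (ContinuousMap.id _))).comp (realize w)) 1 := by
  simp [realizeChain]

theorem singBoundary_realizeChain (h : C(X × unitInterval, Y))
    (s : C(stdSimplex ℝ (Fin (n + 1)), X))
    (c : TupleChain (stdSimplex ℝ (Fin (n + 1)) × unitInterval) (k + 2)) :
    singBoundary Y k (realizeChain h s (k + 1) c) = realizeChain h s k (bdry _ _ c) := by
  refine LinearMap.congr_fun (f := singBoundary Y k ∘ₗ realizeChain h s (k + 1))
    (g := realizeChain h s k ∘ₗ bdry _ _) ?_ c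
  ext w : 2
  simp only [LinearMap.comp_apply, Finsupp.lsingle_apply, realizeChain_single, bdry_single,
    singBoundary_single, map_sum, ContinuousMap.comp_assoc, realize_comp_faceMap]

theorem realizeChain_face (h : C(X × unitInterval, Y))
    (s : C(stdSimplex ℝ (Fin (n + 2)), X)) (i : Fin (n + 2))
    (c : TupleChain (stdSimplex ℝ (Fin (n + 1)) × unitInterval) (k + 1)) :
    realizeChain h s k (TupleChain.push (Prod.map (stdSimplex.map i.succAbove) id) (k + 1) c) =
      realizeChain h (s.comp (faceMap n i)) k c := by
  refine LinearMap.congr_fun (f := realizeChain h s k ∘ₗ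
    TupleChain.push (Prod.map (stdSimplex.map i.succAbove) id) (k + 1))
    (g := realizeChain h (s.comp (faceMap n i)) k) ?_ c
  ext w : 2
  simp only [LinearMap.comp_apply, Finsupp.lsingle_apply, TupleChain.push_single,
    realizeChain_single]
  congr 1
  ext1 t
  have : combo (fun j => stdSimplex.map i.succAbove (w j).1) t =
      stdSimplex.map i.succAbove (combo (fun j => (w j).1) t) :=
    (map_combo i.succAbove (fun j => (w j).1) t).symm
  change h (s (combo (fun j => stdSimplex.map i.succAbove (w j).1) t), _) = _
  rw [this]
  rfl

/-- The prism operator of a homotopy. -/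
def prism (h : C(X × unitInterval, Y)) (n : ℕ) : SingChain X n →ₗ[ZMod 2] SingChain Y (n + 1) :=
  Finsupp.linearCombination (ZMod 2) fun s =>
    realizeChain h s (n + 1) (TupleChain.prism _ (n + 1) (Finsupp.single (vert (n + 1)) 1))

@[simp] theorem prism_single (h : C(X × unitInterval, Y)) (s : C(stdSimplex ℝ (Fin (n + 1)), X)) :
    prism h n (Finsupp.single s 1) = realizeChain h s (n + 1)
      (TupleChain.prism _ (n + 1) (Finsupp.single (vert (n + 1)) 1)) := by
  simp [prism]

theorem chainImage_prism_subset (h : C(X × unitInterval, Y)) (σ : SingChain X n) :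
    chainImage (prism h n σ) ⊆ h '' (chainImage σ ×ˢ univ) := by
  refine chainImage_map_subset fun s hs => ?_
  rw [prism_single]
  refine chainImage_map_subset fun w _ => ?_
  rw [realizeChain_single]
  refine (chainImage_single_subset _).trans ?_
  rintro _ ⟨t, rfl⟩
  exact ⟨_, ⟨range_subset_chainImage hs ⟨(realize w t).1, rfl⟩, mem_univ (realize w t).2⟩, rfl⟩

/-- The map at the time `t` of a homotopy. -/
def slice (h : C(X × unitInterval, Y)) (t : unitInterval) : C(X, Y) :=
  ⟨fun x => h (x, t), h.continuous.comp (Continuous.prodMk continuous_id continuous_const)⟩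

theorem realizeChain_slice (h : C(X × unitInterval, Y)) (s : C(stdSimplex ℝ (Fin (n + 1)), X))
    (t : unitInterval) :
    realizeChain h s n (TupleChain.push (fun x => (x, t)) (n + 1)
      (Finsupp.single (vert (n + 1)) 1)) = Finsupp.single ((slice h t).comp s) 1 := by
  rw [TupleChain.push_single, realizeChain_single]
  congr 1
  ext1 u
  change h (s (combo (vert (n + 1)) u), _) = h (s u, t)
  rw [combo_vert]
  congr 2
  refine Subtype.ext ?_
  change ∑ i, u i * (t : ℝ) = t
  rw [← Finset.sum_mul, stdSimplex.sum_eq_one, one_mul]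

theorem singBoundary_prism_zero (h : C(X × unitInterval, Y)) (σ : SingChain X 0) :
    singBoundary Y 0 (prism h 0 σ) = push (slice h 1) 0 σ + push (slice h 0) 0 σ := by
  refine LinearMap.congr_fun (f := singBoundary Y 0 ∘ₗ prism h 0)
    (g := push (slice h 1) 0 + push (slice h 0) 0) ?_ σ
  ext s : 2
  simp only [LinearMap.comp_apply, Finsupp.lsingle_apply, LinearMap.add_apply, prism_single,
    push_single]
  rw [singBoundary_realizeChain, bdry_prism, map_add, map_add, realizeChain_slice,
    realizeChain_slice]
  simp [TupleChain.prism]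

theorem singBoundary_prism_succ (h : C(X × unitInterval, Y)) (σ : SingChain X (n + 1)) :
    singBoundary Y (n + 1) (prism h (n + 1) σ) =
      push (slice h 1) (n + 1) σ + push (slice h 0) (n + 1) σ
        + prism h n (singBoundary X n σ) := by
  refine LinearMap.congr_fun (f := singBoundary Y (n + 1) ∘ₗ prism h (n + 1))
    (g := push (slice h 1) (n + 1) + push (slice h 0) (n + 1)
      + prism h n ∘ₗ singBoundary X n) ?_ σ
  ext s : 2
  simp only [LinearMap.comp_apply, Finsupp.lsingle_apply, LinearMap.add_apply, prism_single,
    push_single, singBoundary_single, map_sum]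
  rw [singBoundary_realizeChain, bdry_prism, map_add, map_add, realizeChain_slice,
    realizeChain_slice, bdry_single, map_sum, map_sum]
  congr 1
  refine Finset.sum_congr rfl fun i _ => ?_
  rw [← realizeChain_face, push_prism, TupleChain.push_single, map_comp_vert]
  rfl

/-! ### Relative boundaries -/

/-- `σ` is a relative boundary of `(B, A)`. -/
def IsRelBoundary (B A : Set X) (σ : SingChain X n) : Prop :=
  ∃ (τ : SingChain X (n + 1)) (ρ : SingChain X n),
    chainImage τ ⊆ B ∧ chainImage ρ ⊆ A ∧ σ = singBoundary X n τ + ρ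

theorem IsRelBoundary.mono {B A B' A' : Set X} (hB : B ⊆ B') (hA : A ⊆ A') {σ : SingChain X n}
    (h : IsRelBoundary B A σ) : IsRelBoundary B' A' σ := by
  obtain ⟨τ, ρ, h1, h2, h3⟩ := h
  exact ⟨τ, ρ, h1.trans hB, h2.trans hA, h3⟩

theorem IsRelBoundary.add {B A : Set X} {σ σ' : SingChain X n} (h : IsRelBoundary B A σ)
    (h' : IsRelBoundary B A σ') : IsRelBoundary B A (σ + σ') := by
  obtain ⟨τ, ρ, h1, h2, rfl⟩ := h
  obtain ⟨τ', ρ', h1', h2', rfl⟩ := h'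
  refine ⟨τ + τ', ρ + ρ', (chainImage_add_subset _ _).trans (union_subset h1 h1'),
    (chainImage_add_subset _ _).trans (union_subset h2 h2'), ?_⟩
  rw [map_add]
  abel

/-- **Homotopy invariance**: the push-forwards of a relative cycle by homotopic maps are
homologous. -/
theorem isRelBoundary_homotopy (h : C(X × unitInterval, Y)) {B A : Set X} {B' A' : Set Y}
    {σ : SingChain X n} (hσ : chainImage σ ⊆ B) (hσ' : BoundaryIn A n σ)
    (hB : ∀ x ∈ B, ∀ t, h (x, t) ∈ B') (hA : ∀ x ∈ A, ∀ t, h (x, t) ∈ A') :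
    IsRelBoundary B' A' (push (slice h 1) n σ + push (slice h 0) n σ) := by
  have h1 : chainImage (prism h n σ) ⊆ B' := by
    refine (chainImage_prism_subset h σ).trans ?_
    rintro _ ⟨⟨x, t⟩, ⟨hx, _⟩, rfl⟩
    exact hB x (hσ hx) t
  cases n with
  | zero => exact ⟨prism h 0 σ, 0, h1, by simp [chainImage_zero], by
      rw [singBoundary_prism_zero, add_zero]⟩
  | succ n =>
    refine ⟨prism h (n + 1) σ, prism h n (singBoundary X n σ), h1, ?_, ?_⟩
    · refine (chainImage_prism_subset h _).trans ?_
      rintro _ ⟨⟨x, t⟩, ⟨hx, _⟩, rfl⟩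
      exact hA x (hσ' hx) t
    · rw [singBoundary_prism_succ, add_assoc (push (slice h 1) (n + 1) σ + _), add_self_mod_two,
        add_zero]

theorem isRelBoundary_iff_of_homotopy (h : C(X × unitInterval, Y)) {B A : Set X} {B' A' : Set Y}
    {σ : SingChain X n} (hσ : chainImage σ ⊆ B) (hσ' : BoundaryIn A n σ)
    (hB : ∀ x ∈ B, ∀ t, h (x, t) ∈ B') (hA : ∀ x ∈ A, ∀ t, h (x, t) ∈ A') :
    IsRelBoundary B' A' (push (slice h 1) n σ) ↔ IsRelBoundary B' A' (push (slice h 0) n σ) := by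
  have key := isRelBoundary_homotopy h hσ hσ' hB hA
  constructor <;> intro h'
  · have := key.add h'
    rwa [add_comm, ← add_assoc, add_self_mod_two, zero_add] at this
  · have := key.add h'
    rwa [add_assoc, add_self_mod_two, add_zero] at this

/-! ### A simplex which is not a relative boundary -/

/-- The number modulo `2` of completely labelled simplices of the `m`-th subdivision of a chain. -/
def labelCount (L : X → Fin (n + 1)) (m : ℕ) : SingChain X n →ₗ[ZMod 2] ZMod 2 :=
  Finsupp.linearCombination (ZMod 2) fun s =>
    functional labelDet (TupleChain.push (L ∘ s) (n + 1) (sdSimplex (n + 1) m))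

@[simp] theorem labelCount_single (L : X → Fin (n + 1)) (m : ℕ)
    (s : C(stdSimplex ℝ (Fin (n + 1)), X)) : labelCount L m (Finsupp.single s 1) =
      functional labelDet (TupleChain.push (L ∘ s) (n + 1) (sdSimplex (n + 1) m)) := by
  simp [labelCount]

/-- Subdivision is compatible with faces, so the count on a boundary is the count on the boundary of
a subdivided chain, where the determinant cochain vanishes. -/
theorem labelCount_singBoundary (L : X → Fin (n + 1)) (m : ℕ) (τ : SingChain X (n + 1)) :
    labelCount L m (singBoundary X n τ) = 0 := by
  refine LinearMap.congr_fun (f := labelCount L m ∘ₗ singBoundary X n) (g := 0) ?_ τ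
  ext s : 2
  simp only [LinearMap.comp_apply, Finsupp.lsingle_apply, singBoundary_single, map_sum,
    labelCount_single, LinearMap.zero_apply]
  have := functional_labelDet_bdry (TupleChain.push (L ∘ s) (n + 2) (sdSimplex (n + 2) m))
  rw [bdry_push, bdry_sdSimplex, map_sum, map_sum] at this
  simp only [push_push] at this
  exact this

/-- The open sets `f j < 0` cover the image of each simplex of `ρ`. By the Lebesgue number lemma a
fine enough small simplex lies in one of them, and then label `j` is missing. The labelling need not
be continuous. -/
theorem eventually_labelCount_eq_zero (f : Fin (n + 1) → X → ℝ) (hf : ∀ i, Continuous (f i))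
    {L : X → Fin (n + 1)} (hL : ∀ x, 0 ≤ f (L x) x) {ρ : SingChain X n}
    (hρ : chainImage ρ ⊆ {x | ∃ j, f j x < 0}) : ∀ᶠ m in atTop, labelCount L m ρ = 0 := by
  have key : ∀ s ∈ ρ.support, ∀ᶠ m in atTop, labelCount L m (Finsupp.single s 1) = 0 := by
    intro s hs
    obtain ⟨δ, hδ, hδ'⟩ := lebesgue_number_lemma_of_metric
      (c := fun j => {t : stdSimplex ℝ (Fin (n + 1)) | f j (s t) < 0}) isCompact_univ
      (fun j => isOpen_lt ((hf j).comp s.continuous) continuous_const) fun t _ => by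
        simpa using hρ (range_subset_chainImage hs ⟨t, rfl⟩)
    filter_upwards [sdSimplex_small (X := ℝ) (n + 1) hδ] with m hm
    rw [labelCount_single]
    refine functional_eq_zero ?_
    refine TupleChain.All.map hm fun w hw => ?_
    rw [TupleChain.push_single]
    obtain ⟨j, hj⟩ := hδ' (w 0) (mem_univ _)
    refine TupleChain.All.single (labelDet_eq_zero j fun i h => ?_)
    have h1 : f j (s (w i)) < 0 := hj (hw i 0)
    have h2 := hL (s (w i))
    rw [show L (s (w i)) = j from h] at h2
    exact h1.not_ge h2
  filter_upwards [(Filter.eventually_all_finset _).2 key] with m hm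
  rw [← ρ.sum_single, Finsupp.sum, map_sum]
  refine Finset.sum_eq_zero fun s hs => ?_
  have : Finsupp.single s (ρ s) = ρ s • (Finsupp.single s 1 : SingChain X n) := by simp
  rw [this, map_smul, hm s hs, smul_zero]

/-- Label each point by a coordinate that is nonnegative there. The label count is 1 on `s` by
Sperner's lemma, but 0 on any boundary and, after enough subdivisions, on chains where some
coordinate is everywhere negative. -/
theorem not_isRelBoundary_single (f : Fin (n + 1) → X → ℝ) (hf : ∀ i, Continuous (f i))
    (hf' : ∀ x, ∃ j, 0 ≤ f j x) (s : C(stdSimplex ℝ (Fin (n + 1)), X))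
    (hs : ∀ (t : stdSimplex ℝ (Fin (n + 1))) i, 0 ≤ f i (s t) → t i ≠ 0) :
    ¬ IsRelBoundary univ {x | ∃ j, f j x < 0} (Finsupp.single s 1 : SingChain X n) := by
  rintro ⟨τ, ρ, -, hρ, h⟩
  choose L hL using hf'
  obtain ⟨m, hm⟩ := (eventually_labelCount_eq_zero f hf hL hρ).exists
  have := congrArg (labelCount L m) h
  rw [map_add, labelCount_singBoundary, hm, labelCount_single,
    stdSimplex.sperner (n + 1) m (L ∘ s) fun t => hs t _ (hL _)] at this
  exact one_ne_zero this

end SingChain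

end

/-! ### Nonsmooth analysis in finite dimension -/

noncomputable section

/-! ### Convex hulls of compact sets -/

theorem IsCompact.convexJoin_of_normed {V : Type*} [NormedAddCommGroup V] [NormedSpace ℝ V]
    {s t : Set V} (hs : IsCompact s) (ht : IsCompact t) : IsCompact (convexJoin ℝ s t) := by
  have : convexJoin ℝ s t =
      (fun q : (V × V) × ℝ => (1 - q.2) • q.1.1 + q.2 • q.1.2) '' ((s ×ˢ t) ×ˢ Icc (0 : ℝ) 1) := by
    ext x
    simp only [mem_convexJoin, segment_eq_image]
    constructor
    · rintro ⟨a, ha, b, hb, r, hr, rfl⟩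
      exact ⟨((a, b), r), ⟨⟨ha, hb⟩, hr⟩, rfl⟩
    · rintro ⟨⟨⟨a, b⟩, r⟩, ⟨⟨ha, hb⟩, hr⟩, rfl⟩
      exact ⟨a, ha, b, hb, r, hr, rfl⟩
  rw [this]
  exact ((hs.prod ht).prod isCompact_Icc).image (by fun_prop)

/-- By Carathéodory's theorem the hull is reached after `finrank` joins with `s`, and each join of
compact sets is compact. -/
theorem IsCompact.convexHull_of_finiteDimensional {V : Type*} [NormedAddCommGroup V]
    [NormedSpace ℝ V] [FiniteDimensional ℝ V] {s : Set V} (hs : IsCompact s) :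
    IsCompact (convexHull ℝ s) := by
  classical
  rcases s.eq_empty_or_nonempty with rfl | hne
  · simp
  let C : ℕ → Set V := fun n => Nat.rec s (fun _ c => convexJoin ℝ s c) n
  have hC : ∀ n, IsCompact (C n) := by
    intro n
    induction n with
    | zero => exact hs
    | succ n ih => exact hs.convexJoin_of_normed ih
  have hC_sub : ∀ n, C n ⊆ convexHull ℝ s := by
    intro n
    induction n with
    | zero => exact subset_convexHull ℝ s
    | succ n ih =>
      intro x hx
      obtain ⟨a, ha, b, hb, hx⟩ := mem_convexJoin.1 hx
      exact (convex_convexHull ℝ s).segment_subset (subset_convexHull ℝ s ha) (ih hb) hx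
  have hsC : ∀ n, s ⊆ C n := by
    intro n
    induction n with
    | zero => exact Subset.rfl
    | succ n ih =>
      exact fun a ha => mem_convexJoin.2 ⟨a, ha, a, ih ha, left_mem_segment ℝ a a⟩
  have hsub : ∀ n (t : Finset V), (t : Set V) ⊆ s → t.card ≤ n + 1 →
      convexHull ℝ (t : Set V) ⊆ C n := by
    intro n
    induction n with
    | zero =>
      intro t ht htc x hx
      have hne' : (t : Set V).Nonempty := convexHull_nonempty_iff.1 ⟨x, hx⟩
      obtain ⟨a, ha⟩ := hne'
      have : t = {a} := Finset.eq_singleton_iff_unique_mem.2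
        ⟨ha, fun b hb => Finset.card_le_one.1 htc b hb a ha⟩
      rw [this, Finset.coe_singleton, convexHull_singleton] at hx
      rw [mem_singleton_iff.1 hx]
      exact ht ha
    | succ n ih =>
      intro t ht htc x hx
      have hne' : (t : Set V).Nonempty := convexHull_nonempty_iff.1 ⟨x, hx⟩
      obtain ⟨a, ha⟩ := hne'
      rcases (t.erase a).eq_empty_or_nonempty with he | he
      · rw [← Finset.insert_erase ha, he] at hx
        simp only [insert_empty_eq, Finset.coe_singleton, convexHull_singleton,
          mem_singleton_iff] at hx
        rw [hx]
        exact hsC (n + 1) (ht ha)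
      · rw [← Finset.insert_erase ha, Finset.coe_insert,
          convexHull_insert (Finset.coe_nonempty.2 he)] at hx
        obtain ⟨a', ha', b, hb, hx⟩ := mem_convexJoin.1 hx
        rw [mem_singleton_iff.1 ha'] at hx
        refine mem_convexJoin.2 ⟨a, ht ha, b, ih (t.erase a) ?_ ?_ hb, hx⟩
        · exact fun y hy => ht (Finset.mem_of_mem_erase hy)
        · have := Finset.card_erase_of_mem ha
          omega
  have : convexHull ℝ s = C (Module.finrank ℝ V) := by
    refine Subset.antisymm ?_ (hC_sub _)
    rw [convexHull_eq_union]
    refine iUnion_subset fun t => iUnion_subset fun ht => iUnion_subset fun hi => hsub _ t ht ?_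
    have h1 := hi.card_le_finrank_succ
    rw [Fintype.card_coe] at h1
    exact h1.trans (Nat.add_le_add_right (Submodule.finrank_le _) 1)
  rw [this]
  exact hC _

/-- In finite dimension, the continuous linear functionals on the dual space are the evaluations. -/
theorem exists_eq_apply_of_finiteDimensional {V : Type*} [NormedAddCommGroup V] [NormedSpace ℝ V]
    [FiniteDimensional ℝ V] (Φ : (V →L[ℝ] ℝ) →L[ℝ] ℝ) : ∃ v, ∀ ℓ : V →L[ℝ] ℝ, Φ ℓ = ℓ v := by
  let e : (V →ₗ[ℝ] ℝ) ≃ₗ[ℝ] (V →L[ℝ] ℝ) := LinearMap.toContinuousLinearMap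
  obtain ⟨v, hv⟩ := (Module.evalEquiv ℝ V).surjective (Φ.toLinearMap ∘ₗ e.toLinearMap)
  refine ⟨v, fun ℓ => ?_⟩
  have := LinearMap.congr_fun hv (e.symm ℓ)
  have he : ∀ x, e.symm ℓ x = ℓ x := fun x => rfl
  simpa [he] using this.symm

/-! ### Clarke's derivative -/

section Clarke

variable {V : Type*} [NormedAddCommGroup V] [NormedSpace ℝ V] {f : V → ℝ} {a : V}

/-- The limits of derivatives at points converging to `a`. -/
def limDeriv (f : V → ℝ) (a : V) : Set (V →L[ℝ] ℝ) :=
  {p | (a, p) ∈ closure {q : V × (V →L[ℝ] ℝ) | DifferentiableAt ℝ f q.1 ∧ q.2 = fderiv ℝ f q.1}}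

theorem isClosed_limDeriv (f : V → ℝ) (a : V) : IsClosed (limDeriv f a) :=
  isClosed_closure.preimage (Continuous.prodMk continuous_const continuous_id)

/-- An inequality for the nearby derivatives holds for the limits of derivatives. -/
theorem limDeriv_apply_le {w : V → V} {g : V → ℝ} (hw : ContinuousAt w a) (hg : ContinuousAt g a)
    (h : ∀ᶠ η in 𝓝 a, DifferentiableAt ℝ f η → fderiv ℝ f η (w η) ≤ g η) {p : V →L[ℝ] ℝ}
    (hp : p ∈ limDeriv f a) : p (w a) ≤ g a := by
  set S := {q : V × (V →L[ℝ] ℝ) | DifferentiableAt ℝ f q.1 ∧ q.2 = fderiv ℝ f q.1}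
  have hne : (𝓝[S] (a, p)).NeBot := mem_closure_iff_nhdsWithin_neBot.1 hp
  have h1 : Tendsto (fun q : V × (V →L[ℝ] ℝ) => q.1) (𝓝[S] (a, p)) (𝓝 a) :=
    (continuous_fst.tendsto (a, p)).mono_left nhdsWithin_le_nhds
  have h2 : Tendsto (fun q : V × (V →L[ℝ] ℝ) => q.2) (𝓝[S] (a, p)) (𝓝 p) :=
    (continuous_snd.tendsto (a, p)).mono_left nhdsWithin_le_nhds
  refine le_of_tendsto_of_tendsto (f := fun q : V × (V →L[ℝ] ℝ) => q.2 (w q.1))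
    (g := fun q : V × (V →L[ℝ] ℝ) => g q.1) (b := 𝓝[S] (a, p)) ?_ (hg.tendsto.comp h1) ?_
  · exact (isBoundedBilinearMap_apply.continuous.tendsto (p, w a)).comp
      (h2.prodMk_nhds (hw.tendsto.comp h1))
  filter_upwards [h1.eventually h, self_mem_nhdsWithin] with q hq hqS
  have := hq hqS.1
  rwa [← hqS.2] at this

/-- A half-space condition passes from limits of derivatives to their hull. The field `w` may vary:
radial fields serve to bound critical points, constant ones to show that noncriticality is an open
condition. -/
theorem clarkeDeriv_apply_le {w : V → V} {g : V → ℝ} (hw : ContinuousAt w a)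
    (hg : ContinuousAt g a)
    (h : ∀ᶠ η in 𝓝 a, DifferentiableAt ℝ f η → fderiv ℝ f η (w η) ≤ g η) {p : V →L[ℝ] ℝ}
    (hp : p ∈ clarkeDeriv f a) : p (w a) ≤ g a := by
  have hconv : Convex ℝ {p : V →L[ℝ] ℝ | p (w a) ≤ g a} :=
    convex_halfSpace_le (f := fun p : V →L[ℝ] ℝ => p (w a))
      ⟨fun _ _ => rfl, fun _ _ => rfl⟩ (g a)
  exact convexHull_min (fun p hp => limDeriv_apply_le hw hg h hp) hconv hp

variable {K : NNReal}

theorem norm_fderiv_le_of_lipschitzOn_ball {r : ℝ} (hf : LipschitzOnWith K f (Metric.ball a r))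
    {η : V} (hη : η ∈ Metric.ball a r) : ‖fderiv ℝ f η‖ ≤ K :=
  norm_fderiv_le_of_lipschitzOn ℝ (Metric.isOpen_ball.mem_nhds hη) hf

variable [FiniteDimensional ℝ V]

theorem isCompact_limDeriv {r : ℝ} (hr : 0 < r) (hf : LipschitzOnWith K f (Metric.ball a r)) :
    IsCompact (limDeriv f a) := by
  refine (isCompact_closedBall (0 : V →L[ℝ] ℝ) K).of_isClosed_subset (isClosed_limDeriv f a) ?_
  have hcl : IsClosed {q : V × (V →L[ℝ] ℝ) | ‖q.2‖ ≤ K} :=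
    isClosed_le continuous_snd.norm continuous_const
  intro p hp
  rw [mem_closedBall_zero_iff]
  have hp' : (a, p) ∈ closure ({q : V × (V →L[ℝ] ℝ) | DifferentiableAt ℝ f q.1 ∧
      q.2 = fderiv ℝ f q.1} ∩ (Metric.ball a r ×ˢ univ)) := by
    rw [mem_closure_iff_nhdsWithin_neBot, nhdsWithin_inter_of_mem']
    · exact mem_closure_iff_nhdsWithin_neBot.1 hp
    · exact mem_nhdsWithin_of_mem_nhds
        ((Metric.isOpen_ball.prod isOpen_univ).mem_nhds ⟨Metric.mem_ball_self hr, mem_univ _⟩)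
  refine closure_minimal ?_ hcl hp'
  rintro ⟨x, q⟩ ⟨⟨-, hq⟩, hx, -⟩
  rw [show q = fderiv ℝ f x from hq]
  exact norm_fderiv_le_of_lipschitzOn_ball hf hx

/-- If `0` is not in Clarke's derivative, the derivatives at nearby points are uniformly negative
in a suitable direction. -/
theorem exists_fderiv_apply_le {r : ℝ} (hr : 0 < r) (hf : LipschitzOnWith K f (Metric.ball a r))
    (h0 : (0 : V →L[ℝ] ℝ) ∉ clarkeDeriv f a) :
    ∃ v : V, ∃ κ > 0, ∀ᶠ η in 𝓝 a, DifferentiableAt ℝ f η → fderiv ℝ f η v ≤ -κ := by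
  obtain ⟨Φ, u, hu0, hu⟩ := geometric_hahn_banach_point_closed (convex_convexHull ℝ (limDeriv f a))
    (isCompact_limDeriv hr hf).convexHull_of_finiteDimensional.isClosed h0
  obtain ⟨v, hv⟩ := exists_eq_apply_of_finiteDimensional Φ
  rw [map_zero] at hu0
  refine ⟨-v, u, hu0, ?_⟩
  by_contra hcon
  -- Otherwise there are points tending to `a` whose derivatives at `v` are below `u`; these
  -- derivatives are bounded, and a limit point of them contradicts the separation.
  have hfreq : ∃ᶠ η in 𝓝 a, η ∈ Metric.ball a r ∧ DifferentiableAt ℝ f η ∧ fderiv ℝ f η v < u := by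
    refine (Filter.Frequently.and_eventually (not_eventually.1 hcon)
      (Metric.ball_mem_nhds a hr)).mono fun η hη => ⟨hη.2, ?_⟩
    have := hη.1
    push Not at this
    refine ⟨this.1, ?_⟩
    have h := this.2
    rw [map_neg] at h
    linarith
  obtain ⟨x, hx, hx'⟩ := exists_seq_forall_of_frequently hfreq
  obtain ⟨p, -, φ, hφ, hp⟩ := (isCompact_closedBall (0 : V →L[ℝ] ℝ) K).tendsto_subseq
    (x := fun n => fderiv ℝ f (x n)) fun n => by
      rw [mem_closedBall_zero_iff]
      exact norm_fderiv_le_of_lipschitzOn_ball hf (hx' n).1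
  have hpl : p ∈ limDeriv f a := by
    refine mem_closure_of_tendsto ((hx.comp hφ.tendsto_atTop).prodMk_nhds hp) ?_
    exact Eventually.of_forall fun n => ⟨(hx' _).2.1, rfl⟩
  have h1 : p v ≤ u := le_of_tendsto
    (((ContinuousLinearMap.apply ℝ ℝ v).continuous.tendsto p).comp hp)
    (Eventually.of_forall fun n => (hx' _).2.2.le)
  have h2 := hu p (subset_convexHull ℝ _ hpl)
  rw [hv] at h2
  exact h2.not_ge h1

open MeasureTheory in
/-- A Lipschitz function whose derivatives in the direction `v` are at most `-κ` decreases in this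
direction. -/
theorem apply_add_smul_le {r κ : ℝ} {v : V} (hf : LipschitzOnWith K f (Metric.ball a r))
    (h : ∀ η ∈ Metric.ball a r, DifferentiableAt ℝ f η → fderiv ℝ f η v ≤ -κ) {η : V} {s : ℝ}
    (hs : 0 ≤ s) (hη : ∀ τ ∈ Icc 0 s, η + τ • v ∈ Metric.ball a r) :
    f (η + s • v) ≤ f η - κ * s := by
  borelize V
  obtain ⟨g, hg, hfg⟩ := hf.extend_real
  have hg' : ∀ x ∈ Metric.ball a r, DifferentiableAt ℝ g x → fderiv ℝ g x v ≤ -κ := by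
    intro x hx hd
    have he : f =ᶠ[𝓝 x] g := by
      filter_upwards [Metric.isOpen_ball.mem_nhds hx] with y hy using hfg hy
    rw [← he.fderiv_eq]
    exact h x hx (he.differentiableAt_iff.2 hd)
  let μ : Measure V := Measure.addHaar
  -- Rademacher and Fubini: a given segment may miss the differentiability points, but on almost
  -- every parallel line `g` is differentiable almost everywhere. The inequality is integrated on
  -- those lines and extended by density and continuity.
  have hae : ∀ᵐ x ∂μ, ∀ᵐ τ : ℝ, DifferentiableAt ℝ g (x + τ • v) := by
    rw [Measure.ae_ae_comm (p := fun x τ => DifferentiableAt ℝ g (x + τ • v))]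
    · refine Eventually.of_forall fun τ => ?_
      exact (measurePreserving_add_right μ (τ • v)).quasiMeasurePreserving.ae
        (hg.ae_differentiableAt (μ := μ))
    · exact (show Measurable fun q : V × ℝ => q.1 + q.2 • v by fun_prop)
        (measurableSet_of_differentiableAt ℝ g)
  have hdense : Dense {x | ∀ᵐ τ : ℝ, DifferentiableAt ℝ g (x + τ • v)} := Measure.dense_of_ae hae
  have hopen : ∀ᶠ x in 𝓝 η, ∀ τ ∈ Icc 0 s, x + τ • v ∈ Metric.ball a r := by
    have := isCompact_Icc.eventually_forall_of_forall_eventually (x₀ := η) (K := Icc 0 s)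
      (P := fun x τ => x + τ • v ∈ Metric.ball a r) fun τ hτ => by
        refine (show Continuous fun q : V × ℝ => q.1 + q.2 • v by fun_prop).continuousAt.eventually
          (Metric.isOpen_ball.mem_nhds (hη τ hτ))
    exact this
  have key : ∀ x, (∀ᵐ τ : ℝ, DifferentiableAt ℝ g (x + τ • v)) →
      (∀ τ ∈ Icc 0 s, x + τ • v ∈ Metric.ball a r) → g (x + s • v) ≤ g x - κ * s := by
    intro x hx hxb
    have hlip : LipschitzWith (K * ‖v‖₊) fun τ : ℝ => g (x + τ • v) := by
      refine hg.comp (LipschitzWith.of_dist_le_mul fun τ τ' => ?_)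
      rw [dist_add_left, dist_eq_norm, ← sub_smul, norm_smul, mul_comm, dist_eq_norm]
      rfl
    have hac := (hlip.lipschitzOnWith (s := uIcc 0 s)).absolutelyContinuousOnInterval
    have hint := hac.integral_deriv_eq_sub
    have hle : ∫ τ in (0 : ℝ)..s, deriv (fun τ : ℝ => g (x + τ • v)) τ ≤ ∫ _ in (0 : ℝ)..s, -κ := by
      refine intervalIntegral.integral_mono_ae_restrict hs hac.intervalIntegrable_deriv
        intervalIntegrable_const ?_
      rw [EventuallyLE, ae_restrict_iff' measurableSet_Icc]
      filter_upwards [hx] with τ hτ hτs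
      have hd : HasDerivAt (fun τ : ℝ => g (x + τ • v)) (fderiv ℝ g (x + τ • v) v) τ := by
        have h1 : HasDerivAt (fun τ : ℝ => x + τ • v) v τ := by
          simpa using ((hasDerivAt_id τ).smul_const v).const_add x
        exact hτ.hasFDerivAt.comp_hasDerivAt τ h1
      rw [hd.deriv]
      exact hg' _ (hxb τ hτs) hτ
    rw [hint, intervalIntegral.integral_const, smul_eq_mul, zero_smul, add_zero] at hle
    linarith
  have h1 : g (η + s • v) ≤ g η - κ * s := by
    have hcl := mem_closure_iff_nhdsWithin_neBot.1 (hdense η)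
    refine le_of_tendsto_of_tendsto (b := 𝓝[{x | ∀ᵐ τ : ℝ, DifferentiableAt ℝ g (x + τ • v)}] η)
      (f := fun x => g (x + s • v)) (g := fun x => g x - κ * s) ?_ ?_ ?_
    · exact ((hg.continuous.comp (by fun_prop :
        Continuous fun x : V => x + s • v)).tendsto η).mono_left nhdsWithin_le_nhds
    · exact ((hg.continuous.sub continuous_const).tendsto η).mono_left nhdsWithin_le_nhds
    · filter_upwards [self_mem_nhdsWithin, mem_nhdsWithin_of_mem_nhds hopen] with x hx hx'
      exact key x hx hx'
  rw [hfg (hη s ⟨hs, le_rfl⟩), hfg (by simpa using hη 0 ⟨le_rfl, hs⟩)]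
  exact h1

/-- If `0` is not in Clarke's derivative at `a`, there is a direction in which `f` decreases near
`a`, and `0` is not in Clarke's derivative at the points near `a`. -/
theorem exists_descent {r : ℝ} (hr : 0 < r) (hf : LipschitzOnWith K f (Metric.ball a r))
    (h0 : (0 : V →L[ℝ] ℝ) ∉ clarkeDeriv f a) :
    ∃ v : V, ∃ κ > 0, ∃ ε > 0, (∀ η ∈ Metric.ball a ε, (0 : V →L[ℝ] ℝ) ∉ clarkeDeriv f η) ∧
      ∀ η ∈ Metric.ball a ε, ∀ s ∈ Icc 0 ε, f (η + s • v) ≤ f η - κ * s := by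
  obtain ⟨v, κ, hκ, hv⟩ := exists_fderiv_apply_le hr hf h0
  obtain ⟨ε', hε', hε''⟩ := Metric.eventually_nhds_iff_ball.1 hv
  set ρ := min r ε' with hρ
  have hρ0 : 0 < ρ := lt_min hr hε'
  have hρ1 : Metric.ball a ρ ⊆ Metric.ball a r := Metric.ball_subset_ball (min_le_left _ _)
  have hρ2 : Metric.ball a ρ ⊆ Metric.ball a ε' := Metric.ball_subset_ball (min_le_right _ _)
  have hv0 : 0 < 1 + ‖v‖ := by positivity
  -- Chosen so that a point at distance less than ε from `a`, moved by at most ε‖v‖, stays in the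
  -- ball of radius ρ.
  set ε := ρ / (2 * (1 + ‖v‖)) with hε
  have hε0 : 0 < ε := by positivity
  have h2 : ε * (2 * (1 + ‖v‖)) = ρ := div_mul_cancel₀ _ (by positivity)
  have hερ : ε ≤ ρ := by nlinarith [norm_nonneg v]
  refine ⟨v, κ, hκ, ε, hε0, fun η hη h => ?_, fun η hη s hs => ?_⟩
  · have := clarkeDeriv_apply_le (f := f) (a := η) (w := fun _ => v) (g := fun _ => -κ)
      continuousAt_const continuousAt_const ?_ h
    · rw [zero_apply] at this
      linarith
    · filter_upwards [Metric.isOpen_ball.mem_nhds hη] with x hx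
      exact hε'' x (hρ2 (Metric.ball_subset_ball hερ hx))
  · refine apply_add_smul_le (hf.mono hρ1) (fun x hx => hε'' x (hρ2 hx)) hs.1 fun τ hτ => ?_
    rw [Metric.mem_ball, dist_eq_norm] at hη ⊢
    have h3 : ‖η + τ • v - a‖ ≤ ‖η - a‖ + τ * ‖v‖ := by
      rw [show η + τ • v - a = (η - a) + τ • v by abel]
      refine (norm_add_le _ _).trans ?_
      rw [norm_smul, Real.norm_of_nonneg hτ.1]
    have h4 : τ * ‖v‖ ≤ ε * ‖v‖ :=
      mul_le_mul_of_nonneg_right (hτ.2.trans hs.2) (norm_nonneg v)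
    nlinarith [norm_nonneg v]

end Clarke

end

/-! ### Linking and the minmax value of a single function -/

noncomputable section

/-! ### Functions at bounded distance of a quadratic form -/

section Tame

open SingChain

variable {E P : Type*} [NormedAddCommGroup E] [NormedSpace ℝ E] [NormedAddCommGroup P]
  [NormedSpace ℝ P] {k : ℕ}

/-- In the coordinates `ℓ`, the function `f` differs from the quadratic form `|p|² - |q|²` by a
Lipschitz function. -/
structure IsTame (ℓ : E ≃L[ℝ] P × EuclideanSpace ℝ (Fin k)) (L C : ℝ) (f : E → ℝ) : Prop where
  one_le : 1 ≤ L
  lip : ∀ η η', |(f η - (‖(ℓ η).1‖ ^ 2 - ‖(ℓ η).2‖ ^ 2)) - (f η' - (‖(ℓ η').1‖ ^ 2 - ‖(ℓ η').2‖ ^ 2))|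
    ≤ L * (‖(ℓ η).1 - (ℓ η').1‖ + ‖(ℓ η).2 - (ℓ η').2‖)
  zero : |f 0| ≤ C

/-- A level above the topologically interesting values of a tame function. -/
def tameLevel (L C : ℝ) : ℝ := 3 * L ^ 2 + C

/-- The map which multiplies the coordinates by `α` and `β`. -/
def scale (ℓ : E ≃L[ℝ] P × EuclideanSpace ℝ (Fin k)) (α β : ℝ) (η : E) : E :=
  ℓ.symm (α • (ℓ η).1, β • (ℓ η).2)

/-- The factor which brings `p` into the ball of radius `L`. -/
def squeezeFactor (ℓ : E ≃L[ℝ] P × EuclideanSpace ℝ (Fin k)) (L : ℝ) (η : E) : ℝ :=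
  L / max L ‖(ℓ η).1‖

variable {ℓ : E ≃L[ℝ] P × EuclideanSpace ℝ (Fin k)} {L C : ℝ} {f : E → ℝ}

@[simp] theorem scale_fst (α β : ℝ) (η : E) : (ℓ (scale ℓ α β η)).1 = α • (ℓ η).1 := by
  simp [scale]

@[simp] theorem scale_snd (α β : ℝ) (η : E) : (ℓ (scale ℓ α β η)).2 = β • (ℓ η).2 := by
  simp [scale]

theorem scale_one_one (η : E) : scale ℓ 1 1 η = η := by simp [scale]

theorem scale_scale (α β α' β' : ℝ) (η : E) :
    scale ℓ α β (scale ℓ α' β' η) = scale ℓ (α * α') (β * β') η := by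
  simp [scale, mul_smul]

theorem lineMap_scale (α β t : ℝ) (η : E) :
    (1 - t) • η + t • scale ℓ α β η = scale ℓ (1 - t + t * α) (1 - t + t * β) η := by
  apply ℓ.injective
  rw [map_add, map_smul, map_smul]
  refine Prod.ext ?_ ?_
  · simp [add_smul, mul_smul, sub_smul]
  · simp [add_smul, mul_smul, sub_smul]

theorem continuous_scale {α β : E → ℝ} (hα : Continuous α) (hβ : Continuous β) :
    Continuous fun η => scale ℓ (α η) (β η) η := by
  unfold scale
  fun_prop

theorem continuous_squeezeFactor (hL : 1 ≤ L) : Continuous (squeezeFactor ℓ L) := by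
  unfold squeezeFactor
  refine Continuous.div (by fun_prop) (by fun_prop) fun η => ?_
  exact (lt_max_of_lt_left (by linarith)).ne'

theorem squeezeFactor_le_one (hL : 1 ≤ L) (η : E) : squeezeFactor ℓ L η ≤ 1 :=
  (div_le_one (lt_max_of_lt_left (by linarith))).2 (le_max_left _ _)

theorem squeezeFactor_nonneg (hL : 1 ≤ L) (η : E) : 0 ≤ squeezeFactor ℓ L η :=
  div_nonneg (by linarith) (le_max_of_le_left (by linarith))

theorem squeezeFactor_cases (hL : 1 ≤ L) (η : E) :
    squeezeFactor ℓ L η = 1 ∨ squeezeFactor ℓ L η * ‖(ℓ η).1‖ = L := by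
  rcases le_total ‖(ℓ η).1‖ L with h | h
  · left
    rw [squeezeFactor, max_eq_left h, div_self (by linarith)]
  · right
    rw [squeezeFactor, max_eq_right h, div_mul_cancel₀]
    linarith

theorem norm_squeeze_le (hL : 1 ≤ L) (η : E) : squeezeFactor ℓ L η * ‖(ℓ η).1‖ ≤ L := by
  rw [squeezeFactor, div_mul_eq_mul_div, div_le_iff₀ (lt_max_of_lt_left (by linarith))]
  exact mul_le_mul_of_nonneg_left (le_max_right _ _) (by linarith)

/-! #### The homotopy from the identity -/

/-- The affine homotopy from the identity to `g`. -/
def linHomotopy (g : C(E, E)) : C(E × unitInterval, E) :=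
  ⟨fun q => (1 - (q.2 : ℝ)) • q.1 + (q.2 : ℝ) • g q.1, by fun_prop⟩

theorem slice_linHomotopy_zero (g : C(E, E)) : slice (linHomotopy g) 0 = ContinuousMap.id E := by
  ext1 η
  simp [slice, linHomotopy]

theorem slice_linHomotopy_one (g : C(E, E)) : slice (linHomotopy g) 1 = g := by
  ext1 η
  simp [slice, linHomotopy]

theorem isRelBoundary_push_iff (g : C(E, E)) {n : ℕ} {B A B' A' : Set E} {σ : SingChain E n}
    (hσ : chainImage σ ⊆ B) (hσ' : BoundaryIn A n σ)
    (hB : ∀ x ∈ B, ∀ t ∈ Icc (0 : ℝ) 1, (1 - t) • x + t • g x ∈ B')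
    (hA : ∀ x ∈ A, ∀ t ∈ Icc (0 : ℝ) 1, (1 - t) • x + t • g x ∈ A') :
    IsRelBoundary B' A' (SingChain.push g n σ) ↔ IsRelBoundary B' A' σ := by
  have := isRelBoundary_iff_of_homotopy (linHomotopy g) hσ hσ' (B' := B') (A' := A')
    (fun x hx t => hB x hx t t.2) (fun x hx t => hA x hx t t.2)
  rwa [slice_linHomotopy_zero, slice_linHomotopy_one, SingChain.push_id] at this

/-- `σ` is not a relative boundary modulo the complement of `{q = 0}`. -/
def Linked (ℓ : E ≃L[ℝ] P × EuclideanSpace ℝ (Fin k)) (σ : SingChain E k) : Prop :=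
  ¬ IsRelBoundary univ {η | (ℓ η).2 ≠ 0} σ

/-- Only the boundary has to avoid {q = 0} during the affine homotopy; the chain itself may cross it
freely. -/
theorem Linked.push {σ : SingChain E k} (h : Linked ℓ σ) (g : C(E, E)) {A : Set E}
    (hσ : BoundaryIn A k σ)
    (hA : ∀ x ∈ A, ∀ t ∈ Icc (0 : ℝ) 1, (ℓ ((1 - t) • x + t • g x)).2 ≠ 0) :
    Linked ℓ (SingChain.push g k σ) := fun h' =>
  h ((isRelBoundary_push_iff g (subset_univ _) hσ (fun _ _ _ _ => mem_univ _) hA).1 h')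

/-- A chain that misses {q = 0} is trivially a relative boundary. This intersection point is what
bounds the maxima over cycles from below. -/
theorem Linked.exists_mem {σ : SingChain E k} (h : Linked ℓ σ) :
    ∃ η ∈ chainImage σ, (ℓ η).2 = 0 := by
  by_contra! hcon
  exact h ⟨0, σ, by simp [chainImage_zero], hcon, by simp⟩

/-- There is a linked cycle up to level `m` with boundary below the level `-a`. -/
def HasLinked (ℓ : E ≃L[ℝ] P × EuclideanSpace ℝ (Fin k)) (f : E → ℝ) (a m : ℝ) : Prop :=
  ∃ σ : SingChain E k, Linked ℓ σ ∧ BoundaryIn (subLevel f (-a)) k σ ∧ chainImage σ ⊆ subLevel f m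

/-! #### Inequalities -/

namespace IsTame

variable (hf : IsTame ℓ L C f)
include hf

theorem continuous : Continuous f := by
  have h1 : Continuous fun η => f η - (‖(ℓ η).1‖ ^ 2 - ‖(ℓ η).2‖ ^ 2) := by
    rw [continuous_iff_continuousAt]
    intro η
    rw [ContinuousAt, tendsto_iff_norm_sub_tendsto_zero]
    refine squeeze_zero (fun _ => norm_nonneg _) (fun η' => hf.lip η' η) ?_
    have : Continuous fun η' => L * (‖(ℓ η').1 - (ℓ η).1‖ + ‖(ℓ η').2 - (ℓ η).2‖) := by fun_prop
    simpa using this.tendsto η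
  have h2 : Continuous fun η => (‖(ℓ η).1‖ ^ 2 - ‖(ℓ η).2‖ ^ 2) := by fun_prop
  exact (h1.add h2).congr fun η => sub_add_cancel _ _

theorem apply_le (η : E) : f η ≤
    ‖(ℓ η).1‖ ^ 2 - ‖(ℓ η).2‖ ^ 2 + L * (‖(ℓ η).1‖ + ‖(ℓ η).2‖) + C := by
  have h1 := (abs_le.1 (hf.lip η 0)).2
  have h2 := (abs_le.1 hf.zero).2
  simp at h1
  linarith

theorem le_apply (η : E) :
    ‖(ℓ η).1‖ ^ 2 - ‖(ℓ η).2‖ ^ 2 - L * (‖(ℓ η).1‖ + ‖(ℓ η).2‖) - C ≤ f η := by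
  have h1 := (abs_le.1 (hf.lip η 0)).1
  have h2 := (abs_le.1 hf.zero).1
  simp at h1
  linarith

theorem apply_le_of_tube {η : E} (hη : ‖(ℓ η).1‖ ≤ L) :
    f η ≤ 2 * L ^ 2 + C - ‖(ℓ η).2‖ * (‖(ℓ η).2‖ - L) := by
  have := hf.apply_le η
  nlinarith [norm_nonneg (ℓ η).1, hf.one_le]

/-- With r = |q|, the term −r(r − L) is at most L²/4, so 9L²/4 + C would do; `tameLevel` rounds this
up to 3L² + C. The same margin serves for `le_norm_of_apply_le`. -/
theorem apply_le_tameLevel {η : E} (hη : ‖(ℓ η).1‖ ≤ L) : f η ≤ tameLevel L C := by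
  have := hf.apply_le_of_tube hη
  unfold tameLevel
  nlinarith [sq_nonneg (‖(ℓ η).2‖ - L / 2), hf.one_le]

theorem le_norm_of_apply_le {η : E} (h : f η ≤ -tameLevel L C) : L ≤ ‖(ℓ η).2‖ := by
  by_contra! hlt
  have := hf.le_apply η
  unfold tameLevel at h
  nlinarith [sq_nonneg (‖(ℓ η).1‖ - L / 2), hf.one_le, norm_nonneg (ℓ η).2]

theorem neg_tameLevel_lt {η : E} (h : (ℓ η).2 = 0) : -tameLevel L C < f η := by
  by_contra! hle
  have := hf.le_norm_of_apply_le hle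
  rw [h, norm_zero] at this
  linarith [hf.one_le]

/-- This places low sublevels in the complement of {q = 0}, so that a relative boundary in the
sublevel pair is also one in the pair that defines linking. -/
theorem snd_ne_zero {a : ℝ} (ha : tameLevel L C ≤ a) {η : E} (h : f η ≤ -a) : (ℓ η).2 ≠ 0 :=
  fun h0 => by linarith [hf.neg_tameLevel_lt h0]

/-- Contracting the coordinate `p` outside of the ball of radius `L` makes `f` decrease. -/
theorem apply_scale_fst_le {α : ℝ} {η : E} (h0 : 0 ≤ α) (h1 : α ≤ 1)
    (h : α = 1 ∨ L ≤ α * ‖(ℓ η).1‖) : f (scale ℓ α 1 η) ≤ f η := by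
  rcases h with rfl | h
  · rw [scale_one_one]
  have key := (abs_le.1 (hf.lip (scale ℓ α 1 η) η)).2
  have h2 : α • (ℓ η).1 - (ℓ η).1 = (α - 1) • (ℓ η).1 := by rw [sub_smul, one_smul]
  rw [scale_fst, scale_snd, one_smul, sub_self, norm_zero, add_zero, h2, norm_smul, norm_smul,
    Real.norm_of_nonneg h0, Real.norm_of_nonpos (by linarith : α - 1 ≤ 0)] at key
  have h3 : α * ‖(ℓ η).1‖ ≤ ‖(ℓ η).1‖ := mul_le_of_le_one_left (norm_nonneg _) h1
  nlinarith [hf.one_le]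

/-- Dilating the coordinate `q` outside of the ball of radius `L` makes `f` decrease. -/
theorem apply_scale_snd_le {β : ℝ} {η : E} (h1 : 1 ≤ β) (h : L ≤ ‖(ℓ η).2‖) :
    f (scale ℓ 1 β η) ≤ f η - (β - 1) := by
  have key := (abs_le.1 (hf.lip (scale ℓ 1 β η) η)).2
  have h2 : β • (ℓ η).2 - (ℓ η).2 = (β - 1) • (ℓ η).2 := by rw [sub_smul, one_smul]
  rw [scale_fst, scale_snd, one_smul, sub_self, norm_zero, zero_add, h2, norm_smul, norm_smul,
    Real.norm_of_nonneg (by linarith : 0 ≤ β),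
    Real.norm_of_nonneg (by linarith : 0 ≤ β - 1)] at key
  have hL := hf.one_le
  have h3 : ‖(ℓ η).2‖ ^ 2 - (β * ‖(ℓ η).2‖) ^ 2 + L * ((β - 1) * ‖(ℓ η).2‖) ≤ -(β - 1) := by
    have h4 : 1 ≤ ‖(ℓ η).2‖ * ((β + 1) * ‖(ℓ η).2‖ - L) := by
      have : 1 ≤ (β + 1) * ‖(ℓ η).2‖ - L := by nlinarith
      nlinarith
    nlinarith
  linarith

/-! #### Deformations -/

/-- The retraction onto the tube `|p| ≤ L`. -/
def squeeze : C(E, E) :=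
  ⟨fun η => scale ℓ (squeezeFactor ℓ L η) 1 η,
    continuous_scale (continuous_squeezeFactor hf.one_le) continuous_const⟩

theorem squeeze_apply (η : E) : hf.squeeze η = scale ℓ (squeezeFactor ℓ L η) 1 η := rfl

theorem norm_squeeze (η : E) : ‖(ℓ (hf.squeeze η)).1‖ ≤ L := by
  rw [squeeze_apply, scale_fst, norm_smul, Real.norm_of_nonneg (squeezeFactor_nonneg hf.one_le η)]
  exact norm_squeeze_le hf.one_le η

theorem snd_lineMap_squeeze (η : E) (t : ℝ) :
    (ℓ ((1 - t) • η + t • hf.squeeze η)).2 = (ℓ η).2 := by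
  rw [squeeze_apply, lineMap_scale, scale_snd, mul_one, sub_add_cancel, one_smul]

theorem apply_lineMap_squeeze_le (η : E) {t : ℝ} (ht : t ∈ Icc (0 : ℝ) 1) :
    f ((1 - t) • η + t • hf.squeeze η) ≤ f η := by
  rw [squeeze_apply, lineMap_scale, mul_one, sub_add_cancel]
  have hL := hf.one_le
  have h0 := squeezeFactor_nonneg (ℓ := ℓ) hL η
  have h1 := squeezeFactor_le_one (ℓ := ℓ) hL η
  obtain ⟨ht0, ht1⟩ := ht
  -- At every time of the homotopy the factor is either 1 or leaves |p| at least L.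
  refine hf.apply_scale_fst_le (by nlinarith) (by nlinarith) ?_
  rcases squeezeFactor_cases (ℓ := ℓ) hL η with h | h
  · left
    rw [h]
    ring
  · right
    have := mul_le_of_le_one_left (norm_nonneg (ℓ η).1) h1
    nlinarith [norm_nonneg (ℓ η).1]

theorem apply_squeeze_le (η : E) : f (hf.squeeze η) ≤ f η := by
  simpa using hf.apply_lineMap_squeeze_le η (t := 1) ⟨zero_le_one, le_rfl⟩

theorem boundaryIn_squeeze {a : ℝ} {n : ℕ} {σ : SingChain E n}
    (h : BoundaryIn (subLevel f a) n σ) :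
    BoundaryIn (subLevel f a ∩ {η | ‖(ℓ η).1‖ ≤ L}) n (SingChain.push hf.squeeze n σ) := by
  refine boundaryIn_push (A := subLevel f a) _ ?_ h
  exact fun x hx => ⟨(hf.apply_squeeze_le x).trans hx, hf.norm_squeeze x⟩

/-- The dilation of the coordinate `q`. -/
def stretch (_ : IsTame ℓ L C f) (β : C(E, ℝ)) : C(E, E) :=
  ⟨fun η => scale ℓ 1 (β η) η, continuous_scale continuous_const β.continuous⟩

theorem stretch_apply (β : C(E, ℝ)) (η : E) : hf.stretch β η = scale ℓ 1 (β η) η := rfl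

theorem lineMap_stretch (β : C(E, ℝ)) (η : E) (t : ℝ) :
    (1 - t) • η + t • hf.stretch β η = scale ℓ 1 (1 + t * (β η - 1)) η := by
  rw [stretch_apply, lineMap_scale]
  congr 1 <;> ring

theorem snd_lineMap_stretch_ne_zero {β : C(E, ℝ)} (hβ : ∀ η, 1 ≤ β η) {η : E} (h : (ℓ η).2 ≠ 0)
    {t : ℝ} (ht : t ∈ Icc (0 : ℝ) 1) : (ℓ ((1 - t) • η + t • hf.stretch β η)).2 ≠ 0 := by
  rw [lineMap_stretch, scale_snd]
  refine smul_ne_zero (ne_of_gt ?_) h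
  nlinarith [ht.1, hβ η]

/-- By compactness |q| is bounded below on K, so one large dilation sends all of K to where −|q|²
dominates; squeezing p first keeps the positive part bounded. With r = c|q| ≥ M, the product r(r −
L) exceeds 2L² + |C| + |a|. -/
theorem exists_stretch {K : Set E} (hK : IsCompact K) (hK0 : ∀ η ∈ K, (ℓ η).2 ≠ 0) (a : ℝ) :
    ∃ c : ℝ, 1 ≤ c ∧ ∀ η ∈ K, f (scale ℓ 1 c (hf.squeeze η)) ≤ -a := by
  rcases K.eq_empty_or_nonempty with rfl | hne
  · exact ⟨1, le_rfl, by simp⟩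
  obtain ⟨η₀, hη₀, hmin⟩ := hK.exists_isMinOn hne
    (f := fun η => ‖(ℓ η).2‖) (by fun_prop)
  set δ := ‖(ℓ η₀).2‖ with hδ
  have hδ0 : 0 < δ := norm_pos_iff.2 (hK0 η₀ hη₀)
  set M := L + 1 + |a| + 2 * L ^ 2 + |C| with hM
  have hL := hf.one_le
  refine ⟨max 1 (M / δ), le_max_left _ _, fun η hη => ?_⟩
  set c := max 1 (M / δ)
  have hc1 : 1 ≤ c := le_max_left _ _
  have hcδ : M ≤ c * δ := by
    rw [← div_le_iff₀ hδ0]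
    exact le_max_right _ _
  have hx : M ≤ c * ‖(ℓ η).2‖ :=
    hcδ.trans (mul_le_mul_of_nonneg_left (hmin hη) (by linarith))
  have key := hf.apply_le_of_tube (η := scale ℓ 1 c (hf.squeeze η)) (by
    rw [scale_fst, one_smul]
    exact hf.norm_squeeze η)
  rw [scale_snd, squeeze_apply, scale_snd, one_smul, norm_smul,
    Real.norm_of_nonneg (by linarith : 0 ≤ c)] at key
  rw [squeeze_apply]
  refine key.trans ?_
  have h1 : 1 + |a| + 2 * L ^ 2 + |C| ≤ c * ‖(ℓ η).2‖ - L := by linarith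
  have h2 : 1 ≤ c * ‖(ℓ η).2‖ := by nlinarith [abs_nonneg a, abs_nonneg C]
  have h3 := abs_nonneg a
  have h4 := abs_nonneg C
  have h5 : 1 + |a| + 2 * L ^ 2 + |C| ≤ c * ‖(ℓ η).2‖ * (c * ‖(ℓ η).2‖ - L) := by
    nlinarith [sq_nonneg L]
  linarith [le_abs_self a, le_abs_self C]

/-! #### Linked cycles and descending cycles -/

/-- In the tube a function is high only on a bounded set, which is what makes compactness arguments
available for cycles. -/
theorem exists_tube {a m : ℝ} (ha : tameLevel L C ≤ a) (h : HasLinked ℓ f a m) :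
    ∃ σ : SingChain E k, Linked ℓ σ ∧ BoundaryIn (subLevel f (-a) ∩ {η | ‖(ℓ η).1‖ ≤ L}) k σ ∧
      chainImage σ ⊆ subLevel f m ∩ {η | ‖(ℓ η).1‖ ≤ L} := by
  obtain ⟨σ, h1, h2, h3⟩ := h
  refine ⟨SingChain.push hf.squeeze k σ, h1.push _ h2 fun x hx t _ => ?_,
    hf.boundaryIn_squeeze h2, ?_⟩
  · rw [snd_lineMap_squeeze]
    exact hf.snd_ne_zero ha hx
  · refine (chainImage_push_subset _ _).trans ?_
    rintro _ ⟨x, hx, rfl⟩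
    exact ⟨(hf.apply_squeeze_le x).trans (h3 hx), hf.norm_squeeze x⟩

theorem isDescendingCycle {a : ℝ} (ha : tameLevel L C ≤ a) {σ : SingChain E k} (h : Linked ℓ σ)
    (h' : BoundaryIn (subLevel f (-a)) k σ) (h'' : chainImage σ ⊆ subLevel f a) :
    IsDescendingCycle f k a σ :=
  ⟨h'', h', fun hb => h (IsRelBoundary.mono (subset_univ _)
    (fun _ hη => hf.snd_ne_zero ha hη) hb)⟩

/-- A relative boundary modulo {q ≠ 0} becomes one in the sublevel pair after squeezing p and
dilating q: the squeeze keeps everything under the level `a`, and the dilation carries the compact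
image of `ρ` below −a. Both maps are homotopic to the identity through maps that respect the pair,
so the class of `σ` would be zero. -/
theorem linked {a : ℝ} (ha : tameLevel L C ≤ a) {σ : SingChain E k}
    (h : IsDescendingCycle f k a σ) : Linked ℓ σ := by
  obtain ⟨h1, h2, h3⟩ := h
  rintro ⟨τ, ρ, -, hρ, hσ⟩
  refine h3 ?_
  obtain ⟨c, hc, hc'⟩ := hf.exists_stretch (isCompact_chainImage ρ) (fun η hη => hρ hη) a
  have hin : BoundaryIn (subLevel f (-a) ∩ {η | ‖(ℓ η).1‖ ≤ L}) k (SingChain.push hf.squeeze k σ) :=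
    hf.boundaryIn_squeeze h2
  change IsRelBoundary (subLevel f a) (subLevel f (-a)) σ
  rw [← isRelBoundary_push_iff hf.squeeze h1 h2
    (fun x hx t ht => (hf.apply_lineMap_squeeze_le x ht).trans hx)
    (fun x hx t ht => (hf.apply_lineMap_squeeze_le x ht).trans hx)]
  rw [← isRelBoundary_push_iff (hf.stretch (ContinuousMap.const E c))
    (B := {η | ‖(ℓ η).1‖ ≤ L}) ?_ hin ?_ ?_]
  · refine ⟨SingChain.push (hf.stretch (ContinuousMap.const E c)) _
      (SingChain.push hf.squeeze _ τ), SingChain.push (hf.stretch (ContinuousMap.const E c)) _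
      (SingChain.push hf.squeeze _ ρ), ?_, ?_, ?_⟩
    · refine (chainImage_push_subset _ _).trans ?_
      rintro _ ⟨y, hy, rfl⟩
      obtain ⟨x, hx, rfl⟩ := chainImage_push_subset _ _ hy
      refine (hf.apply_le_tameLevel ?_).trans ha
      rw [stretch_apply, scale_fst, one_smul]
      exact hf.norm_squeeze x
    · refine (chainImage_push_subset _ _).trans ?_
      rintro _ ⟨y, hy, rfl⟩
      obtain ⟨x, hx, rfl⟩ := chainImage_push_subset _ _ hy
      exact hc' x hx
    · rw [hσ, map_add, map_add, singBoundary_push, singBoundary_push]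
  · refine (chainImage_push_subset _ _).trans ?_
    rintro _ ⟨x, hx, rfl⟩
    exact hf.norm_squeeze x
  · intro x hx t ht
    refine (hf.apply_le_tameLevel ?_).trans ha
    rw [lineMap_stretch, scale_fst, one_smul]
    exact hx
  · intro x hx t ht
    have hx1 : f x ≤ -a := hx.1
    rw [lineMap_stretch]
    have h4 : (1 : ℝ) ≤ 1 + t * (ContinuousMap.const E c x - 1) := by
      simp only [ContinuousMap.const_apply]
      nlinarith [ht.1]
    have := hf.apply_scale_snd_le h4 (hf.le_norm_of_apply_le (η := x) (by linarith))
    exact (by linarith : f (scale ℓ 1 (1 + t * (ContinuousMap.const E c x - 1)) x) ≤ -a)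

theorem hasLinked_of_mem_cycleMaxima {a m : ℝ} (ha : tameLevel L C ≤ a)
    (hm : m ∈ cycleMaxima f k a) : HasLinked ℓ f a m := by
  obtain ⟨σ, hσ, hm⟩ := hm
  exact ⟨σ, hf.linked ha hσ, hσ.2.1, fun x hx => hm.2 ⟨x, hx, rfl⟩⟩

/-- The bound `m` may exceed the level `a`; squeezing into the tube brings the cycle under the level
without raising its maximum. -/
theorem exists_mem_cycleMaxima {a m : ℝ} (ha : tameLevel L C ≤ a) (h : HasLinked ℓ f a m) :
    ∃ m' ∈ cycleMaxima f k a, m' ≤ m := by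
  obtain ⟨σ, h1, h2, h3⟩ := hf.exists_tube ha h
  obtain ⟨η, hη, -⟩ := h1.exists_mem
  obtain ⟨m', hm'⟩ := ((isCompact_chainImage σ).image hf.continuous).exists_isGreatest
    ⟨f η, η, hη, rfl⟩
  refine ⟨m', ⟨σ, hf.isDescendingCycle ha h1 (boundaryIn_mono inter_subset_left h2)
    fun x hx => (hf.apply_le_tameLevel (h3 hx).2).trans ha, hm'⟩, ?_⟩
  obtain ⟨x, hx, rfl⟩ := hm'.1
  exact (h3 hx).1

theorem neg_tameLevel_le_of_hasLinked {a m : ℝ} (h : HasLinked ℓ f a m) :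
    -tameLevel L C ≤ m := by
  obtain ⟨σ, h1, -, h3⟩ := h
  obtain ⟨η, hη, h0⟩ := h1.exists_mem
  exact (hf.neg_tameLevel_lt h0).le.trans (h3 hη)

/-- Dilating q where f is very negative pushes the boundary from below −a to below −b, and leaves
the higher part of the chain in place. -/
theorem hasLinked_of_hasLinked {a b m : ℝ} (ha : tameLevel L C < a) (h : HasLinked ℓ f a m) :
    HasLinked ℓ f b m := by
  obtain ⟨σ, h1, h2, h3⟩ := h
  set a₀ := tameLevel L C with ha₀
  have hfc := hf.continuous
  -- This factor is 1 where f ≥ −a₀, and at least 1 + |a| + |b| where f ≤ −a.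
  let β : C(E, ℝ) :=
    ⟨fun η => 1 + (|b| + |a|) / (a - a₀) * max 0 (-a₀ - f η), by fun_prop⟩
  have hΛ : 0 ≤ (|b| + |a|) / (a - a₀) := div_nonneg (by positivity) (by linarith)
  have hβ : ∀ η, 1 ≤ β η := fun η => by
    have := mul_nonneg hΛ (le_max_left 0 (-a₀ - f η))
    change (1 : ℝ) ≤ 1 + (|b| + |a|) / (a - a₀) * max 0 (-a₀ - f η)
    linarith
  refine ⟨SingChain.push (hf.stretch β) k σ, h1.push _ h2 fun x hx t ht => ?_,
    boundaryIn_push _ (fun x hx => ?_) h2, ?_⟩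
  · exact hf.snd_lineMap_stretch_ne_zero hβ (hf.snd_ne_zero ha.le hx) ht
  · have hx : f x ≤ -a := hx
    have h4 := hf.apply_scale_snd_le (hβ x) (hf.le_norm_of_apply_le (η := x) (by linarith))
    have h5 : |b| + |a| ≤ β x - 1 := by
      change _ ≤ 1 + (|b| + |a|) / (a - a₀) * max 0 (-a₀ - f x) - 1
      have h6 : a - a₀ ≤ max 0 (-a₀ - f x) := le_max_of_le_right (by linarith)
      have h7 := mul_le_mul_of_nonneg_left h6 hΛ
      rw [div_mul_cancel₀ _ (by linarith)] at h7
      linarith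
    change f (scale ℓ 1 (β x) x) ≤ -b
    linarith [neg_abs_le a, le_abs_self b]
  · refine (chainImage_push_subset _ _).trans ?_
    rintro _ ⟨x, hx, rfl⟩
    refine le_trans (b := f x) ?_ (h3 hx)
    rw [stretch_apply]
    rcases le_total (f x) (-a₀) with h4 | h4
    · linarith [hf.apply_scale_snd_le (hβ x) (hf.le_norm_of_apply_le h4), hβ x]
    · have : β x = 1 := by
        change 1 + (|b| + |a|) / (a - a₀) * max 0 (-a₀ - f x) = 1
        rw [max_eq_left (by linarith), mul_zero, add_zero]
      rw [this, scale_one_one]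

end IsTame

end Tame

end

noncomputable section

/-! ### The minmax value of a tame function -/

section TameMinmax

open SingChain

variable {E P : Type*} [NormedAddCommGroup E] [NormedSpace ℝ E] [NormedAddCommGroup P]
  [NormedSpace ℝ P] {k : ℕ} {L C : ℝ} {f : E → ℝ}

/-- The coordinates of a point of the hyperplane `∑ fⱼ = 0` of `ℝ ^ (k + 1)`. -/
def hyperCoord (q : EuclideanSpace ℝ (Fin k)) (j : Fin (k + 1)) : ℝ :=
  Fin.cases (-∑ i, q i) (fun i => q i) j

@[simp] theorem hyperCoord_zero (q : EuclideanSpace ℝ (Fin k)) : hyperCoord q 0 = -∑ i, q i := rfl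

@[simp] theorem hyperCoord_succ (q : EuclideanSpace ℝ (Fin k)) (i : Fin k) :
    hyperCoord q i.succ = q i := rfl

theorem continuous_hyperCoord (j : Fin (k + 1)) : Continuous fun q => hyperCoord (k := k) q j := by
  refine Fin.cases ?_ (fun i => ?_) j
  · simp only [hyperCoord_zero]
    fun_prop
  · simp only [hyperCoord_succ]
    fun_prop

theorem sum_hyperCoord (q : EuclideanSpace ℝ (Fin k)) : ∑ j, hyperCoord q j = 0 := by
  simp [Fin.sum_univ_succ]

theorem exists_hyperCoord_nonneg (q : EuclideanSpace ℝ (Fin k)) : ∃ j, 0 ≤ hyperCoord q j := by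
  by_contra! h
  have := Finset.sum_lt_sum_of_nonempty Finset.univ_nonempty fun j (_ : j ∈ Finset.univ) => h j
  rw [sum_hyperCoord, Finset.sum_const_zero] at this
  exact lt_irrefl _ this

theorem exists_hyperCoord_neg {q : EuclideanSpace ℝ (Fin k)} (hq : q ≠ 0) :
    ∃ j, hyperCoord q j < 0 := by
  by_contra! h
  have h0 := (Finset.sum_eq_zero_iff_of_nonneg fun j (_ : j ∈ Finset.univ) => h j).1
    (sum_hyperCoord q)
  refine hq ?_
  ext i
  exact h0 i.succ (Finset.mem_univ _)

/-- The affine simplex centered at the origin in the space of the coordinate `q`. -/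
def linkSimplex (ℓ : E ≃L[ℝ] P × EuclideanSpace ℝ (Fin k)) :
    C(stdSimplex ℝ (Fin (k + 1)), E) where
  toFun t := ℓ.symm (0, WithLp.toLp 2 fun i => t i.succ - ((k : ℝ) + 1)⁻¹)
  continuous_toFun := by
    have : ∀ i : Fin k, Continuous fun t : stdSimplex ℝ (Fin (k + 1)) => t i.succ :=
      fun i => (continuous_apply i.succ).comp continuous_subtype_val
    refine ℓ.symm.continuous.comp (continuous_const.prodMk ?_)
    exact (PiLp.continuous_toLp 2 _).comp (continuous_pi fun i => (this i).sub continuous_const)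

theorem hyperCoord_linkSimplex (ℓ : E ≃L[ℝ] P × EuclideanSpace ℝ (Fin k))
    (t : stdSimplex ℝ (Fin (k + 1))) (j : Fin (k + 1)) :
    hyperCoord (ℓ (linkSimplex ℓ t)).2 j = t j - ((k : ℝ) + 1)⁻¹ := by
  have h2 : (ℓ (linkSimplex ℓ t)).2 = WithLp.toLp 2 fun i => t i.succ - ((k : ℝ) + 1)⁻¹ := by
    simp [linkSimplex]
  rw [h2]
  refine Fin.cases ?_ (fun i => rfl) j
  have h1 := stdSimplex.sum_eq_one t
  rw [Fin.sum_univ_succ] at h1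
  rw [hyperCoord_zero]
  simp only [Finset.sum_sub_distrib, Finset.sum_const, Finset.card_univ, Fintype.card_fin,
    nsmul_eq_mul]
  field_simp
  linear_combination (-(k : ℝ) - 1) * h1

/-- Hyperplane coordinates sum to zero, so one of them is always nonnegative, and one is negative
exactly off {q = 0}. On this simplex, centered at the origin, coordinate `j` is nonnegative only if
`t j` is at least 1/(k+1). -/
theorem linked_linkSimplex (ℓ : E ≃L[ℝ] P × EuclideanSpace ℝ (Fin k)) :
    Linked ℓ (Finsupp.single (linkSimplex ℓ) 1) := by
  intro h
  refine not_isRelBoundary_single (fun j η => hyperCoord (ℓ η).2 j) (fun j => ?_)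
    (fun η => exists_hyperCoord_nonneg _) (linkSimplex ℓ) (fun t j ht => ?_)
    (h.mono Subset.rfl fun η hη => exists_hyperCoord_neg hη)
  · exact (continuous_hyperCoord j).comp (by fun_prop)
  · rw [hyperCoord_linkSimplex] at ht
    have : 0 < ((k : ℝ) + 1)⁻¹ := by positivity
    linarith

/-- On face `i` the coordinate `i` is −1/(k+1), which keeps q away from 0. In degree 0 there is no
boundary and the empty set serves. -/
theorem boundaryIn_linkSimplex (ℓ : E ≃L[ℝ] P × EuclideanSpace ℝ (Fin k)) :
    ∃ K : Set E, IsCompact K ∧ (∀ η ∈ K, (ℓ η).2 ≠ 0) ∧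
      BoundaryIn K k (Finsupp.single (linkSimplex ℓ) 1) := by
  cases k with
  | zero => exact ⟨∅, isCompact_empty, by simp, trivial⟩
  | succ k =>
    refine ⟨chainImage (singBoundary E k (Finsupp.single (linkSimplex ℓ) 1)),
      isCompact_chainImage _, fun η hη h0 => ?_, Subset.rfl⟩
    rw [singBoundary_single] at hη
    have hsub : chainImage (∑ i : Fin (k + 2),
        (Finsupp.single ((linkSimplex ℓ).comp (faceMap k i)) 1 : SingChain E k)) ⊆
        ⋃ i : Fin (k + 2), range ((linkSimplex ℓ).comp (faceMap k i)) :=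
      chainImage_sum_subset _ _ fun i _ => (chainImage_single_subset _).trans
        (subset_iUnion (fun i : Fin (k + 2) => range ((linkSimplex ℓ).comp (faceMap k i))) i)
    obtain ⟨i, t, rfl⟩ := mem_iUnion.1 (hsub hη)
    have h1 := hyperCoord_linkSimplex ℓ (faceMap k i t) i
    have h2 : faceMap k i t i = 0 := stdSimplex.map_succAbove_self i t
    have h3 : hyperCoord (0 : EuclideanSpace ℝ (Fin (k + 1))) i = 0 := by
      refine Fin.cases ?_ (fun j => ?_) i <;> simp
    change (ℓ (linkSimplex ℓ (faceMap k i t))).2 = 0 at h0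
    rw [h0, h2, h3] at h1
    have : 0 < (((k + 1 : ℕ) : ℝ) + 1)⁻¹ := by positivity
    linarith

namespace IsTame

variable {ℓ : E ≃L[ℝ] P × EuclideanSpace ℝ (Fin k)} (hf : IsTame ℓ L C f)
include hf

/-- The link simplex, squeezed and then dilated until its boundary is low enough, stays in the tube;
hence a bound on its values that does not depend on `a`. -/
theorem hasLinked_tameLevel (a : ℝ) : HasLinked ℓ f a (tameLevel L C) := by
  obtain ⟨K, hK, hK0, hbd⟩ := boundaryIn_linkSimplex ℓ
  obtain ⟨c, hc, hc'⟩ := hf.exists_stretch hK hK0 a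
  let g : C(E, E) := (hf.stretch (ContinuousMap.const E c)).comp hf.squeeze
  have hg : ∀ η, g η = scale ℓ (squeezeFactor ℓ L η) c η := fun η => by
    change scale ℓ 1 c (scale ℓ (squeezeFactor ℓ L η) 1 η) = _
    rw [scale_scale, one_mul, mul_one]
  refine ⟨SingChain.push g k (Finsupp.single (linkSimplex ℓ) 1),
    (linked_linkSimplex ℓ).push g hbd fun x hx t ht => ?_,
    boundaryIn_push g (fun x hx => hc' x hx) hbd, ?_⟩
  · rw [hg, lineMap_scale, scale_snd]
    refine smul_ne_zero (ne_of_gt ?_) (hK0 x hx)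
    nlinarith [ht.1, ht.2]
  · refine (chainImage_push_subset _ _).trans ?_
    rintro _ ⟨x, -, rfl⟩
    refine hf.apply_le_tameLevel ?_
    rw [hg, scale_fst, norm_smul, Real.norm_of_nonneg (squeezeFactor_nonneg hf.one_le x)]
    exact norm_squeeze_le hf.one_le x

theorem isGLB_sInf (a : ℝ) :
    IsGLB {m | HasLinked ℓ f a m} (sInf {m | HasLinked ℓ f a m}) :=
  isGLB_csInf ⟨_, hf.hasLinked_tameLevel a⟩
    ⟨-tameLevel L C, fun _ hm => hf.neg_tameLevel_le_of_hasLinked hm⟩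

theorem setOf_hasLinked_eq {a b : ℝ} (ha : tameLevel L C < a) (hb : tameLevel L C < b) :
    {m | HasLinked ℓ f a m} = {m | HasLinked ℓ f b m} :=
  Set.ext fun _ => ⟨hf.hasLinked_of_hasLinked ha, hf.hasLinked_of_hasLinked hb⟩

/-- The two sets need not coincide, linked bounds being closed upwards, but they have the same lower
bounds. -/
theorem isGLB_cycleMaxima_iff {a c : ℝ} (ha : tameLevel L C ≤ a) :
    IsGLB (cycleMaxima f k a) c ↔ IsGLB {m | HasLinked ℓ f a m} c := by
  have : lowerBounds (cycleMaxima f k a) = lowerBounds {m | HasLinked ℓ f a m} := by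
    refine Subset.antisymm (fun c hc m hm => ?_) fun c hc m hm =>
      hc (hf.hasLinked_of_mem_cycleMaxima ha hm)
    obtain ⟨m', hm', hle⟩ := hf.exists_mem_cycleMaxima ha hm
    exact (hc hm').trans hle
  rw [IsGLB, IsGLB, this]

theorem minmaxValue_eq {a : ℝ} (ha : tameLevel L C < a) :
    minmaxValue f k = sInf {m | HasLinked ℓ f a m} := by
  refine Tendsto.limUnder_eq ?_
  refine tendsto_const_nhds.congr' ?_
  filter_upwards [eventually_gt_atTop (tameLevel L C)] with b hb
  have h := (hf.isGLB_cycleMaxima_iff hb.le).2 (hf.isGLB_sInf b)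
  obtain ⟨m', hm', -⟩ := hf.exists_mem_cycleMaxima hb.le (hf.hasLinked_tameLevel b)
  rw [h.csInf_eq ⟨m', hm'⟩, hf.setOf_hasLinked_eq ha hb]

theorem isGLB_minmaxValue {a : ℝ} (ha : tameLevel L C < a) :
    IsGLB {m | HasLinked ℓ f a m} (minmaxValue f k) := by
  rw [hf.minmaxValue_eq ha]
  exact hf.isGLB_sInf a

theorem isGLB_cycleMaxima {a : ℝ} (ha : tameLevel L C < a) :
    IsGLB (cycleMaxima f k a) (minmaxValue f k) :=
  (hf.isGLB_cycleMaxima_iff ha.le).2 (hf.isGLB_minmaxValue ha)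

theorem minmaxValue_le {a m : ℝ} (ha : tameLevel L C < a) (h : HasLinked ℓ f a m) :
    minmaxValue f k ≤ m :=
  (hf.isGLB_minmaxValue ha).1 h

theorem exists_hasLinked_lt {a m : ℝ} (ha : tameLevel L C < a) (h : minmaxValue f k < m) :
    HasLinked ℓ f a m := by
  obtain ⟨m', ⟨σ, h1, h2, h3⟩, -, hlt⟩ := (hf.isGLB_minmaxValue ha).exists_between h
  exact ⟨σ, h1, h2, fun x hx => (show f x ≤ m' from h3 hx).trans hlt.le⟩

theorem neg_tameLevel_le_minmaxValue : -tameLevel L C ≤ minmaxValue f k :=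
  (hf.isGLB_minmaxValue (lt_add_one _)).2 fun _ hm => hf.neg_tameLevel_le_of_hasLinked hm

end IsTame

end TameMinmax

end

/-! ### Deformations, and the minmax of a family -/

noncomputable section

/-! ### Descent deformations -/

section Descent

variable {E : Type*} [NormedAddCommGroup E]

/-- `g` is supported in `O` and makes `f` decrease by at least `ε` times the displacement. -/
structure IsDescent (f : E → ℝ) (O : Set E) (ε : ℝ) (g : C(E, E)) : Prop where
  id_off : ∀ η ∉ O, g η = η
  mapsTo : MapsTo g O O
  le : ∀ η, f (g η) ≤ f η - ε * ‖g η - η‖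

theorem IsDescent.mono {f : E → ℝ} {O : Set E} {ε ε' : ℝ} {g : C(E, E)} (h : IsDescent f O ε g)
    (hε : ε' ≤ ε) : IsDescent f O ε' g :=
  ⟨h.id_off, h.mapsTo, fun η => (h.le η).trans
    (by linarith [mul_le_mul_of_nonneg_right hε (norm_nonneg (g η - η))])⟩

/-- A decrease measured by displacement survives composition, by the triangle inequality; this is
why `IsDescent` is phrased with displacement. -/
theorem IsDescent.comp {f : E → ℝ} {O : Set E} {ε : ℝ} (hε : 0 < ε) {g g' : C(E, E)}
    (h : IsDescent f O ε g) (h' : IsDescent f O ε g') : IsDescent f O ε (g'.comp g) where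
  id_off η hη := by rw [ContinuousMap.comp_apply, h.id_off η hη, h'.id_off η hη]
  mapsTo := h'.mapsTo.comp h.mapsTo
  le η := by
    rw [ContinuousMap.comp_apply]
    have h1 := h.le η
    have h2 := h'.le (g η)
    have h3 : ‖g' (g η) - η‖ ≤ ‖g' (g η) - g η‖ + ‖g η - η‖ := by
      simpa using norm_add_le (g' (g η) - g η) (g η - η)
    nlinarith

theorem IsDescent.lt_of_ne {f : E → ℝ} {O : Set E} {ε : ℝ} (hε : 0 < ε) {g : C(E, E)}
    (h : IsDescent f O ε g) {η : E} (hη : g η ≠ η) : f (g η) < f η := by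
  have h1 := h.le η
  have h2 : 0 < ‖g η - η‖ := norm_pos_iff.2 (sub_ne_zero.2 hη)
  nlinarith

/-- If two functions are close in the Lipschitz sense, a descent deformation of the first one does
not increase the second one. -/
theorem IsDescent.apply_le_of_lipschitz {f f' : E → ℝ} {O : Set E} {ε : ℝ} {g : C(E, E)}
    (h : IsDescent f O ε g)
    (hff' : ∀ η ∈ O, ∀ η' ∈ O, |(f' η - f η) - (f' η' - f η')| ≤ ε * ‖η - η'‖) (η : E) :
    f' (g η) ≤ f' η := by
  by_cases hη : η ∈ O
  · have h1 := h.le η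
    have h2 := (abs_le.1 (hff' (g η) (h.mapsTo hη) η hη)).2
    linarith
  · rw [h.id_off η hη]

variable [NormedSpace ℝ E] [FiniteDimensional ℝ E]

/-- The map adds a small bump function times the descent direction given by `exists_descent`. -/
theorem exists_isDescent_nhds {f : E → ℝ} (hf : LocallyLipschitz f) {O : Set E} (hO : IsOpen O)
    {η₀ : E} (hη₀ : η₀ ∈ O) (h0 : (0 : E →L[ℝ] ℝ) ∉ clarkeDeriv f η₀) :
    ∃ ε > 0, ∃ g : C(E, E), IsDescent f O ε g ∧ ∀ᶠ η in 𝓝 η₀, g η ≠ η := by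
  obtain ⟨K, t, ht, hK⟩ := hf η₀
  obtain ⟨r, hr, hrt⟩ := Metric.mem_nhds_iff.1 ht
  obtain ⟨v, κ, hκ, δ, hδ, -, hdesc⟩ := exists_descent hr (hK.mono hrt) h0
  obtain ⟨δ', hδ', hδO⟩ := Metric.isOpen_iff.1 hO η₀ hη₀
  set ρ := min δ δ' / 2 with hρ
  have hm : 0 < min δ δ' := lt_min hδ hδ'
  have hρ0 : 0 < ρ := by positivity
  have hρδ : 2 * ρ ≤ δ := by rw [hρ]; linarith [min_le_left δ δ']
  have hρδ' : 2 * ρ ≤ δ' := by rw [hρ]; linarith [min_le_right δ δ']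
  have hv : 0 < 1 + ‖v‖ := by positivity
  -- The step is admissible for the descent estimate and short enough for points of the ρ-ball to
  -- stay in the 2ρ-ball, which lies in O.
  set c := min δ (ρ / (1 + ‖v‖)) with hc
  have hc0 : 0 < c := lt_min hδ (by positivity)
  have hcv : c * (1 + ‖v‖) ≤ ρ := by
    rw [← le_div_iff₀ hv]
    exact min_le_right _ _
  let χ : E → ℝ := fun η => c * max 0 (1 - dist η η₀ / ρ)
  have hχc : Continuous χ := by
    change Continuous fun η => c * max 0 (1 - dist η η₀ / ρ)
    fun_prop
  have hχ0 : ∀ η, 0 ≤ χ η := fun η => mul_nonneg hc0.le (le_max_left _ _)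
  have hχ1 : ∀ η, χ η ≤ c := fun η => by
    refine mul_le_of_le_one_right hc0.le (max_le zero_le_one ?_)
    have : 0 ≤ dist η η₀ / ρ := by positivity
    linarith
  have hχ_off : ∀ η, ρ ≤ dist η η₀ → χ η = 0 := fun η hη => by
    change c * max 0 (1 - dist η η₀ / ρ) = 0
    rw [max_eq_left, mul_zero]
    have : 1 ≤ dist η η₀ / ρ := (one_le_div hρ0).2 hη
    linarith
  have hχ_on : ∀ η, dist η η₀ < ρ → 0 < χ η := fun η hη => by
    refine mul_pos hc0 (lt_max_of_lt_right ?_)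
    have : dist η η₀ / ρ < 1 := (div_lt_one hρ0).2 hη
    linarith
  let g : C(E, E) := ⟨fun η => η + χ η • v, by fun_prop⟩
  have hg : ∀ η, g η = η + χ η • v := fun _ => rfl
  have hgdist : ∀ η, ‖g η - η‖ = χ η * ‖v‖ := fun η => by
    rw [hg, add_sub_cancel_left, norm_smul, Real.norm_of_nonneg (hχ0 η)]
  have hgf : ∀ η, f (g η) ≤ f η - κ * χ η := by
    intro η
    rcases lt_or_ge (dist η η₀) ρ with h | h
    · exact hdesc η (by rw [Metric.mem_ball]; linarith) _
        ⟨hχ0 η, (hχ1 η).trans (min_le_left _ _)⟩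
    · rw [hg, hχ_off η h]
      simp
  refine ⟨κ / (1 + ‖v‖), by positivity, g, ⟨?_, ?_, ?_⟩, ?_⟩
  · intro η hη
    have : ρ ≤ dist η η₀ := by
      by_contra! hlt
      exact hη (hδO (by rw [Metric.mem_ball]; linarith))
    rw [hg, hχ_off η this, zero_smul, add_zero]
  · intro η hη
    rcases lt_or_ge (dist η η₀) ρ with h | h
    · refine hδO ?_
      rw [Metric.mem_ball]
      have h1 : dist (g η) η₀ ≤ dist (g η) η + dist η η₀ := dist_triangle _ _ _
      rw [dist_eq_norm (g η) η, hgdist] at h1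
      have h2 : χ η * ‖v‖ ≤ c * ‖v‖ := mul_le_mul_of_nonneg_right (hχ1 η) (norm_nonneg v)
      linarith
    · rw [hg, hχ_off η h, zero_smul, add_zero]
      exact hη
  · intro η
    refine (hgf η).trans ?_
    rw [hgdist]
    have h1 : κ / (1 + ‖v‖) * (χ η * ‖v‖) ≤ κ * χ η := by
      rw [div_mul_eq_mul_div, div_le_iff₀ hv]
      nlinarith [mul_nonneg hκ.le (hχ0 η), norm_nonneg v]
    linarith
  · filter_upwards [Metric.ball_mem_nhds η₀ hρ0] with η hη hne
    have h1 := hgf η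
    have h2 := mul_pos hκ (hχ_on η hη)
    rw [hne] at h1
    linarith

/-- A compact set without critical points can be moved by a descent deformation. -/
theorem exists_isDescent {f : E → ℝ} (hf : LocallyLipschitz f) {O : Set E} (hO : IsOpen O)
    {K : Set E} (hK : IsCompact K) (hKO : K ⊆ O)
    (h0 : ∀ η ∈ K, (0 : E →L[ℝ] ℝ) ∉ clarkeDeriv f η) :
    ∃ ε > 0, ∃ g : C(E, E), IsDescent f O ε g ∧ ∀ η ∈ K, g η ≠ η := by
  refine hK.induction_on (p := fun K => ∃ ε > 0, ∃ g : C(E, E), IsDescent f O ε g ∧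
    ∀ η ∈ K, g η ≠ η) ?_ ?_ ?_ ?_
  · exact ⟨1, one_pos, ContinuousMap.id E, ⟨fun _ _ => rfl, fun _ h => h, fun η => by simp⟩,
      by simp⟩
  · rintro s t hst ⟨ε, hε, g, hg, h⟩
    exact ⟨ε, hε, g, hg, fun η hη => h η (hst hη)⟩
  · rintro s t ⟨ε, hε, g, hg, h⟩ ⟨ε', hε', g', hg', h'⟩
    have hm : 0 < min ε ε' := lt_min hε hε'
    have hg1 := hg.mono (min_le_left ε ε')
    have hg2 := hg'.mono (min_le_right ε ε')
    refine ⟨min ε ε', hm, g'.comp g, hg1.comp hm hg2, fun η hη => ?_⟩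
    rw [ContinuousMap.comp_apply]
    -- If `g` moves the point, f drops strictly and `g'` cannot raise it again, so the point does
    -- not return; if `g` fixes it, `g'` acts on it alone.
    by_cases hgη : g η = η
    · rw [hgη]
      rcases hη with hη | hη
      · exact (h η hη hgη).elim
      · exact h' η hη
    · intro heq
      have h1 := hg1.lt_of_ne hm hgη
      have h2 : f (g' (g η)) ≤ f (g η) := by
        have := hg2.le (g η)
        nlinarith [norm_nonneg (g' (g η) - g η)]
      rw [heq] at h2
      linarith
  · intro η hη
    obtain ⟨ε, hε, g, hg, h⟩ := exists_isDescent_nhds hf hO (hKO hη) (h0 η hη)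
    exact ⟨_, mem_nhdsWithin_of_mem_nhds h, ε, hε, g, hg, fun _ h => h⟩

end Descent

/-! ### Critical points of tame functions -/

section TameCritical

variable {E P : Type*} [NormedAddCommGroup E] [NormedSpace ℝ E] [NormedAddCommGroup P]
  [InnerProductSpace ℝ P] {k : ℕ}

theorem fderiv_apply_le_of_eventually {f : E → ℝ} {η w : E} {b : ℝ} (hf : DifferentiableAt ℝ f η)
    (h : ∀ᶠ s : ℝ in 𝓝[>] 0, f (η + s • w) ≤ f η + s * b) : fderiv ℝ f η w ≤ b := by
  have hd : HasDerivAt (fun s : ℝ => f (η + s • w)) (fderiv ℝ f η w) 0 := by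
    have h1 : HasDerivAt (fun s : ℝ => η + s • w) w 0 := by
      simpa using ((hasDerivAt_id (0 : ℝ)).smul_const w).const_add η
    have hf' : HasFDerivAt f (fderiv ℝ f η) (η + (0 : ℝ) • w) := by simpa using hf.hasFDerivAt
    exact hf'.comp_hasDerivAt 0 h1
  have hs := hd.tendsto_slope_zero_right
  refine le_of_tendsto hs ?_
  filter_upwards [h, self_mem_nhdsWithin] with s hs hs0
  have hs0 : 0 < s := hs0
  simp only [zero_add, zero_smul, add_zero, smul_eq_mul]
  rw [inv_mul_le_iff₀ hs0]
  linarith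

namespace IsTame

variable {L C : ℝ} {f : E → ℝ} {ℓ : E ≃L[ℝ] P × EuclideanSpace ℝ (Fin k)} (hf : IsTame ℓ L C f)
include hf

theorem locallyLipschitz : LocallyLipschitz f := by
  have h1 : LipschitzWith (Real.toNNReal (L * (2 * ‖(ℓ : E →L[ℝ] P × EuclideanSpace ℝ (Fin k))‖)))
      fun η => f η - (‖(ℓ η).1‖ ^ 2 - ‖(ℓ η).2‖ ^ 2) := by
    refine LipschitzWith.of_dist_le_mul fun η η' => ?_
    have hL := hf.one_le
    rw [Real.coe_toNNReal _ (by positivity), Real.dist_eq, dist_eq_norm]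
    refine (hf.lip η η').trans ?_
    rw [mul_assoc]
    refine mul_le_mul_of_nonneg_left ?_ (by linarith)
    have h2 : ‖ℓ (η - η')‖ ≤ ‖(ℓ : E →L[ℝ] P × EuclideanSpace ℝ (Fin k))‖ * ‖η - η'‖ :=
      (ℓ : E →L[ℝ] P × EuclideanSpace ℝ (Fin k)).le_opNorm _
    have h3 := norm_fst_le (ℓ (η - η'))
    have h4 := norm_snd_le (ℓ (η - η'))
    rw [map_sub, Prod.fst_sub] at h3
    rw [map_sub, Prod.snd_sub] at h4
    rw [map_sub] at h2
    linarith
  have h2 : ContDiff ℝ 1 fun η => ‖(ℓ η).1‖ ^ 2 - ‖(ℓ η).2‖ ^ 2 := by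
    have h3 : ContDiff ℝ 1 fun η => (ℓ η).1 := contDiff_fst.comp ℓ.contDiff
    have h4 : ContDiff ℝ 1 fun η => (ℓ η).2 := contDiff_snd.comp ℓ.contDiff
    exact (h3.norm_sq ℝ).sub (h4.norm_sq ℝ)
  have h3 := h1.locallyLipschitz.add h2.locallyLipschitz
  simpa only [sub_add_cancel] using h3

theorem fderiv_fst_le {η : E} (hd : DifferentiableAt ℝ f η) :
    fderiv ℝ f η (ℓ.symm (-(ℓ η).1, 0)) ≤ L * ‖(ℓ η).1‖ - ‖(ℓ η).1‖ ^ 2 := by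
  refine fderiv_apply_le_of_eventually hd ?_
  filter_upwards [Ioo_mem_nhdsGT (zero_lt_one (α := ℝ))] with s hs
  have h1 : η + s • ℓ.symm (-(ℓ η).1, 0) = scale ℓ (1 - s) 1 η := by
    apply ℓ.injective
    refine Prod.ext ?_ ?_
    · simp [add_smul, sub_eq_add_neg]
    · simp
  rw [h1]
  have key := (abs_le.1 (hf.lip (scale ℓ (1 - s) 1 η) η)).2
  have h2 : (1 - s) • (ℓ η).1 - (ℓ η).1 = -(s • (ℓ η).1) := by rw [sub_smul, one_smul]; abel
  rw [scale_fst, scale_snd, one_smul, sub_self, norm_zero, add_zero, h2, norm_neg, norm_smul,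
    norm_smul, Real.norm_of_nonneg (by linarith [hs.2] : 0 ≤ 1 - s),
    Real.norm_of_nonneg hs.1.le] at key
  -- The quadratic part loses s(2 − s)|p|², at least s|p|² for s < 1, while the Lipschitz part gains
  -- at most sL|p|.
  nlinarith [hs.1, hs.2, mul_nonneg hs.1.le (sq_nonneg ‖(ℓ η).1‖),
    mul_nonneg (mul_nonneg hs.1.le (sub_nonneg.2 hs.2.le)) (sq_nonneg ‖(ℓ η).1‖)]

theorem fderiv_snd_le {η : E} (hd : DifferentiableAt ℝ f η) :
    fderiv ℝ f η (ℓ.symm (0, (ℓ η).2)) ≤ L * ‖(ℓ η).2‖ - ‖(ℓ η).2‖ ^ 2 := by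
  refine fderiv_apply_le_of_eventually hd ?_
  filter_upwards [Ioo_mem_nhdsGT (zero_lt_one (α := ℝ))] with s hs
  have h1 : η + s • ℓ.symm (0, (ℓ η).2) = scale ℓ 1 (1 + s) η := by
    apply ℓ.injective
    refine Prod.ext ?_ ?_
    · simp
    · simp [add_smul]
  rw [h1]
  have key := (abs_le.1 (hf.lip (scale ℓ 1 (1 + s) η) η)).2
  have h2 : (1 + s) • (ℓ η).2 - (ℓ η).2 = s • (ℓ η).2 := by rw [add_smul, one_smul]; abel
  rw [scale_fst, scale_snd, one_smul, sub_self, norm_zero, zero_add, h2, norm_smul,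
    norm_smul, Real.norm_of_nonneg (by linarith [hs.1] : 0 ≤ 1 + s),
    Real.norm_of_nonneg hs.1.le] at key
  nlinarith [hs.1, hs.2, mul_nonneg hs.1.le (sq_nonneg ‖(ℓ η).2‖),
    mul_nonneg (mul_nonneg hs.1.le hs.1.le) (sq_nonneg ‖(ℓ η).2‖)]

/-- The critical points of a tame function are bounded. -/
theorem norm_le_of_zero_mem {η : E} (h : (0 : E →L[ℝ] ℝ) ∈ clarkeDeriv f η) :
    ‖(ℓ η).1‖ ≤ L ∧ ‖(ℓ η).2‖ ≤ L := by
  have hL := hf.one_le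
  constructor
  · have := clarkeDeriv_apply_le (f := f) (a := η) (w := fun η => ℓ.symm (-(ℓ η).1, 0))
      (g := fun η => L * ‖(ℓ η).1‖ - ‖(ℓ η).1‖ ^ 2) (by fun_prop) (by fun_prop)
      (Eventually.of_forall fun η hd => hf.fderiv_fst_le hd) h
    rw [zero_apply] at this
    by_contra! hlt
    nlinarith
  · have := clarkeDeriv_apply_le (f := f) (a := η) (w := fun η => ℓ.symm (0, (ℓ η).2))
      (g := fun η => L * ‖(ℓ η).2‖ - ‖(ℓ η).2‖ ^ 2) (by fun_prop) (by fun_prop)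
      (Eventually.of_forall fun η hd => hf.fderiv_snd_le hd) h
    rw [zero_apply] at this
    by_contra! hlt
    nlinarith

end IsTame

theorem isClosed_zero_mem_clarkeDeriv [FiniteDimensional ℝ E] {f : E → ℝ}
    (hf : LocallyLipschitz f) : IsClosed {η | (0 : E →L[ℝ] ℝ) ∈ clarkeDeriv f η} := by
  rw [← isOpen_compl_iff, isOpen_iff_mem_nhds]
  intro η hη
  obtain ⟨K, t, ht, hK⟩ := hf η
  obtain ⟨r, hr, hrt⟩ := Metric.mem_nhds_iff.1 ht
  obtain ⟨v, κ, hκ, δ, hδ, h, -⟩ := exists_descent hr (hK.mono hrt) hη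
  filter_upwards [Metric.ball_mem_nhds η hδ] with η' hη' using h η' hη'

/-- The set of the points whose coordinates are bounded by `r₁` and `r₂`. -/
def box (ℓ : E ≃L[ℝ] P × EuclideanSpace ℝ (Fin k)) (r₁ r₂ : ℝ) : Set E :=
  {η | ‖(ℓ η).1‖ ≤ r₁ ∧ ‖(ℓ η).2‖ ≤ r₂}

theorem isCompact_box [FiniteDimensional ℝ E] (ℓ : E ≃L[ℝ] P × EuclideanSpace ℝ (Fin k))
    (r₁ r₂ : ℝ) : IsCompact (box ℓ r₁ r₂) := by
  have : FiniteDimensional ℝ (P × EuclideanSpace ℝ (Fin k)) :=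
    ℓ.toLinearEquiv.finiteDimensional
  have : FiniteDimensional ℝ P := FiniteDimensional.of_surjective
    (LinearMap.fst ℝ P (EuclideanSpace ℝ (Fin k))) LinearMap.fst_surjective
  have : ProperSpace P := FiniteDimensional.proper_real P
  have h : IsCompact (ℓ ⁻¹' (Metric.closedBall 0 r₁ ×ˢ Metric.closedBall 0 r₂)) :=
    ℓ.toHomeomorph.isCompact_preimage.2
      ((isCompact_closedBall (0 : P) r₁).prod (isCompact_closedBall _ r₂))
  convert! h using 1
  ext η
  simp [box]

end TameCritical

end

noncomputable section

/-! ### Families of tame functions -/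

section TameFamily

open SingChain

variable {B E P : Type*} [NormedAddCommGroup B] [NormedSpace ℝ B] [NormedAddCommGroup E]
  [NormedSpace ℝ E] [NormedAddCommGroup P] [InnerProductSpace ℝ P] {k : ℕ}

/-- A family of tame functions, continuously differentiable with respect to the parameter, whose
increments with respect to the parameter are locally Lipschitz with a small constant. -/
structure IsTameFamily (ℓ : E ≃L[ℝ] P × EuclideanSpace ℝ (Fin k)) (F : B → E → ℝ) : Prop where
  tame : ∀ x₀, ∃ L C, ∀ᶠ x in 𝓝 x₀, IsTame ℓ L C (F x)
  diff : ∀ x η, DifferentiableAt ℝ (fun x' => F x' η) x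
  cont : Continuous fun q : B × E => fderiv ℝ (fun x' => F x' q.2) q.1
  lip : ∀ x₀ ρ, ∀ ε > 0, ∀ᶠ x in 𝓝 x₀, ∀ η ∈ Metric.ball (0 : E) ρ, ∀ η' ∈ Metric.ball (0 : E) ρ,
    |(F x η - F x₀ η) - (F x η' - F x₀ η')| ≤ ε * ‖η - η'‖

/-- In the tube f tends to −∞ with |q|, at a rate that depends only on the constants. So one box
serves for all nearby parameters. -/
theorem exists_tube_radius (ℓ : E ≃L[ℝ] P × EuclideanSpace ℝ (Fin k)) (L C a : ℝ) :
    ∃ r, ∀ f, IsTame ℓ L C f → ∀ η, ‖(ℓ η).1‖ ≤ L → -a < f η → η ∈ box ℓ L r := by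
  refine ⟨L + 1 + 2 * L ^ 2 + |C| + |a|, fun f hf η hη ha => ⟨hη, ?_⟩⟩
  have h1 := hf.apply_le_of_tube hη
  have hL := hf.one_le
  by_contra! hlt
  have h2 := abs_nonneg C
  have h3 := abs_nonneg a
  have h4 := le_abs_self C
  have h5 := le_abs_self a
  nlinarith [sq_nonneg L]

namespace IsTameFamily

variable {ℓ : E ≃L[ℝ] P × EuclideanSpace ℝ (Fin k)} {F : B → E → ℝ} (hF : IsTameFamily ℓ F)
include hF

theorem exists_abs_sub_le [FiniteDimensional ℝ B] (x₀ : B) {K : Set E} (hK : IsCompact K) :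
    ∃ M > 0, ∀ x ∈ Metric.ball x₀ 1, ∀ x' ∈ Metric.ball x₀ 1, ∀ η ∈ K,
      |F x' η - F x η| ≤ M * ‖x' - x‖ := by
  have : ProperSpace B := FiniteDimensional.proper_real B
  obtain ⟨M, hM⟩ := ((isCompact_closedBall x₀ 1).prod hK).exists_bound_of_continuousOn
    hF.cont.continuousOn
  refine ⟨max M 1, by positivity, fun x hx x' hx' η hη => ?_⟩
  refine (convex_ball x₀ 1).norm_image_sub_le_of_norm_fderiv_le (𝕜 := ℝ)
    (f := fun x' => F x' η) (fun y _ => hF.diff y η) (fun y hy => ?_) hx hx'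
  exact (hM (y, η) ⟨Metric.ball_subset_closedBall hy, hη⟩).trans (le_max_left _ _)

theorem eventually_abs_sub_le [FiniteDimensional ℝ B] (x₀ : B) {K : Set E} (hK : IsCompact K)
    {ε : ℝ} (hε : 0 < ε) : ∀ᶠ x in 𝓝 x₀, ∀ η ∈ K, |F x η - F x₀ η| ≤ ε := by
  obtain ⟨M, hM, h⟩ := hF.exists_abs_sub_le x₀ hK
  filter_upwards [Metric.ball_mem_nhds x₀ one_pos, Metric.ball_mem_nhds x₀ (div_pos hε hM)]
    with x hx hx' η hη
  refine (h x₀ (Metric.mem_ball_self one_pos) x hx η hη).trans ?_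
  rw [Metric.mem_ball, dist_eq_norm, lt_div_iff₀ hM] at hx'
  linarith

/-- A mean value estimate uniform on compact sets. The base point varies too, since Clarke's
derivative at x₀ involves derivatives at nearby points. -/
theorem eventually_apply_add_smul_le (x₀ e : B) {K : Set E} (hK : IsCompact K) {κ : ℝ}
    (hκ : 0 < κ) : ∀ᶠ q : B × ℝ in 𝓝 x₀ ×ˢ 𝓝[>] 0, ∀ η ∈ K,
      F (q.1 + q.2 • e) η ≤ F q.1 η + q.2 * (fderiv ℝ (fun x' => F x' η) x₀ e + κ) := by
  have h1 : ∀ᶠ x in 𝓝 x₀, ∀ η ∈ K,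
      fderiv ℝ (fun x' => F x' η) x e < fderiv ℝ (fun x' => F x' η) x₀ e + κ := by
    refine hK.eventually_forall_of_forall_eventually fun η _ => ?_
    have hc : Continuous fun q : B × E => fderiv ℝ (fun x' => F x' q.2) q.1 e :=
      hF.cont.clm_apply continuous_const
    have hc' : Continuous fun q : B × E => fderiv ℝ (fun x' => F x' q.2) x₀ e + κ :=
      (hc.comp (continuous_const.prodMk continuous_snd)).add continuous_const
    exact (hc.tendsto (x₀, η)).eventually_lt (hc'.tendsto (x₀, η)) (by simpa using hκ)
  obtain ⟨δ, hδ, h2⟩ := Metric.eventually_nhds_iff_ball.1 h1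
  have h3 : Tendsto (fun q : B × ℝ => q.1 + q.2 • e) (𝓝 x₀ ×ˢ 𝓝[>] 0) (𝓝 x₀) := by
    have : Tendsto (fun q : B × ℝ => q.1 + q.2 • e) (𝓝 (x₀, 0)) (𝓝 (x₀ + (0 : ℝ) • e)) :=
      Continuous.tendsto (by fun_prop) _
    rw [zero_smul, add_zero, nhds_prod_eq] at this
    exact this.mono_left (prod_mono le_rfl nhdsWithin_le_nhds)
  have h4 : ∀ᶠ q : B × ℝ in 𝓝 x₀ ×ˢ 𝓝[>] 0, 0 < q.2 :=
    tendsto_snd.eventually self_mem_nhdsWithin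
  filter_upwards [tendsto_fst.eventually (Metric.ball_mem_nhds x₀ hδ),
    h3.eventually (Metric.ball_mem_nhds x₀ hδ), h4] with ⟨x, s⟩ hx hxs hs η hη
  have hd : ∀ τ, HasDerivAt (fun τ : ℝ => F (x + τ • e) η)
      (fderiv ℝ (fun x' => F x' η) (x + τ • e) e) τ := fun τ => by
    have h5 : HasDerivAt (fun τ : ℝ => x + τ • e) e τ := by
      simpa using ((hasDerivAt_id τ).smul_const e).const_add x
    exact (hF.diff (x + τ • e) η).hasFDerivAt.comp_hasDerivAt τ h5
  obtain ⟨τ, hτ, h6⟩ := exists_hasDerivAt_eq_slope _ _ hs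
    (fun τ _ => (hd τ).continuousAt.continuousWithinAt) (fun τ _ => hd τ)
  have h7 : x + τ • e ∈ Metric.ball x₀ δ := by
    have := (convex_ball x₀ δ).add_smul_sub_mem hx hxs (t := τ / s)
      ⟨div_nonneg hτ.1.le hs.le, (div_le_one hs).2 hτ.2.le⟩
    simpa [smul_smul, div_mul_cancel₀ τ hs.ne'] using this
  have h8 := h2 _ h7 η hη
  rw [h6, sub_zero, zero_smul, add_zero, div_lt_iff₀ hs] at h8
  simp only
  linarith

variable [FiniteDimensional ℝ B] [FiniteDimensional ℝ E]

/-- An almost optimal tube cycle for x is a competitor for x': in the box the two functions differ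
by at most M‖x' − x‖, and outside it the second one is too low to matter. -/
theorem locallyLipschitz_minmaxFun : LocallyLipschitz (minmaxFun F k) := by
  intro x₀
  obtain ⟨L, C, hLC⟩ := hF.tame x₀
  obtain ⟨δ, hδ, htame⟩ := Metric.eventually_nhds_iff_ball.1 hLC
  set a := tameLevel L C
  obtain ⟨r, hr⟩ := exists_tube_radius ℓ L C (a + 1)
  obtain ⟨M, hM, hMle⟩ := hF.exists_abs_sub_le x₀ (isCompact_box ℓ L r)
  have hM' : 0 < (2 * M)⁻¹ := by positivity
  -- This keeps M‖x' − x‖ ≤ 1, the gap between the level −(a + 2) imposed on the boundary for x and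
  -- −(a + 1) required for x'.
  set ρ := min (min δ 1) (2 * M)⁻¹ with hρ
  have hρ0 : 0 < ρ := lt_min (lt_min hδ one_pos) hM'
  have key : ∀ x ∈ Metric.ball x₀ ρ, ∀ x' ∈ Metric.ball x₀ ρ,
      minmaxFun F k x' ≤ minmaxFun F k x + M * ‖x' - x‖ := by
    intro x hx x' hx'
    have hsub : Metric.ball x₀ ρ ⊆ Metric.ball x₀ (min δ 1) :=
      Metric.ball_subset_ball (min_le_left _ _)
    have hsub1 := hsub.trans (Metric.ball_subset_ball (min_le_left _ _))
    have hsub2 := hsub.trans (Metric.ball_subset_ball (min_le_right _ _))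
    have hfx := htame x (hsub1 hx)
    have hfx' := htame x' (hsub1 hx')
    have hdist : M * ‖x' - x‖ ≤ 1 := by
      have h1 : dist x' x < 2 * (2 * M)⁻¹ := by
        have h2 := (Metric.mem_ball.1 hx).trans_le (min_le_right _ _)
        have h3 := (Metric.mem_ball.1 hx').trans_le (min_le_right _ _)
        linarith [dist_triangle_right x' x x₀]
      rw [dist_eq_norm] at h1
      have h4 := mul_lt_mul_of_pos_left h1 hM
      have h5 : M * (2 * (2 * M)⁻¹) = 1 := by field_simp
      linarith
    refine le_of_forall_pos_le_add fun ε hε => ?_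
    have hlow := hfx.neg_tameLevel_le_minmaxValue
    obtain ⟨σ, h1, h2, h3⟩ := hfx.exists_tube (a := a + 2) (by linarith)
      (hfx.exists_hasLinked_lt (a := a + 2) (by linarith)
        (show minmaxValue (F x) k < minmaxValue (F x) k + ε by linarith))
    have hcase : ∀ η, ‖(ℓ η).1‖ ≤ L → F x' η ≤ -(a + 1) ∨ F x' η ≤ F x η + M * ‖x' - x‖ := by
      intro η hη
      rcases le_or_gt (F x' η) (-(a + 1)) with h | h
      · exact Or.inl h
      · refine Or.inr ?_
        have := (abs_le.1 (hMle x (hsub2 hx) x' (hsub2 hx') η (hr _ hfx' η hη h))).2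
        linarith
    refine hfx'.minmaxValue_le (a := a + 1) (by linarith) ⟨σ, h1, ?_, ?_⟩
    · refine boundaryIn_mono ?_ h2
      rintro η ⟨hη, hη'⟩
      have hη : F x η ≤ -(a + 2) := hη
      change F x' η ≤ -(a + 1)
      rcases hcase η hη' with h | h <;> linarith
    · intro η hη
      have h4 : F x η ≤ minmaxValue (F x) k + ε := (h3 hη).1
      change F x' η ≤ minmaxValue (F x) k + M * ‖x' - x‖ + ε
      rcases hcase η (h3 hη).2 with h | h
      · have := mul_nonneg hM.le (norm_nonneg (x' - x))
        linarith
      · linarith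
  refine ⟨M.toNNReal, Metric.ball x₀ ρ, Metric.ball_mem_nhds x₀ hρ0,
    LipschitzOnWith.of_dist_le_mul fun x hx x' hx' => ?_⟩
  rw [Real.coe_toNNReal _ hM.le, Real.dist_eq, dist_eq_norm, abs_le]
  have h1 := key x hx x' hx'
  have h2 := key x' hx' x hx
  rw [norm_sub_rev] at h1
  constructor <;> linarith

/-- An almost optimal cycle for x is deformed by a descent map built for x₀; on the result, each
point is either well below the minmax level or has x-derivative along `e` less than `u`. -/
theorem eventually_minmaxFun_le {x₀ e : B} {u u' : ℝ} (hu : u < u')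
    (h0 : ∀ η ∈ critSet F k x₀, fderiv ℝ (fun x' => F x' η) x₀ e < u) :
    ∀ᶠ q : B × ℝ in 𝓝 x₀ ×ˢ 𝓝[>] 0,
      minmaxFun F k (q.1 + q.2 • e) ≤ minmaxFun F k q.1 + q.2 * u' := by
  obtain ⟨L, C, hLC⟩ := hF.tame x₀
  have hf := hLC.self_of_nhds
  set a := tameLevel L C
  set c := minmaxFun F k x₀ with hc
  have hca : -a ≤ c := hf.neg_tameLevel_le_minmaxValue
  set D : E → ℝ := fun η => fderiv ℝ (fun x' => F x' η) x₀ e with hD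
  have hDc : Continuous D :=
    (hF.cont.comp (continuous_const.prodMk continuous_id)).clm_apply continuous_const
  have hfc := hf.continuous
  obtain ⟨r, hr⟩ := exists_tube_radius ℓ L C (a + 1)
  have hK := isCompact_box ℓ L r
  set K := box ℓ L r
  obtain ⟨ρ, hρ⟩ := hK.isBounded.subset_ball 0
  -- The set to be moved consists of points of the box at the critical level with derivative at
  -- least `u`; by `h0` none of them is critical.
  obtain ⟨ε, hε, g, hg, hgne⟩ := exists_isDescent hf.locallyLipschitz
    (O := {η | -(a + 1) < F x₀ η} ∩ Metric.ball 0 ρ)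
    ((isOpen_lt continuous_const hfc).inter Metric.isOpen_ball)
    (K := K ∩ {η | F x₀ η = c ∧ u ≤ D η})
    (hK.inter_right ((isClosed_eq hfc continuous_const).inter (isClosed_le continuous_const hDc)))
    (fun η hη => ⟨by
      change -(a + 1) < F x₀ η
      linarith [hη.2.1], hρ hη.1⟩)
    (fun η hη hcrit => (h0 η ⟨hcrit, hη.2.1⟩).not_ge hη.2.2)
  have hgfix : ∀ η, F x₀ η ≤ -(a + 1) → g η = η := fun η hη =>
    hg.id_off η fun h => (lt_of_lt_of_le h.1 hη).false
  have hgle : ∀ η, F x₀ (g η) ≤ F x₀ η := fun η =>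
    (hg.le η).trans (sub_le_self _ (mul_nonneg hε.le (norm_nonneg _)))
  -- If the derivative at `g η` is at least `u`, then η starts above `c` or `g η` ends below `c`, by
  -- a uniform amount: otherwise F x₀ η ≤ c ≤ F x₀ (g η) ≤ F x₀ η forces g η = η, a point that `g`
  -- must move.
  obtain ⟨ε₂, hε₂, hmax⟩ := (hK.inter_right
      (isClosed_le continuous_const (hDc.comp g.continuous))).exists_forall_le'
    (f := fun η => max (F x₀ η - c) (c - F x₀ (g η))) (a := 0)
    (((hfc.sub continuous_const).max (continuous_const.sub (hfc.comp g.continuous))).continuousOn)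
    (fun η hη => by
      by_contra! hle
      have h1 := (le_max_left _ _).trans hle
      have h2 := (le_max_right _ _).trans hle
      have h3 := hgle η
      have h4 : g η = η := by
        by_contra hne
        linarith [hg.lt_of_ne hε hne]
      refine hgne η ⟨hη.1, by linarith, ?_⟩ h4
      have h5 : u ≤ D (g η) := hη.2
      rwa [h4] at h5)
  have hK' : IsCompact (K ∪ g '' K) := hK.union (hK.image g.continuous)
  have hadd : Tendsto (fun q : B × ℝ => q.1 + q.2 • e) (𝓝 x₀ ×ˢ 𝓝[>] 0) (𝓝 x₀) := by
    have : Tendsto (fun q : B × ℝ => q.1 + q.2 • e) (𝓝 (x₀, 0)) (𝓝 (x₀ + (0 : ℝ) • e)) :=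
      Continuous.tendsto (by fun_prop) _
    rw [zero_smul, add_zero, nhds_prod_eq] at this
    exact this.mono_left (prod_mono le_rfl nhdsWithin_le_nhds)
  have hfst : Tendsto (fun q : B × ℝ => q.1) (𝓝 x₀ ×ˢ 𝓝[>] (0 : ℝ)) (𝓝 x₀) := tendsto_fst
  have hsnd : Tendsto (fun q : B × ℝ => q.2) (𝓝 x₀ ×ˢ 𝓝[>] (0 : ℝ)) (𝓝[>] 0) := tendsto_snd
  have hsnd' := hsnd.mono_right nhdsWithin_le_nhds
  -- The quarter leaves room for the changes of parameter, the variation of the minmax and the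
  -- excess of the cycle; the half lets two changes of parameter fit between −(a + 2) and −(a + 1).
  set ε₃ := min (ε₂ / 4) (1 / 2) with hε₃
  have hε₃0 : 0 < ε₃ := lt_min (by linarith) one_half_pos
  have hR : ∀ᶠ x in 𝓝 x₀, |minmaxFun F k x - c| < ε₃ :=
    Metric.tendsto_nhds.1 (hF.locallyLipschitz_minmaxFun.continuous.tendsto x₀) ε₃ hε₃0
  have hs1 : ∀ᶠ q : B × ℝ in 𝓝 x₀ ×ˢ 𝓝[>] 0, -ε₃ < q.2 * u' :=
    (hsnd'.mul_const u').eventually (lt_mem_nhds (by linarith))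
  have hs2 : ∀ᶠ q : B × ℝ in 𝓝 x₀ ×ˢ 𝓝[>] 0, q.2 * ((u' - u) / 2) < ε₃ :=
    (hsnd'.mul_const ((u' - u) / 2)).eventually (gt_mem_nhds (by linarith))
  have hclose := hF.eventually_abs_sub_le x₀ hK' hε₃0
  filter_upwards [hfst.eventually hLC, hadd.eventually hLC,
    hfst.eventually (hF.lip x₀ ρ ε hε), hfst.eventually hclose, hadd.eventually hclose,
    hF.eventually_apply_add_smul_le x₀ e hK' (κ := (u' - u) / 2) (by linarith),
    hfst.eventually hR, hs1, hs2, hsnd.eventually self_mem_nhdsWithin]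
    with ⟨x, s⟩ hfx hfx' hlip hclo hclo' hinc hRx hsu hsu' hs
  simp only at hfx hfx' hlip hclo hclo' hinc hRx hsu hsu' ⊢
  have hs : 0 < s := hs
  have hlow : -a ≤ minmaxFun F k x := hfx.neg_tameLevel_le_minmaxValue
  have hε₃1 : ε₃ ≤ 1 / 2 := min_le_right _ _
  have hε₃2 : ε₃ ≤ ε₂ / 4 := min_le_left _ _
  rw [abs_lt] at hRx
  -- The ε-Lipschitz bound on F x − F x₀ is absorbed by the rate of descent ε of `g`.
  have hgx : ∀ η, F x (g η) ≤ F x η := hg.apply_le_of_lipschitz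
    fun η hη η' hη' => hlip η hη.2 η' hη'.2
  obtain ⟨σ, h1, h2, h3⟩ := hfx.exists_tube (a := a + 2) (by linarith)
    (hfx.exists_hasLinked_lt (a := a + 2) (by linarith)
      (show minmaxValue (F x) k < minmaxFun F k x + s * ((u' - u) / 2) by
        have := mul_pos hs (show 0 < (u' - u) / 2 by linarith)
        change minmaxFun F k x < _
        linarith))
  have hbd : ∀ η, F x η ≤ -(a + 2) → ‖(ℓ η).1‖ ≤ L → g η = η := by
    intro η hη hη'
    refine hgfix η ?_
    by_contra! hlt
    have := (abs_le.1 (hclo η (Or.inl (hr _ hf η hη' hlt)))).1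
    linarith
  refine hfx'.minmaxValue_le (a := a + 1) (by linarith)
    ⟨SingChain.push g k σ, h1.push g h2 fun η hη t _ => ?_, boundaryIn_push g (fun η hη => ?_) h2,
      (chainImage_push_subset _ _).trans ?_⟩
  · have hη1 : F x η ≤ -(a + 2) := hη.1
    rw [hbd η hη.1 hη.2, ← add_smul, sub_add_cancel, one_smul]
    exact hfx.snd_ne_zero (a := a + 2) (by linarith) hη1
  · have hη1 : F x η ≤ -(a + 2) := hη.1
    rw [hbd η hη.1 hη.2]
    change F (x + s • e) η ≤ -(a + 1)
    by_contra! hlt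
    have hηK := hr _ hfx' η hη.2 hlt
    have h4 := (abs_le.1 (hclo η (Or.inl hηK))).1
    have h5 := (abs_le.1 (hclo' η (Or.inl hηK))).2
    linarith
  · rintro _ ⟨η, hη, rfl⟩
    have h4 : F x η ≤ minmaxFun F k x + s * ((u' - u) / 2) := (h3 hη).1
    change F (x + s • e) (g η) ≤ minmaxFun F k x + s * u'
    rcases le_or_gt (F (x + s • e) (g η)) (-(a + 1)) with h5 | h5
    · linarith
    by_cases hηK : η ∈ K
    · have hgη : g η ∈ K ∪ g '' K := Or.inr ⟨η, hηK, rfl⟩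
      have h6 := (abs_le.1 (hclo η (Or.inl hηK))).1
      by_cases hDη : u ≤ D (g η)
      · have h7 := hmax η ⟨hηK, hDη⟩
        -- The cycle lies below c + ε₂, which excludes the first alternative of `hmax`.
        have h8 : ε₂ ≤ c - F x₀ (g η) := by
          rcases le_max_iff.1 h7 with h8 | h8
          · linarith
          · exact h8
        have h9 := (abs_le.1 (hclo' _ hgη)).2
        linarith
      -- Two halves of u' − u are spent here, one for the excess of the cycle and one for the first
      -- order expansion.
      · have h7 := hinc _ hgη
        have h8 := hgx η
        have h9 : s * (D (g η) + (u' - u) / 2) ≤ s * (u + (u' - u) / 2) :=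
          mul_le_mul_of_nonneg_left (by linarith [not_le.1 hDη]) hs.le
        have h10 : D (g η) = fderiv ℝ (fun x' => F x' (g η)) x₀ e := rfl
        rw [← h10] at h7
        nlinarith
    · have h6 : F x₀ η ≤ -(a + 1) := by
        by_contra! hlt
        exact hηK (hr _ hf η (h3 hη).2 hlt)
      rw [hgfix η h6] at h5
      exact (hηK (hr _ hfx' η (h3 hη).2 h5)).elim

omit [FiniteDimensional ℝ B] in
theorem isCompact_critSet (x : B) : IsCompact (critSet F k x) := by
  obtain ⟨L, C, hLC⟩ := hF.tame x
  have hf := hLC.self_of_nhds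
  refine (isCompact_box ℓ L L).of_isClosed_subset ?_ fun η hη => hf.norm_le_of_zero_mem hη.1
  exact (isClosed_zero_mem_clarkeDeriv hf.locallyLipschitz).inter
    (isClosed_eq hf.continuous continuous_const)

/-- A limit of derivatives outside the compact hull is separated from it by a direction `e`; the
one-sided estimate bounds the nearby derivatives along `e` by `u'` and contradicts the separation.
-/
theorem clarkeDeriv_minmaxFun_subset (x : B) : clarkeDeriv (minmaxFun F k) x ⊆
    convexHull ℝ ((fun η => fderiv ℝ (fun x' => F x' η) x) '' critSet F k x) := by
  refine convexHull_min (fun p hp => ?_) (convex_convexHull ℝ _)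
  by_contra hpn
  have hcomp : IsCompact ((fun η => fderiv ℝ (fun x' => F x' η) x) '' critSet F k x) :=
    (hF.isCompact_critSet x).image (hF.cont.comp (continuous_const.prodMk continuous_id))
  obtain ⟨Φ, u, hu, hup⟩ := geometric_hahn_banach_closed_point (convex_convexHull ℝ _)
    hcomp.convexHull_of_finiteDimensional.isClosed hpn
  obtain ⟨e, he⟩ := exists_eq_apply_of_finiteDimensional Φ
  rw [he] at hup
  obtain ⟨u', huu', hu'p⟩ := exists_between hup
  -- Currying fixes the base point y near x first and then lets s tend to 0, as a derivative at y
  -- requires.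
  have h1 := (hF.eventually_minmaxFun_le huu' (x₀ := x) (e := e) fun η hη => by
    rw [← he]
    exact hu _ (subset_convexHull ℝ _ ⟨η, hη, rfl⟩)).curry
  have h2 := limDeriv_apply_le (f := minmaxFun F k) (a := x) (w := fun _ => e) (g := fun _ => u')
    continuousAt_const continuousAt_const
    (h1.mono fun y hy hd => fderiv_apply_le_of_eventually hd hy) hp
  exact absurd h2 (not_le.2 hu'p)

omit [FiniteDimensional ℝ B] [FiniteDimensional ℝ E] in
theorem eventually_isGLB_cycleMaxima (x : B) :
    ∀ᶠ a in atTop, IsGLB (cycleMaxima (F x) k a) (minmaxFun F k x) := by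
  obtain ⟨L, C, hLC⟩ := hF.tame x
  filter_upwards [eventually_gt_atTop (tameLevel L C)] with a ha
  exact hLC.self_of_nhds.isGLB_cycleMaxima ha

end IsTameFamily

end TameFamily

end

/-! ### Hamiltonian flows and regularity of their generating functions -/

noncomputable section

/-! ### The cotangent space -/

namespace Cot

variable {d : ℕ}

@[simp] theorem pos_cotMk (x y : Base d) : pos (cotMk x y) = x := rfl

@[simp] theorem mom_cotMk (x y : Base d) : mom (cotMk x y) = y := rfl

theorem cotMk_pos_mom (z : Cot d) : cotMk z.pos z.mom = z := by
  ext i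
  rcases i with i | i <;> rfl

theorem pos_sub (z w : Cot d) : (z - w).pos = z.pos - w.pos := rfl

theorem mom_sub (z w : Cot d) : (z - w).mom = z.mom - w.mom := rfl

theorem norm_sq_eq (z : Cot d) : ‖z‖ ^ 2 = ‖z.pos‖ ^ 2 + ‖z.mom‖ ^ 2 := by
  rw [EuclideanSpace.norm_sq_eq, EuclideanSpace.norm_sq_eq, EuclideanSpace.norm_sq_eq,
    Fintype.sum_sum_type]
  rfl

theorem norm_pos_le (z : Cot d) : ‖z.pos‖ ≤ ‖z‖ := by
  have := norm_sq_eq z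
  nlinarith [norm_nonneg z, norm_nonneg z.pos, sq_nonneg ‖z.mom‖]

theorem norm_mom_le (z : Cot d) : ‖z.mom‖ ≤ ‖z‖ := by
  have := norm_sq_eq z
  nlinarith [norm_nonneg z, norm_nonneg z.mom, sq_nonneg ‖z.pos‖]

theorem norm_le_add (z : Cot d) : ‖z‖ ≤ ‖z.pos‖ + ‖z.mom‖ := by
  have := norm_sq_eq z
  nlinarith [norm_nonneg z, norm_nonneg z.mom, norm_nonneg z.pos,
    mul_nonneg (norm_nonneg z.pos) (norm_nonneg z.mom)]

/-- The projection `(x, y) ↦ x`. -/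
def posL (d : ℕ) : Cot d →L[ℝ] Base d :=
  LinearMap.mkContinuous ⟨⟨pos, fun _ _ => rfl⟩, fun _ _ => rfl⟩ 1 fun z => by
    rw [one_mul]
    exact norm_pos_le z

/-- The projection `(x, y) ↦ y`. -/
def momL (d : ℕ) : Cot d →L[ℝ] Base d :=
  LinearMap.mkContinuous ⟨⟨mom, fun _ _ => rfl⟩, fun _ _ => rfl⟩ 1 fun z => by
    rw [one_mul]
    exact norm_mom_le z

@[simp] theorem posL_apply (z : Cot d) : posL d z = z.pos := rfl

@[simp] theorem momL_apply (z : Cot d) : momL d z = z.mom := rfl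

/-- The inclusion `x ↦ (x, 0)`. -/
def inPos (d : ℕ) : Base d →L[ℝ] Cot d :=
  LinearMap.mkContinuous ⟨⟨fun x => cotMk x 0, fun x y => by
    ext i; rcases i with i | i <;> simp [cotMk]⟩, fun c x => by
    ext i; rcases i with i | i <;> simp [cotMk]⟩ 1 fun x => by
    rw [one_mul]
    simpa using norm_le_add (cotMk x 0)

/-- The inclusion `y ↦ (0, y)`. -/
def inMom (d : ℕ) : Base d →L[ℝ] Cot d :=
  LinearMap.mkContinuous ⟨⟨fun x => cotMk 0 x, fun x y => by
    ext i; rcases i with i | i <;> simp [cotMk]⟩, fun c x => by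
    ext i; rcases i with i | i <;> simp [cotMk]⟩ 1 fun x => by
    rw [one_mul]
    simpa using norm_le_add (cotMk 0 x)

theorem cotMk_eq (x y : Base d) : cotMk x y = inPos d x + inMom d y := by
  ext i
  rcases i with i | i
  · change x i = x i + (0 : Base d) i
    simp
  · change y i = (0 : Base d) i + y i
    simp

theorem continuous_pos : Continuous (pos : Cot d → Base d) := (posL d).continuous

theorem continuous_mom : Continuous (mom : Cot d → Base d) := (momL d).continuous

end Cot

/-! ### The Hamiltonian vector field -/

section HamField

variable {d : ℕ} {H : ℝ → Cot d → ℝ}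

/-- The vector field is the symplectic gradient. -/
theorem inner_hamField {t : ℝ} {z : Cot d} (h : DifferentiableAt ℝ (H t) z) (w : Cot d) :
    inner ℝ (hamField H t z).pos w.mom - inner ℝ (hamField H t z).mom w.pos
      = fderiv ℝ (H t) z w := by
  have hy : HasFDerivAt (fun y => H t (cotMk z.pos y)) (fderiv ℝ (H t) z ∘L Cot.inMom d) z.mom := by
    have h1 : HasFDerivAt (fun y => cotMk z.pos y) (Cot.inMom d) z.mom := by
      simp_rw [Cot.cotMk_eq z.pos]
      exact (Cot.inMom d).hasFDerivAt.const_add _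
    refine HasFDerivAt.comp z.mom (g := H t) ?_ h1
    rw [Cot.cotMk_pos_mom]
    exact h.hasFDerivAt
  have hx : HasFDerivAt (fun x => H t (cotMk x z.mom)) (fderiv ℝ (H t) z ∘L Cot.inPos d) z.pos := by
    have h1 : HasFDerivAt (fun x => cotMk x z.mom) (Cot.inPos d) z.pos := by
      simp_rw [Cot.cotMk_eq _ z.mom]
      exact (Cot.inPos d).hasFDerivAt.add_const _
    refine HasFDerivAt.comp z.pos (g := H t) ?_ h1
    rw [Cot.cotMk_pos_mom]
    exact h.hasFDerivAt
  have hy' := hy.hasGradientAt.gradient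
  have hx' := hx.hasGradientAt.gradient
  simp only [hamField, Cot.pos_cotMk, Cot.mom_cotMk, hx', hy', inner_neg_left, sub_neg_eq_add,
    InnerProductSpace.toDual_symm_apply, ContinuousLinearMap.comp_apply]
  rw [← map_add, add_comm, ← Cot.cotMk_eq, Cot.cotMk_pos_mom]

/-- Testing against V rotated by the symplectic structure, a vector of the same norm, gives |V|². No
constant is lost, so the field inherits exactly the Lipschitz constant c_H. -/
theorem norm_le_of_inner_eq {V : Cot d} {φ : Cot d →L[ℝ] ℝ}
    (h : ∀ w : Cot d, inner ℝ V.pos w.mom - inner ℝ V.mom w.pos = φ w) : ‖V‖ ≤ ‖φ‖ := by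
  set w : Cot d := cotMk (-V.mom) V.pos with hw
  have h1 := h w
  have h2 : ‖w‖ = ‖V‖ := by
    rw [← sq_eq_sq₀ (norm_nonneg _) (norm_nonneg _), Cot.norm_sq_eq, Cot.norm_sq_eq V, hw,
      Cot.pos_cotMk, Cot.mom_cotMk, norm_neg, add_comm]
  rw [hw, Cot.pos_cotMk, Cot.mom_cotMk, inner_neg_right, real_inner_self_eq_norm_sq,
    real_inner_self_eq_norm_sq, sub_neg_eq_add, ← Cot.norm_sq_eq, ← hw] at h1
  have h3 := (le_abs_self _).trans (φ.le_opNorm w)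
  rw [← h1, h2] at h3
  by_contra! hlt
  nlinarith [norm_nonneg φ]

theorem norm_hamField_sub_le {t t' : ℝ} {z z' : Cot d} (h : DifferentiableAt ℝ (H t) z)
    (h' : DifferentiableAt ℝ (H t') z') :
    ‖hamField H t z - hamField H t' z'‖ ≤ ‖fderiv ℝ (H t) z - fderiv ℝ (H t') z'‖ := by
  refine norm_le_of_inner_eq fun w => ?_
  rw [sub_apply, ← inner_hamField h, ← inner_hamField h', Cot.pos_sub, Cot.mom_sub,
    inner_sub_left, inner_sub_left]
  ring

theorem norm_hamField_le {t : ℝ} {z : Cot d} (h : DifferentiableAt ℝ (H t) z) :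
    ‖hamField H t z‖ ≤ ‖fderiv ℝ (H t) z‖ :=
  norm_le_of_inner_eq (inner_hamField h)

/-- The properties of the Hamiltonian used in the study of its flow. -/
structure IsHamiltonian (H : ℝ → Cot d → ℝ) (T c M : ℝ) : Prop where
  nonneg : 0 ≤ c
  diff : ∀ τ ∈ Icc 0 T, Differentiable ℝ (H τ)
  cont : ContinuousOn (fun q : ℝ × Cot d => H q.1 q.2) (Icc 0 T ×ˢ univ)
  cont_fderiv : ContinuousOn (fun q : ℝ × Cot d => fderiv ℝ (H q.1) q.2) (Icc 0 T ×ˢ univ)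
  lip : ∀ τ ∈ Icc 0 T, ∀ z z', ‖fderiv ℝ (H τ) z - fderiv ℝ (H τ) z'‖ ≤ c * ‖z - z'‖
  bound : ∀ τ ∈ Icc 0 T, ∀ z, ‖fderiv ℝ (H τ) z‖ ≤ M

/-- Regularity in time is only within `S`, but the second variable is unrestricted: its derivative
is the restriction of the within-derivative to that factor. -/
theorem contDiffOn_fderiv_snd {V W : Type*} [NormedAddCommGroup V] [NormedSpace ℝ V]
    [NormedAddCommGroup W] [NormedSpace ℝ W] {G : ℝ → V → W} {S : Set ℝ} (hS : UniqueDiffOn ℝ S)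
    {n m : WithTop ℕ∞} (hmn : m + 1 ≤ n)
    (hG : ContDiffOn ℝ n (fun q : ℝ × V => G q.1 q.2) (S ×ˢ univ)) :
    (∀ τ ∈ S, Differentiable ℝ (G τ)) ∧
      ContDiffOn ℝ m (fun q : ℝ × V => fderiv ℝ (G q.1) q.2) (S ×ˢ univ) := by
  have hd : ∀ τ ∈ S, ∀ z, HasFDerivAt (G τ)
      (fderivWithin ℝ (fun q : ℝ × V => G q.1 q.2) (S ×ˢ univ) (τ, z) ∘L
        ContinuousLinearMap.inr ℝ ℝ V) z := fun τ hτ z => by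
    have h1 : HasFDerivWithinAt (fun q : ℝ × V => G q.1 q.2)
        (fderivWithin ℝ (fun q : ℝ × V => G q.1 q.2) (S ×ˢ univ) (τ, z)) (S ×ˢ univ) (τ, z) :=
      ((hG.differentiableOn (ne_of_gt (lt_of_lt_of_le (by simp) (le_trans le_add_self hmn)))) (τ, z)
        ⟨hτ, mem_univ _⟩).hasFDerivWithinAt
    have h2 : HasFDerivAt (fun z : V => (τ, z)) (ContinuousLinearMap.inr ℝ ℝ V) z :=
      hasFDerivAt_prodMk_right τ z
    exact h1.comp_hasFDerivAt z h2 (Eventually.of_forall fun z' => ⟨hτ, mem_univ _⟩)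
  refine ⟨fun τ hτ z => (hd τ hτ z).differentiableAt, ?_⟩
  have h1 := (hG.fderivWithin (hS.prod uniqueDiffOn_univ) hmn).clm_comp
    (contDiffOn_const (c := ContinuousLinearMap.inr ℝ ℝ V))
  exact h1.congr fun q hq => (hd q.1 hq.1 q.2).fderiv

theorem fderiv_eq_zero_of_eq_zero_off {V W : Type*} [NormedAddCommGroup V] [NormedSpace ℝ V]
    [NormedAddCommGroup W] [NormedSpace ℝ W] {f : V → W} {K : Set V} (hK : IsClosed K)
    (h : ∀ z ∉ K, f z = 0) : ∀ z ∉ K, fderiv ℝ f z = 0 := fun z hz => by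
  have : f =ᶠ[𝓝 z] fun _ => 0 := by
    filter_upwards [hK.isOpen_compl.mem_nhds hz] with w hw using h w hw
  rw [this.fderiv_eq, fderiv_fun_const, Pi.zero_apply]

theorem exists_bound_of_eq_zero_off {V W : Type*} [NormedAddCommGroup V] [NormedAddCommGroup W]
    {G : ℝ → V → W} {T : ℝ} {K : Set V} (hK : IsCompact K)
    (hG : ContinuousOn (fun q : ℝ × V => G q.1 q.2) (Icc 0 T ×ˢ univ))
    (h : ∀ τ ∈ Icc 0 T, ∀ z ∉ K, G τ z = 0) : ∃ M, ∀ τ ∈ Icc 0 T, ∀ z, ‖G τ z‖ ≤ M := by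
  obtain ⟨M, hM⟩ := (isCompact_Icc.prod hK).exists_bound_of_continuousOn
    (hG.mono (prod_mono Subset.rfl (subset_univ _)))
  refine ⟨max M 0, fun τ hτ z => ?_⟩
  by_cases hz : z ∈ K
  · exact (hM (τ, z) ⟨hτ, hz⟩).trans (le_max_left _ _)
  · rw [h τ hτ z hz, norm_zero]
    exact le_max_right _ _

theorem exists_isHamiltonian {T : ℝ} (hT : 0 < T)
    (hH : ContDiffOn ℝ 2 (fun q : ℝ × Cot d => H q.1 q.2) (Icc 0 T ×ˢ univ))
    (hHc : ∃ K : Set (Cot d), IsCompact K ∧ ∀ τ ∈ Icc 0 T, ∀ z ∉ K, H τ z = 0) :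
    ∃ M, IsHamiltonian H T (hessSup H T) M := by
  obtain ⟨K, hK, hK0⟩ := hHc
  obtain ⟨h1, h2⟩ := contDiffOn_fderiv_snd (uniqueDiffOn_Icc hT) (n := 2) (m := 1)
    (by norm_num) hH
  obtain ⟨h3, h4⟩ := contDiffOn_fderiv_snd (G := fun τ => fderiv ℝ (H τ)) (uniqueDiffOn_Icc hT)
    (n := 1) (m := 0) (by norm_num) h2
  have hz1 : ∀ τ ∈ Icc 0 T, ∀ z ∉ K, fderiv ℝ (H τ) z = 0 := fun τ hτ =>
    fderiv_eq_zero_of_eq_zero_off hK.isClosed (hK0 τ hτ)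
  have hz2 : ∀ τ ∈ Icc 0 T, ∀ z ∉ K, fderiv ℝ (fderiv ℝ (H τ)) z = 0 := fun τ hτ =>
    fderiv_eq_zero_of_eq_zero_off hK.isClosed (hz1 τ hτ)
  obtain ⟨M, hM⟩ := exists_bound_of_eq_zero_off (G := fun τ => fderiv ℝ (H τ)) hK
    h2.continuousOn hz1
  obtain ⟨M', hM'⟩ := exists_bound_of_eq_zero_off (G := fun τ => fderiv ℝ (fderiv ℝ (H τ))) hK
    h4.continuousOn hz2
  -- A real supremum over an unbounded family defaults to 0, so boundedness, from compact support,
  -- is needed before `hessSup` bounds the Hessian.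
  have hbdd : BddAbove (range fun q : Icc (0 : ℝ) T × Cot d =>
      ‖fderiv ℝ (fderiv ℝ (H q.1)) q.2‖) := by
    refine ⟨M', ?_⟩
    rintro _ ⟨q, rfl⟩
    exact hM' q.1 q.1.2 q.2
  refine ⟨M, Real.iSup_nonneg fun q => norm_nonneg (fderiv ℝ (fderiv ℝ (H q.1)) q.2), h1, hH.continuousOn, h2.continuousOn,
    fun τ hτ z z' => ?_, hM⟩
  exact convex_univ.norm_image_sub_le_of_norm_fderiv_le (𝕜 := ℝ) (fun w _ => h3 τ hτ w)
    (fun w _ => le_ciSup hbdd (⟨τ, hτ⟩, w)) (mem_univ _) (mem_univ _)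

namespace IsHamiltonian

variable {T c M : ℝ} (h : IsHamiltonian H T c M)
include h

theorem norm_hamField_le {τ : ℝ} (hτ : τ ∈ Icc 0 T) (z : Cot d) : ‖hamField H τ z‖ ≤ M :=
  (_root_.norm_hamField_le (h.diff τ hτ z)).trans (h.bound τ hτ z)

theorem norm_hamField_sub_le {τ : ℝ} (hτ : τ ∈ Icc 0 T) (z z' : Cot d) :
    ‖hamField H τ z - hamField H τ z'‖ ≤ c * ‖z - z'‖ :=
  (_root_.norm_hamField_sub_le (h.diff τ hτ z) (h.diff τ hτ z')).trans (h.lip τ hτ z z')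

theorem lipschitzWith_hamField {τ : ℝ} (hτ : τ ∈ Icc 0 T) :
    LipschitzWith c.toNNReal (hamField H τ) :=
  LipschitzWith.of_dist_le_mul fun z z' => by
    rw [Real.coe_toNNReal _ h.nonneg, dist_eq_norm, dist_eq_norm]
    exact h.norm_hamField_sub_le hτ z z'

theorem continuousOn_hamField :
    ContinuousOn (fun q : ℝ × Cot d => hamField H q.1 q.2) (Icc 0 T ×ˢ univ) := by
  intro q hq
  have h1 := h.cont_fderiv q hq
  rw [ContinuousWithinAt, tendsto_iff_norm_sub_tendsto_zero] at h1 ⊢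
  refine squeeze_zero' (Eventually.of_forall fun _ => norm_nonneg _) ?_ h1
  filter_upwards [self_mem_nhdsWithin] with q' hq'
  exact _root_.norm_hamField_sub_le (h.diff _ hq'.1 _) (h.diff _ hq.1 _)

/-- The remainder of the first order expansion of the Hamiltonian. -/
theorem abs_sub_sub_fderiv_le {τ : ℝ} (hτ : τ ∈ Icc 0 T) (z z' : Cot d) :
    |H τ z' - H τ z - fderiv ℝ (H τ) z (z' - z)| ≤ c * ‖z' - z‖ ^ 2 := by
  have h1 := (convex_closedBall z ‖z' - z‖).norm_image_sub_le_of_norm_hasFDerivWithin_le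
    (𝕜 := ℝ) (f := fun w => H τ w - fderiv ℝ (H τ) z w) (C := c * ‖z' - z‖)
    (f' := fun w => fderiv ℝ (H τ) w - fderiv ℝ (H τ) z)
    (fun w _ => ((h.diff τ hτ w).hasFDerivAt.sub
      (fderiv ℝ (H τ) z).hasFDerivAt).hasFDerivWithinAt)
    (fun w hw => (h.lip τ hτ w z).trans
      (mul_le_mul_of_nonneg_left (mem_closedBall_iff_norm.1 hw) h.nonneg))
    (Metric.mem_closedBall_self (norm_nonneg _)) (mem_closedBall_iff_norm.2 (le_refl ‖z' - z‖))
  rw [Real.norm_eq_abs] at h1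
  rw [map_sub]
  convert! h1 using 1
  · congr 1
    ring
  · ring

end IsHamiltonian

end HamField

end

noncomputable section

/-! ### The Hamiltonian flow and its generating function -/

section HamFlow

variable {d : ℕ} {H : ℝ → Cot d → ℝ} {T c M : ℝ}

/-- `γ` solves Hamilton's equations on `[0, T]`. -/
def IsTrajectory (H : ℝ → Cot d → ℝ) (T : ℝ) (γ : ℝ → Cot d) : Prop :=
  ∀ τ ∈ Icc (0 : ℝ) T, HasDerivWithinAt γ (hamField H τ (γ τ)) (Icc (0 : ℝ) T) τ

/-- The action integrand along a curve. -/
def actionDensity (H : ℝ → Cot d → ℝ) (y : Base d) (γ : ℝ → Cot d) (τ : ℝ) : ℝ :=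
  inner ℝ ((γ τ).mom - y) (hamField H τ (γ τ)).pos - H τ (γ τ)

namespace IsTrajectory

variable {γ γ' : ℝ → Cot d}

theorem continuousOn (hγ : IsTrajectory H T γ) : ContinuousOn γ (Icc 0 T) :=
  fun τ hτ => (hγ τ hτ).continuousWithinAt

theorem hasDerivWithinAt_Ici (hγ : IsTrajectory H T γ) {τ : ℝ} (hτ : τ ∈ Ico 0 T) :
    HasDerivWithinAt γ (hamField H τ (γ τ)) (Ici τ) τ :=
  (hγ τ (Ico_subset_Icc_self hτ)).mono_of_mem_nhdsWithin (Icc_mem_nhdsGE_of_mem hτ)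

theorem hasDerivAt (hγ : IsTrajectory H T γ) {τ : ℝ} (hτ : τ ∈ Ioo 0 T) :
    HasDerivAt γ (hamField H τ (γ τ)) τ :=
  (hγ τ (Ioo_subset_Icc_self hτ)).hasDerivAt (Icc_mem_nhds hτ.1 hτ.2)

end IsTrajectory

namespace IsHamiltonian

variable (h : IsHamiltonian H T c M) {γ γ' : ℝ → Cot d} {s t : ℝ}
include h

theorem exists_isTrajectory (hs : s ∈ Icc 0 T) (z : Cot d) :
    ∃ γ, γ s = z ∧ IsTrajectory H T γ := by
  have hM : 0 ≤ M := (norm_nonneg _).trans (h.norm_hamField_le hs z)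
  have hT : 0 ≤ T := hs.1.trans hs.2
  -- With speed at most M, a ball of radius MT contains any solution, so it exists on the whole of
  -- [0, T].
  have hPL : IsPicardLindelof (hamField H) (⟨s, hs⟩ : Icc (0 : ℝ) T) z (M * T).toNNReal 0
      M.toNNReal c.toNNReal :=
    { lipschitzOnWith := fun τ hτ => (h.lipschitzWith_hamField hτ).lipschitzOnWith
      continuousOn := fun w _ => h.continuousOn_hamField.comp
        (continuousOn_id.prodMk continuousOn_const) fun τ hτ => ⟨hτ, mem_univ _⟩
      norm_le := fun τ hτ w _ => by
        rw [Real.coe_toNNReal _ hM]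
        exact h.norm_hamField_le hτ w
      mul_max_le := by
        rw [Real.coe_toNNReal _ hM, Real.coe_toNNReal _ (mul_nonneg hM hT), NNReal.coe_zero]
        simp only [sub_zero]
        refine mul_le_mul_of_nonneg_left (max_le ?_ ?_) hM
        · exact sub_le_self _ hs.1
        · exact hs.2 }
  exact hPL.exists_eq_forall_mem_Icc_hasDerivWithinAt₀

theorem norm_sub_le (hγ : IsTrajectory H T γ) (hγ' : IsTrajectory H T γ') (hs : 0 ≤ s)
    (ht : t ∈ Icc s T) : ‖γ' t - γ t‖ ≤ ‖γ' s - γ s‖ * Real.exp (c * (t - s)) := by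
  have hsub : Icc s T ⊆ Icc 0 T := Icc_subset_Icc_left hs
  have hsub' : Ico s T ⊆ Ico 0 T := Ico_subset_Ico_left hs
  have := dist_le_of_trajectories_ODE_of_mem (v := hamField H) (s := fun _ => univ)
    (K := c.toNNReal) (f := γ') (g := γ) (a := s) (b := T) (δ := ‖γ' s - γ s‖)
    (fun τ hτ => (h.lipschitzWith_hamField (hsub (Ico_subset_Icc_self hτ))).lipschitzOnWith)
    (hγ'.continuousOn.mono hsub) (fun τ hτ => hγ'.hasDerivWithinAt_Ici (hsub' hτ))
    (fun _ _ => mem_univ _) (hγ.continuousOn.mono hsub)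
    (fun τ hτ => hγ.hasDerivWithinAt_Ici (hsub' hτ)) (fun _ _ => mem_univ _)
    (dist_eq_norm _ _).le t ht
  rwa [Real.coe_toNNReal _ h.nonneg, dist_eq_norm] at this

/-- `hamFlow` is a choice among values of solutions; Grönwall's inequality makes that value unique.
-/
theorem hamFlow_eq (hγ : IsTrajectory H T γ) (hs : 0 ≤ s) (ht : t ∈ Icc s T) :
    hamFlow H T s t (γ s) = γ t := by
  obtain ⟨γ', h1, h2, h3⟩ := Classical.epsilon_spec (p := fun w => ∃ γ' : ℝ → Cot d,
    γ' s = γ s ∧ γ' t = w ∧ ∀ τ ∈ Icc (0 : ℝ) T,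
      HasDerivWithinAt γ' (hamField H τ (γ' τ)) (Icc (0 : ℝ) T) τ) ⟨γ t, γ, rfl, rfl, hγ⟩
  have h4 := h.norm_sub_le hγ h3 hs ht
  rw [h1, sub_self, norm_zero, zero_mul] at h4
  exact h2.symm.trans (sub_eq_zero.1 (norm_le_zero_iff.1 h4))

/-- Integration of c e^{c(τ−s)}, the Grönwall bound on the relative speed. The factor is below 1
exactly when c(t − s) < ln 2, so the flow minus the identity is then a contraction. -/
theorem norm_sub_sub_le (hγ : IsTrajectory H T γ) (hγ' : IsTrajectory H T γ') (hs : 0 ≤ s)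
    (ht : t ∈ Icc s T) :
    ‖(γ' t - γ t) - (γ' s - γ s)‖ ≤ ‖γ' s - γ s‖ * (Real.exp (c * (t - s)) - 1) := by
  have hsub : Icc s T ⊆ Icc 0 T := Icc_subset_Icc_left hs
  have hsub' : Ico s T ⊆ Ico 0 T := Ico_subset_Ico_left hs
  refine image_norm_le_of_norm_deriv_right_le_deriv_boundary
    (f := fun τ => (γ' τ - γ τ) - (γ' s - γ s)) (a := s) (b := T)
    (f' := fun τ => hamField H τ (γ' τ) - hamField H τ (γ τ))
    (B := fun τ => ‖γ' s - γ s‖ * (Real.exp (c * (τ - s)) - 1))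
    (B' := fun τ => ‖γ' s - γ s‖ * (Real.exp (c * (τ - s)) * c))
    (((hγ'.continuousOn.sub hγ.continuousOn).mono hsub).sub continuousOn_const)
    (fun τ hτ => ((hγ'.hasDerivWithinAt_Ici (hsub' hτ)).sub
      (hγ.hasDerivWithinAt_Ici (hsub' hτ))).sub_const _)
    (by simp) (fun τ => ?_) (fun τ hτ => ?_) ht
  · have h1 : HasDerivAt (fun τ => c * (τ - s)) c τ := by
      simpa using ((hasDerivAt_id τ).sub_const s).const_mul c
    exact (h1.exp.sub_const 1).const_mul _
  · have h1 := h.norm_hamField_sub_le (hsub (Ico_subset_Icc_self hτ)) (γ' τ) (γ τ)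
    have h2 := mul_le_mul_of_nonneg_left
      (h.norm_sub_le hγ hγ' hs (Ico_subset_Icc_self hτ)) h.nonneg
    linarith

theorem norm_sub_initial_le (hγ : IsTrajectory H T γ) (hs : 0 ≤ s) (ht : t ∈ Icc s T) :
    ‖γ t - γ s‖ ≤ M * (t - s) :=
  have hsub : Icc s T ⊆ Icc 0 T := Icc_subset_Icc_left hs
  norm_image_sub_le_of_norm_deriv_right_le_segment (hγ.continuousOn.mono hsub)
    (fun _ hτ => hγ.hasDerivWithinAt_Ici (Ico_subset_Ico_left hs hτ))
    (fun _ hτ => h.norm_hamField_le (hsub (Ico_subset_Icc_self hτ)) _) t ht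

theorem continuousOn_hamField_comp (hγ : IsTrajectory H T γ) :
    ContinuousOn (fun τ => hamField H τ (γ τ)) (Icc 0 T) :=
  h.continuousOn_hamField.comp (continuousOn_id.prodMk hγ.continuousOn) fun _ hτ => ⟨hτ, mem_univ _⟩

theorem continuousOn_actionDensity (hγ : IsTrajectory H T γ) (y : Base d) :
    ContinuousOn (actionDensity H y γ) (Icc 0 T) := by
  have h1 : ContinuousOn (fun τ => H τ (γ τ)) (Icc 0 T) :=
    h.cont.comp (continuousOn_id.prodMk hγ.continuousOn) fun _ hτ => ⟨hτ, mem_univ _⟩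
  have h2 : ContinuousOn (fun τ => (γ τ).mom - y) (Icc 0 T) :=
    (Cot.continuous_mom.comp_continuousOn hγ.continuousOn).sub continuousOn_const
  exact (h2.inner (𝕜 := ℝ)
    (Cot.continuous_pos.comp_continuousOn (h.continuousOn_hamField_comp hγ))).sub h1

/-- The first variation of the action, with a quadratic remainder. -/
theorem abs_action_sub_le (hγ : IsTrajectory H T γ) (hγ' : IsTrajectory H T γ') (hs : 0 ≤ s)
    (hst : s ≤ t) (ht : t ≤ T) (hexp : Real.exp (c * (t - s)) ≤ 2) :
    |(∫ τ in s..t, actionDensity H (γ' s).mom γ' τ) - (∫ τ in s..t, actionDensity H (γ s).mom γ τ)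
      - (inner ℝ ((γ t).mom - (γ s).mom) ((γ' t).pos - (γ t).pos)
        - inner ℝ ((γ t).pos - (γ s).pos) ((γ' s).mom - (γ s).mom))|
      ≤ 6 * c * (t - s) * ‖γ' s - γ s‖ ^ 2 := by
  have hsub : Icc s t ⊆ Icc 0 T := Icc_subset_Icc hs ht
  -- The expected first variation up to time τ; its derivative `b'` is compared with the difference
  -- of the integrands.
  set b : ℝ → ℝ := fun τ => inner ℝ ((γ τ).mom - (γ s).mom) ((γ' τ).pos - (γ τ).pos)
    - inner ℝ ((γ τ).pos - (γ s).pos) ((γ' s).mom - (γ s).mom) with hb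
  set b' : ℝ → ℝ := fun τ => inner ℝ ((γ τ).mom - (γ s).mom)
      ((hamField H τ (γ' τ)).pos - (hamField H τ (γ τ)).pos)
    + inner ℝ (hamField H τ (γ τ)).mom ((γ' τ).pos - (γ τ).pos)
    - inner ℝ (hamField H τ (γ τ)).pos ((γ' s).mom - (γ s).mom) with hb'
  have hpos : ∀ {γ : ℝ → Cot d}, IsTrajectory H T γ →
      ContinuousOn (fun τ => (γ τ).pos) (Icc s t) := fun hγ =>
    Cot.continuous_pos.comp_continuousOn (hγ.continuousOn.mono hsub)
  have hmom : ∀ {γ : ℝ → Cot d}, IsTrajectory H T γ →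
      ContinuousOn (fun τ => (γ τ).mom) (Icc s t) := fun hγ =>
    Cot.continuous_mom.comp_continuousOn (hγ.continuousOn.mono hsub)
  have hpos' : ∀ {γ : ℝ → Cot d}, IsTrajectory H T γ →
      ContinuousOn (fun τ => (hamField H τ (γ τ)).pos) (Icc s t) := fun hγ =>
    Cot.continuous_pos.comp_continuousOn ((h.continuousOn_hamField_comp hγ).mono hsub)
  have hmom' : ContinuousOn (fun τ => (hamField H τ (γ τ)).mom) (Icc s t) :=
    Cot.continuous_mom.comp_continuousOn ((h.continuousOn_hamField_comp hγ).mono hsub)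
  have hbc : ContinuousOn b (Icc s t) :=
    (((hmom hγ).sub continuousOn_const).inner (𝕜 := ℝ) ((hpos hγ').sub (hpos hγ))).sub
      (((hpos hγ).sub continuousOn_const).inner (𝕜 := ℝ) continuousOn_const)
  have hbc' : ContinuousOn b' (Icc s t) :=
    ((((hmom hγ).sub continuousOn_const).inner (𝕜 := ℝ) ((hpos' hγ').sub (hpos' hγ))).add
      (hmom'.inner (𝕜 := ℝ) ((hpos hγ').sub (hpos hγ)))).sub
      ((hpos' hγ).inner (𝕜 := ℝ) continuousOn_const)
  have hbd : ∀ τ ∈ Ioo s t, HasDerivAt b (b' τ) τ := fun τ hτ => by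
    have hτ' : τ ∈ Ioo 0 T := ⟨hs.trans_lt hτ.1, hτ.2.trans_le ht⟩
    have h1 := (Cot.posL d).hasFDerivAt.comp_hasDerivAt τ (hγ.hasDerivAt hτ')
    have h2 := (Cot.momL d).hasFDerivAt.comp_hasDerivAt τ (hγ.hasDerivAt hτ')
    have h3 := (Cot.posL d).hasFDerivAt.comp_hasDerivAt τ (hγ'.hasDerivAt hτ')
    have h4 := ((h2.sub_const (γ s).mom).inner ℝ (h3.sub h1)).sub
      ((h1.sub_const (γ s).pos).inner ℝ (hasDerivAt_const τ ((γ' s).mom - (γ s).mom)))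
    refine h4.congr_deriv ?_
    simp [hb', sub_eq_add_neg]
  have hint : ∀ {f : ℝ → ℝ}, ContinuousOn f (Icc s t) →
      IntervalIntegrable f MeasureTheory.volume s t := fun hf =>
    hf.intervalIntegrable_of_Icc hst
  have hFTC := intervalIntegral.integral_eq_sub_of_hasDerivAt_of_le hst hbc hbd (hint hbc')
  have hb0 : b s = 0 := by simp [hb]
  have hA := hint ((h.continuousOn_actionDensity hγ (γ s).mom).mono hsub)
  have hA' := hint ((h.continuousOn_actionDensity hγ' (γ' s).mom).mono hsub)
  rw [hb0, sub_zero] at hFTC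
  change |_ - _ - b t| ≤ _
  rw [← hFTC, ← intervalIntegral.integral_sub hA' hA,
    ← intervalIntegral.integral_sub (hA'.sub hA) (hint hbc'), ← Real.norm_eq_abs]
  refine (intervalIntegral.norm_integral_le_of_norm_le_const
    (C := 6 * c * ‖γ' s - γ s‖ ^ 2) fun τ hτ => ?_).trans ?_
  swap
  · rw [abs_of_nonneg (sub_nonneg.2 hst)]
    exact le_of_eq (by ring)
  rw [uIoc_of_le hst] at hτ
  have hτ0 : τ ∈ Icc 0 T := hsub (Ioc_subset_Icc_self hτ)
  have hτs : τ ∈ Icc s T := ⟨hτ.1.le, hτ.2.trans ht⟩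
  have hc := h.nonneg
  have hexp' : Real.exp (c * (τ - s)) ≤ 2 :=
    (Real.exp_le_exp.2 (mul_le_mul_of_nonneg_left (by linarith [hτ.2]) hc)).trans hexp
  have h0 := norm_nonneg (γ' s - γ s)
  have h1 : ‖γ' τ - γ τ‖ ≤ 2 * ‖γ' s - γ s‖ := by
    nlinarith [h.norm_sub_le hγ hγ' hs hτs]
  have h2 : ‖(γ' τ - γ τ) - (γ' s - γ s)‖ ≤ ‖γ' s - γ s‖ := by
    nlinarith [h.norm_sub_sub_le hγ hγ' hs hτs]
  have h3 := h.norm_hamField_sub_le hτ0 (γ' τ) (γ τ)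
  have h4 := h.abs_sub_sub_fderiv_le hτ0 (γ τ) (γ' τ)
  have h5 := inner_hamField (h.diff τ hτ0 (γ τ)) (γ' τ - γ τ)
  have h6 : |inner ℝ ((γ' τ - γ τ) - (γ' s - γ s)).mom
      (hamField H τ (γ' τ) - hamField H τ (γ τ)).pos| ≤
      ‖γ' s - γ s‖ * (c * (2 * ‖γ' s - γ s‖)) :=
    (abs_real_inner_le_norm _ _).trans (mul_le_mul ((Cot.norm_mom_le _).trans h2)
      (((Cot.norm_pos_le _).trans h3).trans (mul_le_mul_of_nonneg_left h1 hc))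
      (norm_nonneg _) h0)
  -- Hamilton's equations cancel all first order terms. With δ = ‖γ' s − γ s‖ the bilinear term is
  -- at most 2cδ² and the Taylor remainder of H at most 4cδ², which explains the constant 6.
  have h7 : actionDensity H (γ' s).mom γ' τ - actionDensity H (γ s).mom γ τ - b' τ =
      inner ℝ ((γ' τ - γ τ) - (γ' s - γ s)).mom (hamField H τ (γ' τ) - hamField H τ (γ τ)).pos
      - (H τ (γ' τ) - H τ (γ τ) - fderiv ℝ (H τ) (γ τ) (γ' τ - γ τ)) := by
    rw [← h5, hb']
    simp only [actionDensity, Cot.mom_sub, Cot.pos_sub, inner_sub_left, inner_sub_right]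
    rw [real_inner_comm (γ' τ).mom (hamField H τ (γ τ)).pos,
      real_inner_comm (γ τ).mom (hamField H τ (γ τ)).pos,
      real_inner_comm (γ' s).mom (hamField H τ (γ τ)).pos,
      real_inner_comm (γ s).mom (hamField H τ (γ τ)).pos]
    ring
  have h8 : c * ‖γ' τ - γ τ‖ ^ 2 ≤ c * (2 * ‖γ' s - γ s‖) ^ 2 :=
    mul_le_mul_of_nonneg_left (pow_le_pow_left₀ (norm_nonneg _) h1 2) hc
  rw [Real.norm_eq_abs, h7]
  refine (abs_sub _ _).trans ?_
  nlinarith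

end IsHamiltonian

/-- `φ` has bounded Lipschitz partial gradients `p` and `q`. -/
structure IsCOneOne (φ : Base d → Base d → ℝ) (p q : Base d → Base d → Base d) (M : ℝ) :
    Prop where
  nonneg : 0 ≤ M
  taylor : ∀ x y x' y', |φ x' y' - φ x y - (inner ℝ (p x y) (x' - x) + inner ℝ (q x y) (y' - y))|
    ≤ M * (‖x' - x‖ + ‖y' - y‖) ^ 2
  bound_fst : ∀ x y, ‖p x y‖ ≤ M
  bound_snd : ∀ x y, ‖q x y‖ ≤ M
  lip_fst : ∀ x y x' y', ‖p x' y' - p x y‖ ≤ M * (‖x' - x‖ + ‖y' - y‖)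
  lip_snd : ∀ x y x' y', ‖q x' y' - q x y‖ ≤ M * (‖x' - x‖ + ‖y' - y‖)

namespace IsHamiltonian

variable (h : IsHamiltonian H T c M) {s t : ℝ}
include h

theorem norm_alphaMap_sub_sub_le (hs : 0 ≤ s) (ht : t ∈ Icc s T) (z z' : Cot d) :
    ‖(alphaMap H T s t z' - z') - (alphaMap H T s t z - z)‖
      ≤ (Real.exp (c * (t - s)) - 1) * ‖z' - z‖ := by
  have hs' : s ∈ Icc 0 T := ⟨hs, ht.1.trans ht.2⟩
  obtain ⟨γ, rfl, hγ⟩ := h.exists_isTrajectory hs' z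
  obtain ⟨γ', rfl, hγ'⟩ := h.exists_isTrajectory hs' z'
  have h1 := h.norm_sub_sub_le hγ hγ' hs ht
  have h2 : ∀ w : Cot d, alphaMap H T s t w - w = cotMk (hamFlow H T s t w - w).pos 0 := fun w => by
    unfold alphaMap
    ext i
    rcases i with i | i
    · rfl
    · exact sub_self _
  rw [h2, h2, h.hamFlow_eq hγ hs ht, h.hamFlow_eq hγ' hs ht, mul_comm]
  refine (Cot.norm_le_add _).trans (le_trans ?_ h1)
  rw [Cot.pos_sub, Cot.mom_sub, Cot.mom_cotMk, Cot.mom_cotMk, sub_zero, norm_zero, add_zero,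
    Cot.pos_cotMk, Cot.pos_cotMk, ← Cot.pos_sub]
  refine (Cot.norm_pos_le _).trans (le_of_eq ?_)
  congr 1
  abel

/-- A preimage of w is a fixed point of the contraction z ↦ w − (α z − z); surjectivity makes
`Function.invFun` a right inverse. -/
theorem surjective_alphaMap (hs : 0 ≤ s) (ht : t ∈ Icc s T)
    (hexp : Real.exp (c * (t - s)) < 2) : Function.Surjective (alphaMap H T s t) := by
  intro w
  have hκ : 0 ≤ Real.exp (c * (t - s)) - 1 :=
    sub_nonneg.2 (Real.one_le_exp (mul_nonneg h.nonneg (sub_nonneg.2 ht.1)))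
  have hcontr : ContractingWith (Real.exp (c * (t - s)) - 1).toNNReal
      (fun z => w - (alphaMap H T s t z - z)) := by
    refine ⟨?_, LipschitzWith.of_dist_le_mul fun z z' => ?_⟩
    · rw [Real.toNNReal_lt_one]
      linarith
    · rw [Real.coe_toNNReal _ hκ, dist_eq_norm, dist_eq_norm, sub_sub_sub_cancel_left,
        norm_sub_rev z z']
      exact h.norm_alphaMap_sub_sub_le hs ht z z'
  have hfix := hcontr.fixedPoint_isFixedPt
  refine ⟨ContractingWith.fixedPoint _ hcontr, ?_⟩
  have h1 : w - (alphaMap H T s t (ContractingWith.fixedPoint _ hcontr) -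
    ContractingWith.fixedPoint _ hcontr) = ContractingWith.fixedPoint _ hcontr := hfix
  rw [sub_sub_eq_add_sub, sub_eq_iff_eq_add, add_comm w, add_right_inj] at h1
  exact h1.symm

/-- The generating function has bounded Lipschitz partial gradients `Y - y` and `x - X`. -/
theorem exists_isCOneOne_genFun (hs : 0 ≤ s) (hst : s ≤ t) (htT : t ≤ T)
    (hexp : Real.exp (c * (t - s)) < 2) :
    ∃ p q M', IsCOneOne (genFun H T s t) p q M' := by
  have hs' : s ∈ Icc 0 T := ⟨hs, hst.trans htT⟩
  have ht : t ∈ Icc s T := ⟨hst, htT⟩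
  have hM : 0 ≤ M := (norm_nonneg _).trans (h.norm_hamField_le hs' 0)
  choose γ hγs hγ using h.exists_isTrajectory hs'
  set ζ : Base d → Base d → Cot d := fun x y =>
    Function.invFun (alphaMap H T s t) (cotMk x y) with hζ
  have hα : ∀ x y, alphaMap H T s t (ζ x y) = cotMk x y := fun x y =>
    Function.rightInverse_invFun (h.surjective_alphaMap hs ht hexp) _
  have hflow : ∀ z, ∀ τ ∈ Icc s t, hamFlow H T s τ z = γ z τ := fun z τ hτ => by
    have := h.hamFlow_eq (hγ z) hs ⟨hτ.1, hτ.2.trans htT⟩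
    rwa [hγs] at this
  have hpos : ∀ x y, (γ (ζ x y) t).pos = x := fun x y => by
    have := congrArg Cot.pos (hα x y)
    rwa [alphaMap, Cot.pos_cotMk, Cot.pos_cotMk, hflow _ t (right_mem_Icc.2 hst)] at this
  have hmom : ∀ x y, (γ (ζ x y) s).mom = y := fun x y => by
    rw [hγs]
    exact congrArg Cot.mom (hα x y)
  have hgen : ∀ x y, genFun H T s t x y =
      ∫ τ in s..t, actionDensity H (γ (ζ x y) s).mom (γ (ζ x y)) τ := fun x y => by
    refine intervalIntegral.integral_congr fun τ hτ => ?_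
    rw [uIcc_of_le hst] at hτ
    simp only [actionDensity]
    rw [hmom, ← hflow _ τ hτ]
  -- As α minus the identity has Lipschitz constant κ = e^{c(t−s)} − 1, its inverse has Lipschitz
  -- constant 1/(1 − κ).
  set Λ := (2 - Real.exp (c * (t - s)))⁻¹ with hΛ
  have hΛ0 : 0 < 2 - Real.exp (c * (t - s)) := by linarith
  have hΛ1 : 0 < Λ := inv_pos.2 hΛ0
  have hζlip : ∀ x y x' y', ‖ζ x' y' - ζ x y‖ ≤ Λ * (‖x' - x‖ + ‖y' - y‖) := fun x y x' y' => by
    have h1 := h.norm_alphaMap_sub_sub_le hs ht (ζ x y) (ζ x' y')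
    rw [hα, hα] at h1
    have h2 : ‖cotMk x' y' - cotMk x y‖ ≤ ‖x' - x‖ + ‖y' - y‖ := Cot.norm_le_add _
    have h3 : ‖ζ x' y' - ζ x y‖ ≤ ‖cotMk x' y' - cotMk x y‖
        + ‖(cotMk x' y' - ζ x' y') - (cotMk x y - ζ x y)‖ := by
      rw [show ζ x' y' - ζ x y = (cotMk x' y' - cotMk x y)
        - ((cotMk x' y' - ζ x' y') - (cotMk x y - ζ x y)) by abel]
      exact _root_.norm_sub_le _ _
    rw [hΛ, inv_mul_eq_div, le_div_iff₀ hΛ0]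
    linarith
  have hγlip : ∀ z z', ‖γ z' t - γ z t‖ ≤ 2 * ‖z' - z‖ := fun z z' => by
    have h1 := h.norm_sub_le (hγ z) (hγ z') hs ht
    rw [hγs, hγs] at h1
    nlinarith [norm_nonneg (z' - z)]
  have hdisp : ∀ z, ‖γ z t - γ z s‖ ≤ M * (t - s) := fun z => h.norm_sub_initial_le (hγ z) hs ht
  have hc := h.nonneg
  have hts : 0 ≤ t - s := sub_nonneg.2 hst
  have hC1 : 0 ≤ 6 * c * (t - s) * Λ ^ 2 := by positivity
  have hC2 : 0 ≤ M * (t - s) := by positivity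
  refine ⟨fun x y => (γ (ζ x y) t).mom - (γ (ζ x y) s).mom,
    fun x y => -((γ (ζ x y) t).pos - (γ (ζ x y) s).pos),
    6 * c * (t - s) * Λ ^ 2 + M * (t - s) + 2 * Λ + 1, by positivity, fun x y x' y' => ?_,
    fun x y => ?_, fun x y => ?_, fun x y x' y' => ?_, fun x y x' y' => ?_⟩
  · have h1 := h.abs_action_sub_le (hγ (ζ x y)) (hγ (ζ x' y')) hs hst htT hexp.le
    rw [← hgen, ← hgen, hpos, hpos, hmom, hmom, hγs, hγs] at h1
    rw [inner_neg_left, ← sub_eq_add_neg, hpos, hmom, hγs]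
    refine h1.trans ?_
    have h2 := pow_le_pow_left₀ (norm_nonneg _) (hζlip x y x' y') 2
    have h3 := mul_le_mul_of_nonneg_left h2 (show 0 ≤ 6 * c * (t - s) by positivity)
    refine h3.trans ?_
    rw [mul_pow, ← mul_assoc]
    exact mul_le_mul_of_nonneg_right (by linarith) (sq_nonneg _)
  · refine ((Cot.norm_mom_le (γ (ζ x y) t - γ (ζ x y) s)).trans (hdisp _)).trans ?_
    linarith
  · rw [norm_neg]
    refine ((Cot.norm_pos_le (γ (ζ x y) t - γ (ζ x y) s)).trans (hdisp _)).trans ?_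
    linarith
  · have h1 := (Cot.norm_mom_le (γ (ζ x' y') t - γ (ζ x y) t)).trans (hγlip _ _)
    have h2 := hζlip x y x' y'
    simp only [hmom]
    rw [Cot.mom_sub] at h1
    have h3 : ‖((γ (ζ x' y') t).mom - y') - ((γ (ζ x y) t).mom - y)‖ ≤
        ‖(γ (ζ x' y') t).mom - (γ (ζ x y) t).mom‖ + ‖y' - y‖ := by
      rw [sub_sub_sub_comm]
      exact _root_.norm_sub_le _ _
    nlinarith [norm_nonneg (x' - x), norm_nonneg (y' - y)]
  · have h1 := Cot.norm_pos_le (ζ x' y' - ζ x y)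
    have h2 := hζlip x y x' y'
    simp only [hpos, hγs]
    rw [Cot.pos_sub] at h1
    have h3 : ‖-(x' - (ζ x' y').pos) - -(x - (ζ x y).pos)‖ ≤
        ‖(ζ x' y').pos - (ζ x y).pos‖ + ‖x' - x‖ := by
      rw [show -(x' - (ζ x' y').pos) - -(x - (ζ x y).pos) =
        ((ζ x' y').pos - (ζ x y).pos) - (x' - x) by abel]
      exact _root_.norm_sub_le _ _
    nlinarith [norm_nonneg (x' - x), norm_nonneg (y' - y)]

end IsHamiltonian

/-- When s = t the generating function is an integral over a point, hence zero. This also covers T =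
0, where [0, T] has no unique derivatives. -/
theorem exists_isCOneOne_genFun {s t : ℝ}
    (hH : ContDiffOn ℝ 2 (fun q : ℝ × Cot d => H q.1 q.2) (Icc 0 T ×ˢ univ))
    (hHc : ∃ K : Set (Cot d), IsCompact K ∧ ∀ τ ∈ Icc 0 T, ∀ z ∉ K, H τ z = 0)
    (hs : 0 ≤ s) (hst : s ≤ t) (htT : t ≤ T) (hδ : hessSup H T * |t - s| < Real.log 2) :
    ∃ p q M', IsCOneOne (genFun H T s t) p q M' := by
  rcases hst.eq_or_lt with rfl | hlt
  · refine ⟨0, 0, 0, le_rfl, ?_, ?_, ?_, ?_, ?_⟩ <;> simp [genFun]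
  · obtain ⟨M, hM⟩ := exists_isHamiltonian ((hs.trans_lt hlt).trans_le htT) hH hHc
    refine hM.exists_isCOneOne_genFun hs hst htT ?_
    rw [abs_of_nonneg (sub_nonneg.2 hst)] at hδ
    rwa [← Real.lt_log_iff_exp_lt two_pos]

end HamFlow

end

/-! ### The generating families as perturbations of a quadratic form -/

noncomputable section

/-! ### Lower order terms -/

section LowerOrder

variable {B E : Type*} [NormedAddCommGroup B] [NormedSpace ℝ B] [NormedAddCommGroup E]

/-- A family of Lipschitz functions of `η`, continuously differentiable in the parameter `x`, whose
increments with respect to `x` are Lipschitz in `η`, locally uniformly in `x`. -/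
structure IsLowerOrder (G : B → E → ℝ) : Prop where
  diff : ∀ x η, DifferentiableAt ℝ (fun x' => G x' η) x
  cont : Continuous fun q : B × E => fderiv ℝ (fun x' => G x' q.2) q.1
  lip : ∀ r, ∃ L ≥ 0, ∀ x ∈ Metric.ball (0 : B) r, ∀ x' ∈ Metric.ball (0 : B) r, ∀ η η',
    |G x η - G x η'| ≤ L * ‖η - η'‖ ∧
    |(G x η - G x' η) - (G x η' - G x' η')| ≤ L * ‖x - x'‖ * ‖η - η'‖

theorem isLowerOrder_const {g : E → ℝ} {L : NNReal} (hg : LipschitzWith L g) :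
    IsLowerOrder fun (_ : B) η => g η where
  diff _ _ := differentiableAt_const _
  cont := by
    simp only [fderiv_fun_const]
    exact continuous_const
  lip _ := ⟨L, L.2, fun x _ x' _ η η' => ⟨by
    simpa [Real.dist_eq, dist_eq_norm] using hg.dist_le_mul η η', by
    simp only [sub_self, abs_zero]
    positivity⟩⟩

namespace IsLowerOrder

variable {G G' : B → E → ℝ}

theorem add (hG : IsLowerOrder G) (hG' : IsLowerOrder G') :
    IsLowerOrder fun x η => G x η + G' x η where
  diff x η := (hG.diff x η).add (hG'.diff x η)
  cont := by
    refine (hG.cont.add hG'.cont).congr fun q => ?_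
    exact (fderiv_fun_add (hG.diff q.1 q.2) (hG'.diff q.1 q.2)).symm
  lip r := by
    obtain ⟨L, hL, h⟩ := hG.lip r
    obtain ⟨L', hL', h'⟩ := hG'.lip r
    refine ⟨L + L', by positivity, fun x hx x' hx' η η' => ?_⟩
    obtain ⟨h1, h2⟩ := h x hx x' hx' η η'
    obtain ⟨h3, h4⟩ := h' x hx x' hx' η η'
    rw [abs_le] at h1 h2 h3 h4
    constructor <;> rw [abs_le] <;> constructor <;> linarith

theorem sum {ι : Type*} (t : Finset ι) {G : ι → B → E → ℝ} (hG : ∀ i ∈ t, IsLowerOrder (G i)) :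
    IsLowerOrder fun x η => ∑ i ∈ t, G i x η := by
  classical
  induction t using Finset.induction_on with
  | empty => simpa using isLowerOrder_const (B := B) (E := E) (LipschitzWith.const (0 : ℝ))
  | insert i t hi ih =>
    simp only [Finset.sum_insert hi]
    exact (hG i (Finset.mem_insert_self i t)).add
      (ih fun j hj => hG j (Finset.mem_insert_of_mem hj))

theorem exists_abs_sub_le [FiniteDimensional ℝ B] (hG : IsLowerOrder G) (r : ℝ) (η : E) :
    ∃ L ≥ 0, ∀ x ∈ Metric.ball (0 : B) r, ∀ x' ∈ Metric.ball (0 : B) r,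
      |G x η - G x' η| ≤ L * ‖x - x'‖ := by
  have : ProperSpace B := FiniteDimensional.proper_real B
  obtain ⟨L, hL⟩ := (isCompact_closedBall (0 : B) r).exists_bound_of_continuousOn
    (hG.cont.comp (continuous_id.prodMk (continuous_const (y := η)))).continuousOn
  refine ⟨max L 0, le_max_right _ _, fun x hx x' hx' => ?_⟩
  refine (convex_ball (0 : B) r).norm_image_sub_le_of_norm_fderiv_le (𝕜 := ℝ)
    (f := fun x' => G x' η) (fun y _ => hG.diff y η) (fun y hy => ?_) hx' hx
  exact (hL y (Metric.ball_subset_closedBall hy)).trans (le_max_left _ _)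

/-- Of two points, one lying in the ball is used for evaluating `g`, so `g` has to be bounded only
there; if both lie outside, both products vanish. -/
theorem abs_mul_sub_mul_le {χ g : E → ℝ} {r L L' b : ℝ}
    (hχ : ∀ η, |χ η| ≤ 1) (hχL : ∀ η η', |χ η - χ η'| ≤ L * ‖η - η'‖)
    (hχr : ∀ η, r < ‖η‖ → χ η = 0) (hg : ∀ η η', |g η - g η'| ≤ L' * ‖η - η'‖)
    (hb : ∀ η, ‖η‖ ≤ r → |g η| ≤ b) (hb0 : 0 ≤ b) (hL' : 0 ≤ L') (η η' : E) :
    |χ η * g η - χ η' * g η'| ≤ (L * b + L') * ‖η - η'‖ := by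
  have hL := (abs_nonneg _).trans (hχL η η')
  have h0 : 0 ≤ L' * ‖η - η'‖ := mul_nonneg hL' (norm_nonneg _)
  have key : ∀ ζ ζ', ‖ζ‖ ≤ r → |χ ζ * g ζ - χ ζ' * g ζ'| ≤ (L * b + L') * ‖ζ - ζ'‖ := by
    intro ζ ζ' hζ
    have h1 : χ ζ * g ζ - χ ζ' * g ζ' = (χ ζ - χ ζ') * g ζ + χ ζ' * (g ζ - g ζ') := by ring
    rw [h1]
    refine (abs_add_le _ _).trans ?_
    rw [abs_mul, abs_mul, add_mul]
    refine add_le_add ?_ ?_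
    · refine (mul_le_mul (hχL ζ ζ') (hb ζ hζ) (abs_nonneg _)
        ((abs_nonneg _).trans (hχL ζ ζ'))).trans (le_of_eq (by ring))
    · refine (mul_le_mul (hχ ζ') (hg ζ ζ') (abs_nonneg _) zero_le_one).trans (le_of_eq (one_mul _))
  rcases le_or_gt ‖η‖ r with h | h
  · exact key η η' h
  rcases le_or_gt ‖η'‖ r with h' | h'
  · rw [abs_sub_comm, norm_sub_rev]
    exact key η' η h'
  · rw [hχr η h, hχr η' h']
    have := mul_nonneg hL hb0
    simp only [zero_mul, sub_self, abs_zero]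
    linarith

theorem mul_cutoff [FiniteDimensional ℝ B] (hG : IsLowerOrder G) {χ : E → ℝ} {K : NNReal} {ρ : ℝ}
    (hχ : ∀ η, |χ η| ≤ 1) (hχL : LipschitzWith K χ) (hχr : ∀ η, ρ < ‖η‖ → χ η = 0) :
    IsLowerOrder fun x η => χ η * G x η where
  diff x η := (hG.diff x η).const_mul _
  cont := by
    refine ((hχL.continuous.comp continuous_snd).smul hG.cont).congr fun q => ?_
    exact (fderiv_const_mul (hG.diff q.1 q.2) _).symm
  lip r := by
    obtain ⟨L, hL, h⟩ := hG.lip r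
    obtain ⟨M, hM, hM'⟩ := hG.exists_abs_sub_le r 0
    have hr' : ∀ x ∈ Metric.ball (0 : B) r, (0 : B) ∈ Metric.ball (0 : B) r := fun x hx =>
      Metric.mem_ball_self (dist_nonneg.trans_lt hx)
    have hχL' : ∀ η η', |χ η - χ η'| ≤ K * ‖η - η'‖ := fun η η' => by
      simpa [Real.dist_eq, dist_eq_norm] using hχL.dist_le_mul η η'
    set b := |G 0 0| + M * |r| + L * |ρ| with hb
    have hb0 : 0 ≤ b := by positivity
    have hbG : ∀ x ∈ Metric.ball (0 : B) r, ∀ η, ‖η‖ ≤ ρ → |G x η| ≤ b := by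
      intro x hx η hη
      have h1 := (h x hx x hx η 0).1
      have h2 := hM' x hx 0 (hr' x hx)
      rw [sub_zero] at h1 h2
      have h3 : ‖x‖ ≤ |r| := (mem_ball_zero_iff.1 hx).le.trans (le_abs_self r)
      have h4 := mul_le_mul_of_nonneg_left h3 hM
      have h5 := mul_le_mul_of_nonneg_left (hη.trans (le_abs_self ρ)) hL
      have h6 := le_abs_self (G 0 0)
      have h7 := neg_abs_le (G 0 0)
      rw [abs_le] at h1 h2 ⊢
      constructor <;> linarith
    refine ⟨max (K * b + L) (K * (M + L * |ρ|) + L), le_max_of_le_left (by positivity),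
      fun x hx x' hx' η η' => ⟨?_, ?_⟩⟩
    · refine (abs_mul_sub_mul_le hχ hχL' hχr (fun η η' => (h x hx x hx η η').1) (hbG x hx) hb0 hL
        η η').trans (mul_le_mul_of_nonneg_right (le_max_left _ _) (norm_nonneg _))
    · have h1 := abs_mul_sub_mul_le (g := fun η => G x η - G x' η)
        (b := (M + L * |ρ|) * ‖x - x'‖) hχ hχL' hχr
        (fun η η' => (h x hx x' hx' η η').2) (fun ζ hζ => ?_) (by positivity) (by positivity) η η'
      · rw [← mul_sub, ← mul_sub]
        refine h1.trans (mul_le_mul_of_nonneg_right ?_ (norm_nonneg _))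
        rw [← mul_assoc, ← add_mul]
        exact mul_le_mul_of_nonneg_right (le_max_right _ _) (norm_nonneg _)
      · have h2 := (h x hx x' hx' ζ 0).2
        have h3 := hM' x hx x' hx'
        rw [sub_zero] at h2
        have h4 := mul_le_mul_of_nonneg_left (hζ.trans (le_abs_self ρ))
          (mul_nonneg hL (norm_nonneg (x - x')))
        rw [abs_le] at h2 h3 ⊢
        constructor <;> linarith

variable {P : Type*} [NormedSpace ℝ E] [NormedAddCommGroup P] [InnerProductSpace ℝ P] {k : ℕ}

/-- The sum of a lower order family and of a nondegenerate quadratic form is tame. -/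
theorem isTameFamily [FiniteDimensional ℝ B] (hG : IsLowerOrder G)
    (ℓ : E ≃L[ℝ] P × EuclideanSpace ℝ (Fin k)) {F : B → E → ℝ}
    (hF : ∀ x η, F x η = G x η + (‖(ℓ η).1‖ ^ 2 - ‖(ℓ η).2‖ ^ 2)) : IsTameFamily ℓ F where
  tame x₀ := by
    obtain ⟨L, hL, h⟩ := hG.lip (‖x₀‖ + 1)
    obtain ⟨M, hM, hM'⟩ := hG.exists_abs_sub_le (‖x₀‖ + 1) 0
    set A := ‖(ℓ.symm : P × EuclideanSpace ℝ (Fin k) →L[ℝ] E)‖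
    have hA : 0 ≤ A := ContinuousLinearMap.opNorm_nonneg _
    refine ⟨max 1 (L * A), M * (‖x₀‖ + 1) + |G 0 0|, ?_⟩
    have hnhds : Metric.ball (0 : B) (‖x₀‖ + 1) ∈ 𝓝 x₀ :=
      Metric.isOpen_ball.mem_nhds (by simp)
    filter_upwards [hnhds] with x hx
    refine ⟨le_max_left _ _, fun η η' => ?_, ?_⟩
    · rw [hF, hF, add_sub_cancel_right, add_sub_cancel_right]
      have h1 := (h x hx x hx η η').1
      have h2 : ‖η - η'‖ ≤ A * ‖ℓ (η - η')‖ := by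
        simpa using (ℓ.symm : P × EuclideanSpace ℝ (Fin k) →L[ℝ] E).le_opNorm (ℓ (η - η'))
      have h3 : ‖ℓ (η - η')‖ ≤ ‖(ℓ η).1 - (ℓ η').1‖ + ‖(ℓ η).2 - (ℓ η').2‖ := by
        rw [map_sub]
        exact max_le_add_of_nonneg (norm_nonneg _) (norm_nonneg _)
      have h4 := mul_le_mul_of_nonneg_left
        (h2.trans (mul_le_mul_of_nonneg_left h3 hA)) hL
      refine h1.trans (h4.trans ?_)
      rw [← mul_assoc]
      exact mul_le_mul_of_nonneg_right (le_max_right _ _) (by positivity)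
    · rw [hF]
      simp only [map_zero, Prod.fst_zero, Prod.snd_zero, norm_zero, sub_self, add_zero]
      have h1 := hM' x hx 0 (Metric.mem_ball_self (by positivity))
      rw [sub_zero] at h1
      have h2 := mul_le_mul_of_nonneg_left (mem_ball_zero_iff.1 hx).le hM
      have h3 := abs_sub_abs_le_abs_sub (G x 0) (G 0 0)
      linarith
  diff x η := by
    simp only [hF]
    exact (hG.diff x η).add_const _
  cont := by
    simp only [hF, fderiv_add_const]
    exact hG.cont
  lip x₀ ρ ε hε := by
    obtain ⟨L, hL, h⟩ := hG.lip (‖x₀‖ + 1)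
    have hx₀ : x₀ ∈ Metric.ball (0 : B) (‖x₀‖ + 1) := by simp
    filter_upwards [Metric.isOpen_ball.mem_nhds hx₀,
      Metric.ball_mem_nhds x₀ (show 0 < ε / (L + 1) by positivity)] with x hx hx' η _ η' _
    rw [hF, hF, hF, hF, add_sub_add_right_eq_sub, add_sub_add_right_eq_sub]
    refine (h x hx x₀ hx₀ η η').2.trans (mul_le_mul_of_nonneg_right ?_ (norm_nonneg _))
    rw [mem_ball_iff_norm, lt_div_iff₀ (by positivity)] at hx'
    linarith [norm_nonneg (x - x₀)]

end IsLowerOrder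

end LowerOrder

/-! ### Functions with Lipschitz partial gradients -/

namespace IsCOneOne

variable {d : ℕ} {φ : Base d → Base d → ℝ} {p q : Base d → Base d → Base d} {M : ℝ}
  (h : IsCOneOne φ p q M)
include h

theorem hasFDerivAt_fst (x y : Base d) : HasFDerivAt (fun x => φ x y) (innerSL ℝ (p x y)) x := by
  rw [hasFDerivAt_iff_isLittleO_nhds_zero]
  refine Asymptotics.IsBigO.trans_isLittleO (g := fun v : Base d => ‖v‖ ^ 2) ?_
    (by simpa using Asymptotics.isLittleO_norm_pow_id one_lt_two)
  refine Asymptotics.IsBigO.of_bound M (Eventually.of_forall fun v => ?_)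
  have := h.taylor x y (x + v) y
  simpa using this

theorem hasFDerivAt_snd (x y : Base d) : HasFDerivAt (fun y => φ x y) (innerSL ℝ (q x y)) y := by
  rw [hasFDerivAt_iff_isLittleO_nhds_zero]
  refine Asymptotics.IsBigO.trans_isLittleO (g := fun v : Base d => ‖v‖ ^ 2) ?_
    (by simpa using Asymptotics.isLittleO_norm_pow_id one_lt_two)
  refine Asymptotics.IsBigO.of_bound M (Eventually.of_forall fun v => ?_)
  have := h.taylor x y x (y + v)
  simpa using this

theorem continuous_fst : Continuous fun z : Base d × Base d => p z.1 z.2 := by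
  have : LipschitzWith (2 * M).toNNReal fun z : Base d × Base d => p z.1 z.2 :=
    LipschitzWith.of_dist_le_mul fun z z' => by
      rw [Real.coe_toNNReal _ (by linarith [h.nonneg]), dist_eq_norm, dist_eq_norm]
      have h1 := h.lip_fst z'.1 z'.2 z.1 z.2
      have h2 : ‖z.1 - z'.1‖ ≤ ‖z - z'‖ := norm_fst_le (z - z')
      have h3 : ‖z.2 - z'.2‖ ≤ ‖z - z'‖ := norm_snd_le (z - z')
      nlinarith [h.nonneg]
  exact this.continuous

theorem abs_sub_fst_le (x x' y : Base d) : |φ x y - φ x' y| ≤ M * ‖x - x'‖ :=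
  convex_univ.norm_image_sub_le_of_norm_hasFDerivWithin_le (𝕜 := ℝ) (f := fun x => φ x y)
    (fun x _ => (h.hasFDerivAt_fst x y).hasFDerivWithinAt)
    (fun x _ => (innerSL_apply_norm (𝕜 := ℝ) (p x y)).trans_le (h.bound_fst x y))
    (mem_univ _) (mem_univ _)

theorem abs_sub_snd_le (x y y' : Base d) : |φ x y - φ x y'| ≤ M * ‖y - y'‖ :=
  convex_univ.norm_image_sub_le_of_norm_hasFDerivWithin_le (𝕜 := ℝ) (f := fun y => φ x y)
    (fun y _ => (h.hasFDerivAt_snd x y).hasFDerivWithinAt)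
    (fun y _ => (innerSL_apply_norm (𝕜 := ℝ) (q x y)).trans_le (h.bound_snd x y))
    (mem_univ _) (mem_univ _)

theorem abs_sub_sub_le (x x' y y' : Base d) :
    |(φ x y - φ x' y) - (φ x y' - φ x' y')| ≤ M * ‖x - x'‖ * ‖y - y'‖ :=
  convex_univ.norm_image_sub_le_of_norm_hasFDerivWithin_le (𝕜 := ℝ)
    (f := fun y => φ x y - φ x' y) (f' := fun y => innerSL ℝ (q x y) - innerSL ℝ (q x' y))
    (fun y _ => ((h.hasFDerivAt_snd x y).sub (h.hasFDerivAt_snd x' y)).hasFDerivWithinAt)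
    (fun y _ => by
      rw [← map_sub, innerSL_apply_norm]
      simpa using h.lip_snd x' y x y)
    (mem_univ _) (mem_univ _)

theorem lipschitzWith {E : Type*} [NormedAddCommGroup E] {f g : E → Base d} {K K' : NNReal}
    (hf : LipschitzWith K f) (hg : LipschitzWith K' g) :
    LipschitzWith (M.toNNReal * (K + K')) fun η => φ (f η) (g η) :=
  LipschitzWith.of_dist_le_mul fun η η' => by
    rw [NNReal.coe_mul, NNReal.coe_add, Real.coe_toNNReal _ h.nonneg, Real.dist_eq]
    have h1 := h.abs_sub_fst_le (f η) (f η') (g η)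
    have h2 := h.abs_sub_snd_le (f η') (g η) (g η')
    have h3 := mul_le_mul_of_nonneg_left (hf.dist_le_mul η η') h.nonneg
    have h4 := mul_le_mul_of_nonneg_left (hg.dist_le_mul η η') h.nonneg
    rw [dist_eq_norm] at h3 h4
    refine (abs_sub_le _ (φ (f η') (g η)) _).trans ?_
    linarith

theorem isLowerOrder {E : Type*} [NormedAddCommGroup E] {g : E → Base d}
    {K : NNReal} (hg : LipschitzWith K g) : IsLowerOrder fun x η => φ x (g η) where
  diff x η := (h.hasFDerivAt_fst x (g η)).differentiableAt
  cont := by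
    refine ((innerSL ℝ).continuous.comp (h.continuous_fst.comp
      (_root_.continuous_fst.prodMk (hg.continuous.comp continuous_snd)))).congr fun z => ?_
    exact (h.hasFDerivAt_fst z.1 (g z.2)).fderiv.symm
  lip r := by
    have hM := h.nonneg
    refine ⟨M * K, by positivity, fun x _ x' _ η η' => ⟨?_, ?_⟩⟩
    · refine (h.abs_sub_snd_le x (g η) (g η')).trans ?_
      rw [mul_assoc]
      refine mul_le_mul_of_nonneg_left ?_ hM
      rw [← dist_eq_norm, ← dist_eq_norm]
      exact hg.dist_le_mul η η'
    · refine (h.abs_sub_sub_le x x' (g η) (g η')).trans ?_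
      have := hg.dist_le_mul η η'
      rw [dist_eq_norm, dist_eq_norm] at this
      refine (mul_le_mul_of_nonneg_left this (by positivity)).trans (le_of_eq (by ring))

end IsCOneOne

/-- The Lipschitz constant in η grows with x; it is for this term that `IsLowerOrder.lip` is only
local in the parameter. -/
theorem isLowerOrder_inner {V E : Type*} [NormedAddCommGroup V] [InnerProductSpace ℝ V]
    [NormedAddCommGroup E] {g : E → V} {K : NNReal} (hg : LipschitzWith K g) :
    IsLowerOrder fun (x : V) η => (inner ℝ x (g η) : ℝ) where
  diff x η := ((innerSL ℝ (g η)).differentiableAt (x := x)).congr_of_eventuallyEq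
    (Eventually.of_forall fun x' => real_inner_comm _ _)
  cont := by
    refine ((innerSL ℝ).continuous.comp (hg.continuous.comp continuous_snd)).congr fun z => ?_
    refine (HasFDerivAt.fderiv ?_).symm
    exact ((innerSL ℝ (g z.2)).hasFDerivAt (x := z.1)).congr_of_eventuallyEq
      (Eventually.of_forall fun x' => real_inner_comm _ _)
  lip r := by
    refine ⟨(|r| + 1) * K, by positivity, fun x hx x' _ η η' => ?_⟩
    have h1 := hg.dist_le_mul η η'
    rw [dist_eq_norm, dist_eq_norm] at h1
    rw [← inner_sub_left, ← inner_sub_left, ← inner_sub_right, ← inner_sub_right]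
    refine ⟨(abs_real_inner_le_norm _ _).trans ?_, (abs_real_inner_le_norm _ _).trans ?_⟩
    · have h2 : ‖x‖ ≤ |r| + 1 := by
        have := mem_ball_zero_iff.1 hx
        linarith [le_abs_self r]
      rw [mul_assoc]
      exact mul_le_mul h2 h1 (norm_nonneg _) (by positivity)
    · refine (mul_le_mul_of_nonneg_left h1 (norm_nonneg _)).trans ?_
      have h3 : 0 ≤ ‖x - x'‖ * (K * ‖η - η'‖) := by positivity
      have h4 := mul_nonneg (abs_nonneg r) h3
      linarith

end

noncomputable section

/-! ### The quadratic form at infinity -/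

/-- The negative index of a difference of squared norms. -/
theorem sigNeg_eq_finrank {E W W' : Type*} [AddCommGroup E] [Module ℝ E]
    [FiniteDimensional ℝ E] [NormedAddCommGroup W] [Module ℝ W] [FiniteDimensional ℝ W]
    [NormedAddCommGroup W'] [Module ℝ W'] [FiniteDimensional ℝ W'] (Q : QuadraticForm ℝ E)
    (e : E ≃ₗ[ℝ] W × W') (h : ∀ η, Q η = ‖(e η).1‖ ^ 2 - ‖(e η).2‖ ^ 2) :
    sigNeg Q = Module.finrank ℝ W' := by
  have hdim : Module.finrank ℝ E = Module.finrank ℝ W + Module.finrank ℝ W' := by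
    rw [e.finrank_eq, Module.finrank_prod]
  refine le_antisymm ?_ ?_
  · set V : Submodule ℝ E := LinearMap.range (e.symm.toLinearMap ∘ₗ LinearMap.inl ℝ W W')
    have hV : Module.finrank ℝ V = Module.finrank ℝ W :=
      LinearMap.finrank_range_of_inj (e.symm.injective.comp LinearMap.inl_injective)
    have := QuadraticForm.sigPos_add_finrank_le_of_nonpos (Q := -Q) (V := V) (by
      rintro _ ⟨w, rfl⟩
      simp [h])
    rw [sigPos_neg] at this
    omega
  · set V : Submodule ℝ E := LinearMap.range (e.symm.toLinearMap ∘ₗ LinearMap.inr ℝ W W')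
    have hV : Module.finrank ℝ V = Module.finrank ℝ W' :=
      LinearMap.finrank_range_of_inj (e.symm.injective.comp LinearMap.inr_injective)
    rw [← hV]
    refine le_sigNeg_of_negDef Q ?_
    rintro ⟨_, w, rfl⟩ hne
    have hw : w ≠ 0 := by
      rintro rfl
      exact hne (by simp)
    simp [h, hw]

section Coordinates

variable {d N : ℕ}

theorem nodes_zero_last (η : Fibre d N) : nodes 0 η (Fin.last N) = 0 := by
  simp [nodes]

theorem nodes_castSucc (x : Base d) (η : Fibre d N) (i : Fin N) :
    nodes x η i.castSucc = (η i).pos := by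
  simp [nodes]

theorem nodeLin_apply (j : Fin (N + 1)) (η : Fibre d N) : nodeLin d N j η = nodes 0 η j := rfl

theorem momLin_apply (i : Fin N) (η : Fibre d N) : momLin d N i η = (η i).mom := rfl

/-- The coordinates `((x_{i+1} - x_i) + y_i) / 2` and `((x_{i+1} - x_i) - y_i) / 2`. -/
def splitLin (d N : ℕ) : Fibre d N →ₗ[ℝ]
    EuclideanSpace ℝ (Fin N × Fin d) × EuclideanSpace ℝ (Fin N × Fin d) where
  toFun η := (WithLp.toLp 2 fun j =>
      ((nodeLin d N j.1.succ η - nodeLin d N j.1.castSucc η) j.2 + momLin d N j.1 η j.2) / 2,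
    WithLp.toLp 2 fun j =>
      ((nodeLin d N j.1.succ η - nodeLin d N j.1.castSucc η) j.2 - momLin d N j.1 η j.2) / 2)
  map_add' η ζ := by
    refine Prod.ext ?_ ?_ <;> ext j <;> simp <;> ring
  map_smul' c η := by
    refine Prod.ext ?_ ?_ <;> ext j <;> simp <;> ring

/-- Coordinatewise this is ab = ((a + b)/2)² − ((a − b)/2)². -/
theorem quadInfty_eq_split (η : Fibre d N) :
    quadInfty d N η = ‖(splitLin d N η).1‖ ^ 2 - ‖(splitLin d N η).2‖ ^ 2 := by
  rw [quadInfty_apply, EuclideanSpace.norm_sq_eq, EuclideanSpace.norm_sq_eq,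
    ← Finset.sum_sub_distrib, Fintype.sum_prod_type]
  refine Finset.sum_congr rfl fun i _ => ?_
  rw [PiLp.inner_apply]
  refine Finset.sum_congr rfl fun j _ => ?_
  simp only [splitLin, LinearMap.coe_mk, AddHom.coe_mk, Real.norm_eq_abs, sq_abs, nodeLin_apply,
    momLin_apply, RCLike.inner_apply, conj_trivial]
  ring

/-- In the kernel all y_i vanish and consecutive x_i agree, so they all equal x_N = 0. -/
theorem splitLin_injective : Function.Injective (splitLin d N) := by
  rw [← LinearMap.ker_eq_bot, LinearMap.ker_eq_bot']
  intro η hη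
  have h1 : ∀ i j, (nodes 0 η i.succ - nodes 0 η i.castSucc) j + (Cot.mom (η i)) j = 0 :=
    fun i j => by
      have := congrArg (fun w => w.1 (i, j)) hη
      simpa [splitLin, nodeLin_apply, momLin_apply] using this
  have h2 : ∀ i j, (nodes 0 η i.succ - nodes 0 η i.castSucc) j - (Cot.mom (η i)) j = 0 :=
    fun i j => by
      have := congrArg (fun w => w.2 (i, j)) hη
      simpa [splitLin, nodeLin_apply, momLin_apply] using this
  have hmom : ∀ i, Cot.mom (η i) = 0 := fun i => by
    ext j
    have := h1 i j
    have := h2 i j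
    change (Cot.mom (η i)) j = 0
    linarith
  have hstep : ∀ i : Fin N, nodes 0 η i.castSucc = nodes 0 η i.succ := fun i => by
    ext j
    have h3 := h1 i j
    have h4 := h2 i j
    rw [PiLp.sub_apply] at h3 h4
    linarith
  have hnode : ∀ i : Fin (N + 1), nodes 0 η i = 0 := fun i => by
    induction i using Fin.reverseInduction with
    | last => exact nodes_zero_last η
    | cast i hi => rw [hstep, hi]
  ext1 i
  rw [← Cot.cotMk_pos_mom (η i), hmom, ← nodes_castSucc 0 η i, hnode, Cot.cotMk_eq, map_zero,
    map_zero, add_zero]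
  rfl

theorem finrank_fibre : Module.finrank ℝ (Fibre d N) = Module.finrank ℝ
    (EuclideanSpace ℝ (Fin N × Fin d) × EuclideanSpace ℝ (Fin N × Fin d)) := by
  rw [Module.finrank_pi_fintype, Module.finrank_prod]
  simp
  ring

theorem indexInfty_eq (d N : ℕ) : indexInfty d N = N * d := by
  rw [indexInfty, sigNeg_eq_finrank _
    (LinearMap.linearEquivOfInjective (splitLin d N) splitLin_injective finrank_fibre)
    fun η => quadInfty_eq_split η]
  simp

/-- The coordinates of `splitLin`, the second one being indexed by `Fin (indexInfty d N)`. -/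
def splitEquiv (d N : ℕ) : Fibre d N ≃L[ℝ]
    EuclideanSpace ℝ (Fin N × Fin d) × EuclideanSpace ℝ (Fin (indexInfty d N)) :=
  (LinearMap.linearEquivOfInjective (splitLin d N) splitLin_injective
    finrank_fibre).toContinuousLinearEquiv.trans
  ((ContinuousLinearEquiv.refl ℝ _).prodCongr
    (LinearIsometryEquiv.piLpCongrLeft 2 ℝ ℝ
      (finProdFinEquiv.trans (finCongr (indexInfty_eq d N).symm))).toContinuousLinearEquiv)

theorem quadInfty_eq (η : Fibre d N) :
    quadInfty d N η = ‖(splitEquiv d N η).1‖ ^ 2 - ‖(splitEquiv d N η).2‖ ^ 2 := by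
  rw [quadInfty_eq_split]
  have h2 : ‖(splitEquiv d N η).2‖ = ‖(splitLin d N η).2‖ :=
    LinearIsometryEquiv.norm_map (LinearIsometryEquiv.piLpCongrLeft 2 ℝ ℝ
      (finProdFinEquiv.trans (finCongr (indexInfty_eq d N).symm))) (splitLin d N η).2
  rw [h2]
  rfl

end Coordinates

/-! ### The generating families are tame -/

section Families

variable {d N : ℕ} {H : ℝ → Cot d → ℝ} {T : ℝ} {v : Base d → ℝ} {t : Fin (N + 1) → ℝ}

theorem Cot.lipschitzWith_pos : LipschitzWith 1 (Cot.pos : Cot d → Base d) :=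
  LipschitzWith.of_dist_le_mul fun z w => by
    rw [NNReal.coe_one, one_mul, dist_eq_norm, dist_eq_norm]
    exact norm_pos_le (z - w)

theorem Cot.lipschitzWith_mom : LipschitzWith 1 (Cot.mom : Cot d → Base d) :=
  LipschitzWith.of_dist_le_mul fun z w => by
    rw [NNReal.coe_one, one_mul, dist_eq_norm, dist_eq_norm]
    exact norm_mom_le (z - w)

theorem lipschitzWith_pos_apply (i : Fin N) :
    LipschitzWith 1 fun η : Fibre d N => (η i).pos := by
  have := (Cot.lipschitzWith_pos (d := d)).comp
    (LipschitzWith.eval (α := fun _ : Fin N => Cot d) i)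
  rwa [mul_one] at this

theorem lipschitzWith_mom_apply (i : Fin N) :
    LipschitzWith 1 fun η : Fibre d N => (η i).mom := by
  have := (Cot.lipschitzWith_mom (d := d)).comp
    (LipschitzWith.eval (α := fun _ : Fin N => Cot d) i)
  rwa [mul_one] at this

/-- The difference `S - Q` is a lower order family. -/
theorem isLowerOrder_genFamily_sub (hN : 0 < N) (hv : ∃ L, LipschitzWith L v)
    (hφ : ∀ i : Fin N, ∃ p q M, IsCOneOne (genFun H T (t i.castSucc) (t i.succ)) p q M) :
    IsLowerOrder fun x η => genFamily H T v t x η - quadInfty d N η := by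
  obtain ⟨L, hL⟩ := hv
  obtain ⟨n, rfl⟩ := Nat.exists_eq_succ_of_ne_zero hN.ne'
  have h1 : IsLowerOrder fun (_ : Base d) (η : Fibre d (n + 1)) => v (η 0).pos :=
    isLowerOrder_const (hL.comp (lipschitzWith_pos_apply 0))
  have h2 : ∀ i ∈ Finset.univ, IsLowerOrder fun (x : Base d) (η : Fibre d (n + 1)) =>
      genFun H T (t i.castSucc) (t i.succ) (nodes x η i.succ) (η i).mom := by
    intro i _
    obtain ⟨p, q, M, h⟩ := hφ i
    -- Only the last generating function involves x; the others depend on η alone.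
    induction i using Fin.lastCases with
    | last =>
      simp only [nodes, Fin.succ_last, Fin.snoc_last]
      exact h.isLowerOrder (lipschitzWith_mom_apply (Fin.last n))
    | cast i =>
      simp only [← Fin.castSucc_succ, nodes_castSucc]
      exact isLowerOrder_const
        (h.lipschitzWith (lipschitzWith_pos_apply _) (lipschitzWith_mom_apply _))
  -- S contains (x − x_{N−1}) · y_{N−1} where Q has −x_{N−1} · y_{N−1}; this is their difference.
  have h3 : IsLowerOrder fun (x : Base d) (η : Fibre d (n + 1)) =>
      (inner ℝ x (η (Fin.last n)).mom : ℝ) :=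
    isLowerOrder_inner (lipschitzWith_mom_apply (Fin.last n))
  have h4 := (h1.add (IsLowerOrder.sum Finset.univ h2)).add h3
  convert! h4 using 3 with x η
  rw [genFamily, quadInfty_apply, add_sub_assoc, ← Finset.sum_sub_distrib]
  have h5 : nodes x η 0 = (η 0).pos := nodes_castSucc x η 0
  rw [h5]
  congr 1
  rw [Fin.sum_univ_castSucc]
  simp only [← inner_sub_left, nodes_castSucc, ← Fin.castSucc_succ, sub_self,
    Finset.sum_const_zero, zero_add, Fin.succ_last, nodes_zero_last]
  simp [nodes]

theorem isTameFamily_of_isFamily (hN : 0 < N) (hv : ∃ L, LipschitzWith L v)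
    (hφ : ∀ i : Fin N, ∃ p q M, IsCOneOne (genFun H T (t i.castSucc) (t i.succ)) p q M)
    {F : Base d → Fibre d N → ℝ} (hF : IsFamily H T v t F) :
    IsTameFamily (splitEquiv d N) F := by
  have hG := isLowerOrder_genFamily_sub hN hv hφ
  rcases hF with rfl | ⟨θ, a, hθ, hθc, hθI, -, ha, rfl⟩
  · refine hG.isTameFamily _ fun x η => ?_
    rw [← quadInfty_eq, sub_add_cancel]
  · obtain ⟨K, hK⟩ := hθ.lipschitzWith_of_hasCompactSupport hθc (by simp)
    obtain ⟨ρ, hρ⟩ := hθc.isBounded.subset_closedBall 0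
    have hχL : LipschitzWith (K * ‖a⁻¹‖₊) fun η => θ (a⁻¹ • η) :=
      hK.comp (lipschitzWith_smul a⁻¹)
    refine (hG.mul_cutoff (χ := fun η => θ (a⁻¹ • η)) (ρ := a * ρ) (fun η => ?_) hχL
      fun η hη => ?_).isTameFamily _ fun x η => ?_
    · rw [abs_of_nonneg (hθI _).1]
      exact (hθI _).2
    · by_contra hne
      have h1 := mem_closedBall_zero_iff.1 (hρ (subset_tsupport θ hne))
      rw [norm_smul, norm_inv, Real.norm_of_nonneg ha.le, inv_mul_le_iff₀ ha] at h1
      exact absurd h1 (not_le.2 hη)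
    · rw [← quadInfty_eq, truncFamily]

end Families

end

/-- For a compactly supported `C²` Hamiltonian `H` on `[0, T] × T* ℝ ^ d`, a Lipschitz function `v`,
a subdivision `t_0 ≤ … ≤ t_N` in `[0, T]` of mesh less than `δ_H = ln 2 / c_H`, and for `F` either
the associated generating family or one of its truncations: the minmax function `R_F` is well
defined and locally Lipschitz, and `∂R_F (x) ⊆ co {∂_x F (x, η) : η ∈ C (x)}`. -/
theorem proposition2p15 {d N : ℕ} (hN : 0 < N) (T : ℝ)
    (H : ℝ → Cot d → ℝ)
    (hH : ContDiffOn ℝ 2 (fun q : ℝ × Cot d => H q.1 q.2) (Icc 0 T ×ˢ univ))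
    (hHc : ∃ K : Set (Cot d), IsCompact K ∧ ∀ τ ∈ Icc 0 T, ∀ z ∉ K, H τ z = 0)
    (v : Base d → ℝ) (hv : ∃ L, LipschitzWith L v)
    (t : Fin (N + 1) → ℝ) (htm : Monotone t) (ht0 : 0 ≤ t 0) (htT : t (Fin.last N) ≤ T)
    (htδ : ∀ i : Fin N, hessSup H T * |t i.succ - t i.castSucc| < Real.log 2)
    (F : Base d → Fibre d N → ℝ) (hF : IsFamily H T v t F) :
    (∀ x, ∀ᶠ a in atTop,
      IsGLB (cycleMaxima (F x) (indexInfty d N) a) (minmaxFun F (indexInfty d N) x)) ∧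
    LocallyLipschitz (minmaxFun F (indexInfty d N)) ∧
    ∀ x, clarkeDeriv (minmaxFun F (indexInfty d N)) x ⊆
      convexHull ℝ ((fun η => fderiv ℝ (fun x' => F x' η) x) '' critSet F (indexInfty d N) x) := by
  have h := isTameFamily_of_isFamily hN hv (fun i => exists_isCOneOne_genFun hH hHc
    (ht0.trans (htm (Fin.zero_le _))) (htm i.castSucc_lt_succ.le)
    ((htm (Fin.le_last _)).trans htT) (htδ i)) hF
  exact ⟨h.eventually_isGLB_cycleMaxima, h.locallyLipschitz_minmaxFun,
    h.clarkeDeriv_minmaxFun_subset⟩
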